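/- Lemma (Harmonic Level Set Lemma). Let $\Delta\subset\mathbb{R}^2$ be the closed unit disc, $\Delta^o$ its interior, and write $\partial_+\Delta=\{(x,y)\in\partial\Delta: y\ge 0\}$, $\partial_+^o\Delta=\{(x,y)\in\partial\Delta: y>0\}$ and $\partial_-\Delta=\{(x,y)\in\partial\Delta: y\le 0\}$. A planar graph is a set of points (nodes) in $\mathbb{R}^2$ together with a set of continuous curves (edges), each from a node to a node; edges do not meet themselves, each other or a node except at their end points. Multiple edges and loops are allowed. The valence of a node is the number of edge ends at it, and every node has valence at least $1$. A graph is a tree graph if it is connected and simply connected. Let $h:\Delta\to\mathbb{R}$ be continuous on $\Delta$, and harmonic and real-analytic on $\Delta\setminus\partial_-\Delta$. Let $a\in\mathbb{R}$ and let $U$ be a nonempty union of connected components of the level set $\{p\in\Delta: h(p)=a\}$. Assume that: (a) $h$ is nonconstant on $\partial_+\Delta$, and $h$, as a function on $\Delta$, has no local extremum at any point of $\partial_+^o\Delta$; that is, for each $p\in\partial_+^o\Delta$, every neighborhood of $p$ in $\Delta$ contains points where $h<h(p)$ and points where $h>h(p)$; (b) $U\cap\partial_-\Delta$ consists of exactly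 $m$ points, where $m$ is a nonnegative integer. Then $U$ has at most $m$ connected components. Each component $P$ of $U$ is either a single point of $\partial_-\Delta$, or is (the point set of) a planar graph, all points of $P\cap\partial\Delta$ being nodes, (1) which is a finite tree graph, (2) all of whose nodes in $\Delta^o$ have even valence at least $4$, (3) which has at least one node on $\partial_-\Delta$, (4) which has at most one node on $\partial_+\Delta$. -/

import Mathlib

open Set Topology

namespace HarmonicLevelSet

/-- The closed unit disc. -/
def disc : Set ℂ := Metric.closedBall 0 1

/-- The open unit disc. -/
def openDisc : Set ℂ := Metric.ball 0 1

/-- The unit circle, the boundary of the disc. -/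
def circle : Set ℂ := Metric.sphere 0 1

/-- The closed upper arc `y ≥ 0` of the unit circle. -/
def upperArc : Set ℂ := {z | z ∈ circle ∧ 0 ≤ z.im}

/-- The open upper arc `y > 0` of the unit circle. -/
def openUpperArc : Set ℂ := {z | z ∈ circle ∧ 0 < z.im}

/-- The closed lower arc `y ≤ 0` of the unit circle. -/
def lowerArc : Set ℂ := {z | z ∈ circle ∧ z.im ≤ 0}

/-- The level set `h = a` on the closed disc. -/
def levelSet (h : ℂ → ℝ) (a : ℝ) : Set ℂ := {z | z ∈ disc ∧ h z = a}

/-- The set of connected components of a subset of the plane. -/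
def components (S : Set ℂ) : Set (Set ℂ) := {P | ∃ x ∈ S, P = connectedComponentIn S x}

/-- A planar graph: a set of nodes in the plane and a family of edges, each edge being a continuous
curve from a node to a node. Loops and multiple edges are allowed. Edges do not cross themselves,
each other, or a node, except at their end points, and every node has an edge emanating from it. -/
structure PlanarGraph where
  /-- The nodes. -/
  nodes : Set ℂ
  /-- The index type of the edges. -/
  Edge : Type
  /-- The curve of an edge, parametrized by `[0, 1]`. -/
  curve : Edge → C(unitInterval, ℂ)
  source_mem : ∀ e, curve e 0 ∈ nodes
  target_mem : ∀ e, curve e 1 ∈ nodes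
  injOn : ∀ e, InjOn (curve e) (Ioo 0 1)
  notMem_nodes : ∀ e, ∀ t ∈ Ioo (0 : unitInterval) 1, curve e t ∉ nodes
  disjoint : ∀ e e', e ≠ e' → Disjoint (curve e '' Ioo 0 1) (curve e' '' Ioo 0 1)
  exists_edge : ∀ v ∈ nodes, ∃ e, curve e 0 = v ∨ curve e 1 = v

namespace PlanarGraph

/-- The set of points of the plane lying on the graph. -/
def support (G : PlanarGraph) : Set ℂ := G.nodes ∪ ⋃ e, range (G.curve e)

/-- The valence of a node: the number of edge ends at it, so that a loop counts twice. -/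
noncomputable def valence (G : PlanarGraph) (v : ℂ) : ℕ∞ :=
  {e | G.curve e 0 = v}.encard + {e | G.curve e 1 = v}.encard

/-- The graph has finitely many nodes and edges. -/
def IsFinite (G : PlanarGraph) : Prop := G.nodes.Finite ∧ Finite G.Edge

/-- A tree graph: a graph which is connected and simply connected. -/
def IsTree (G : PlanarGraph) : Prop := IsConnected G.support ∧ IsSimplyConnected G.support

end PlanarGraph

end HarmonicLevelSet

namespace HarmonicLevelSet

/-! ### Continuous logarithms and separation of the plane -/

/-! Let `f` be holomorphic on the open disc with real part `h`. Near an interior point of a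
component `P` of the level set there is a coordinate `u` in which `f` is a constant plus `u ^ k`, so
`P` is the set where `u ^ k` is imaginary. At a regular point (`k = 1`) this is an arc along which
`T = Im f` is strictly monotone. At a critical point it consists of `2 * k` rays with `k ≥ 2`; along
`k` of them `T` increases, along the other `k` it decreases. This gives the even valence of at least
`4`.

The global structure rests on the maximum principle (`IsAdmissible.maximum_principle`). A compact
part of the level set cannot separate the plane, since a bounded complementary region would have its
boundary in the set `h = a` (`IsAdmissible.isPreconnected_compl`). A component cannot meet the upper
arc twice, since together with the part of the arc between the two points it would enclose a region,
on whose closure `h` would have an extremum that is forbidden even on the open upper arc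
(`IsAdmissible.subsingleton_inter_upperArc`).

The topological tool is `exists_cut`, proved with continuous logarithms instead of the Jordan curve
theorem: if a compact set does not separate the plane and is an arc near one of its points, then
that point cuts it into two closed pieces meeting only there. Applied to a regular point of `P`,
with `B = P ∩ circle` finite, it shows that each of the two pieces contains a point of `B`, because
`T` has no extremum in `P \ B`. Two regular points that divide `B` in the same way lie on the same
edge (`IsCurveSystem.exists_connecting`), so there are finitely many edges; hence there are finitely
many branch points and every edge converges to a node at both ends. Cutting at an inner point of an
edge also shows that removing an edge leaves two disjoint connected pieces, and induction on the
number of edges contracts `P` to a point (`IsCurveSystem.deformsTo_of_saturated`).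

A component that enters the open disc has at least two points on the circle, by cutting, and at most
one on the upper arc, so it meets the lower arc. A single point of the open upper arc is not a
component, for otherwise it would be isolated in the level set and so a local extremum. Choosing a
point of the lower arc in each component gives the bound `m`. -/

lemma eq_zero_of_exp_eq_one {u : ℂ} (h : Complex.exp u = 1) (h' : |u.im| < 2 * Real.pi) :
    u = 0 := by
  obtain ⟨n, rfl⟩ := Complex.exp_eq_one_iff.1 h
  have e : ((n : ℂ) * (2 * Real.pi * Complex.I)).im = n * (2 * Real.pi) := by simp
  rw [e, abs_mul, abs_of_pos Real.two_pi_pos] at h'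
  have h2 : |(n : ℝ)| < 1 := by
    by_contra! h3
    nlinarith [Real.two_pi_pos]
  have : |n| < 1 := by exact_mod_cast h2
  rw [Int.abs_lt_one_iff] at this
  simp [this]

/-- The values of `d` are integer multiples of `2 * π * I`, so a continuous `d` is locally constant;
a change smaller than one is no change. -/
lemma eq_of_exp_eq_of_isPreconnected {X : Type*} [TopologicalSpace X] {S : Set X}
    (hS : IsPreconnected S) {d : X → ℂ} (hd : ContinuousOn d S)
    (h : ∀ x ∈ S, Complex.exp (d x) = 1) {x y : X} (hx : x ∈ S) (hy : y ∈ S) : d x = d y := by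
  refine hS.induction₂ (fun x y => d x = d y) (fun x hx => ?_)
    (fun _ _ _ _ _ _ => Eq.trans) (fun _ _ _ _ => Eq.symm) hx hy
  filter_upwards [(hd x hx).eventually (Metric.ball_mem_nhds (d x) one_pos), self_mem_nhdsWithin]
    with z hz hzS
  have : d z - d x = 0 := by
    apply eq_zero_of_exp_eq_one
    · rw [Complex.exp_sub, h x hx, h z hzS, div_one]
    · rw [dist_eq_norm] at hz
      have := Complex.abs_im_le_norm (d z - d x)
      linarith [Real.pi_gt_three]
  exact (sub_eq_zero.1 this).symm

/-- If `K` does not separate the plane, then `(z - w) / (z - w')` has a continuous logarithm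
on `K`. -/
lemma exists_continuousOn_exp_mul_sub_eq {K : Set ℂ} (hK : IsClosed K) (hc : IsPreconnected Kᶜ)
    {w w' : ℂ} (hw : w ∉ K) (hw' : w' ∉ K) :
    ∃ g : ℂ → ℂ, ContinuousOn g K ∧ ∀ z ∈ K, Complex.exp (g z) * (z - w') = z - w := by
  have symm : ∀ x y : ℂ, (∃ g : ℂ → ℂ, ContinuousOn g K ∧
      ∀ z ∈ K, Complex.exp (g z) * (z - y) = z - x) → ∃ g : ℂ → ℂ, ContinuousOn g K ∧
      ∀ z ∈ K, Complex.exp (g z) * (z - x) = z - y := by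
    rintro x y ⟨g, hg, h⟩
    refine ⟨fun z => -g z, hg.neg, fun z hz => ?_⟩
    rw [← h z hz, ← mul_assoc, ← Complex.exp_add]; simp
  -- Having such a logarithm is an equivalence relation between `w` and `w'`. It holds for nearby
  -- points of the complement of `K`, where the quotient stays within distance one of `1` and the
  -- principal logarithm serves. Connectedness of the complement does the rest.
  refine hc.induction₂ (fun w w' => ∃ g : ℂ → ℂ, ContinuousOn g K ∧
      ∀ z ∈ K, Complex.exp (g z) * (z - w') = z - w) (fun w₀ h₀ => ?_) ?_
      (fun x y _ _ => symm x y) hw hw'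
  · obtain ⟨ε, ε0, hε⟩ := Metric.isOpen_iff.1 hK.isOpen_compl w₀ h₀
    filter_upwards [mem_nhdsWithin_of_mem_nhds (Metric.ball_mem_nhds w₀ ε0)] with w hw
    apply symm
    have key : ∀ z ∈ K, z - w₀ ≠ 0 ∧ (z - w) / (z - w₀) ∈ Complex.slitPlane := by
      intro z hz
      have h1 : ε ≤ ‖z - w₀‖ := by
        by_contra! h
        exact hε (by rwa [Metric.mem_ball, dist_eq_norm]) hz
      have h2 : z - w₀ ≠ 0 := norm_pos_iff.1 (by linarith)
      refine ⟨h2, ?_⟩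
      have : (z - w) / (z - w₀) = 1 + (w₀ - w) / (z - w₀) := by field_simp; ring
      rw [this]
      apply Complex.mem_slitPlane_of_norm_lt_one
      rw [norm_div, div_lt_one (by linarith), norm_sub_rev]
      rw [Metric.mem_ball, dist_eq_norm] at hw
      linarith
    refine ⟨fun z => Complex.log ((z - w) / (z - w₀)), ?_, fun z hz => ?_⟩
    · refine ContinuousOn.clog (ContinuousOn.div (by fun_prop) (by fun_prop) ?_) ?_
      · exact fun z hz => (key z hz).1
      · exact fun z hz => (key z hz).2
    · rw [Complex.exp_log (Complex.slitPlane_ne_zero (key z hz).2)]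
      have := (key z hz).1
      field_simp
  · rintro x y z - - - ⟨g, hg, h⟩ ⟨g', hg', h'⟩
    refine ⟨fun z => g z + g' z, hg.add hg', fun t ht => ?_⟩
    rw [Complex.exp_add, mul_assoc, h' t ht, h t ht]

/-- Strict differentiability controls the difference quotient with both points moving. The bound `1
/ 8` makes the ratio of two such normalized quotients differ from `1` by less than `1`, as the next
lemma shows, so the ratio has a principal logarithm. -/
lemma exists_norm_sub_le_of_hasStrictDerivAt {ψ : ℂ → ℂ} {c : ℂ} (h : HasStrictDerivAt ψ c 0)
    (hc : c ≠ 0) : ∃ r > 0, ∀ u ∈ Metric.ball (0 : ℂ) r, ∀ v ∈ Metric.ball (0 : ℂ) r, u ≠ v →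
      ‖(ψ u - ψ v) / ((u - v) * c) - 1‖ ≤ 1 / 8 := by
  have h1 := h.hasStrictFDerivAt.isLittleO
  have h2 := h1.def (show 0 < ‖c‖ / 8 by positivity)
  obtain ⟨r, r0, hr⟩ := Metric.eventually_nhds_iff_ball.1 h2
  refine ⟨r, r0, fun u hu v hv huv => ?_⟩
  have h3 := hr (u, v) (by
    rw [← ball_prod_same]; exact ⟨hu, hv⟩)
  have h4 : u - v ≠ 0 := sub_ne_zero.2 huv
  have e : (ψ u - ψ v) / ((u - v) * c) - 1 = (ψ u - ψ v - (u - v) * c) / ((u - v) * c) := by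
    field_simp
  rw [e, norm_div, norm_mul, div_le_iff₀ (by positivity)]
  simp at h3
  calc _ ≤ _ := h3
    _ = _ := by ring

lemma norm_div_sub_one_lt {a b : ℂ} (ha : ‖a - 1‖ ≤ 1 / 8) (hb : ‖b - 1‖ ≤ 1 / 8) :
    b ≠ 0 ∧ ‖a / b - 1‖ < 1 := by
  have hb1 : 7 / 8 ≤ ‖b‖ := by
    have := norm_sub_norm_le (1 : ℂ) (1 - b)
    rw [norm_sub_rev 1 b] at this
    simp at this
    linarith
  have hb0 : b ≠ 0 := norm_pos_iff.1 (by linarith)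
  refine ⟨hb0, ?_⟩
  have : a / b - 1 = ((a - 1) - (b - 1)) / b := by field_simp; ring
  rw [this, norm_div, div_lt_one (by linarith)]
  have := norm_sub_le (a - 1) (b - 1)
  linarith

lemma re_pos_of_norm_sub_one_lt {z : ℂ} (h : ‖z - 1‖ < 1) : 0 < z.re := by
  have := (Complex.abs_re_le_norm (z - 1)).trans_lt h
  rw [abs_lt] at this
  simp at this
  linarith

lemma abs_arg_lt_of_norm_sub_one_lt {z : ℂ} (h : ‖z - 1‖ < 1) : |z.arg| < Real.pi / 2 :=
  Complex.abs_arg_lt_pi_div_two_iff.2 (Or.inl (re_pos_of_norm_sub_one_lt h))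

/-- For `w = t + I * ε` one has `w / conj w = exp (2 * I * arg w)`. This logarithm is continuous
along the whole real line, and its imaginary part tends to `0` at one end and to `2 * π` at the
other. This is the winding that `exists_cut` detects. -/
lemma exp_two_mul_arg_mul_I {t ε : ℝ} (hε : 0 < ε) :
    Complex.exp (2 * (t + Complex.I * ε : ℂ).arg * Complex.I) * (t - Complex.I * ε) =
      t + Complex.I * ε := by
  set w : ℂ := t + Complex.I * ε with hw
  have hw0 : w ≠ 0 := by
    intro h
    have := congrArg Complex.im h
    simp [hw] at this
    exact hε.ne' this
  have h1 : (t - Complex.I * ε : ℂ) = (starRingEnd ℂ) w := by simp [hw, sub_eq_add_neg]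
  have h2 : (‖w‖ : ℂ) * Complex.exp (w.arg * Complex.I) = w := Complex.norm_mul_exp_arg_mul_I w
  have h3 : w * (starRingEnd ℂ) w = (‖w‖ : ℂ) ^ 2 := Complex.mul_conj' w
  have h4 : Complex.exp (2 * w.arg * Complex.I) = Complex.exp (w.arg * Complex.I) ^ 2 := by
    rw [← Complex.exp_nat_mul]; congr 1; push_cast; ring
  rw [h1, h4]
  have h5 : (‖w‖ : ℂ) ≠ 0 := by simpa using hw0
  apply mul_left_cancel₀ (pow_ne_zero 2 h5)
  calc (‖w‖ : ℂ) ^ 2 * (Complex.exp (w.arg * Complex.I) ^ 2 * (starRingEnd ℂ) w)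
      = ((‖w‖ : ℂ) * Complex.exp (w.arg * Complex.I)) ^ 2 * (starRingEnd ℂ) w := by ring
    _ = w * (w * (starRingEnd ℂ) w) := by rw [h2]; ring
    _ = _ := by rw [h3]; ring

end HarmonicLevelSet

/-! ### Cutting a nonseparating compact set at a point where it is an arc. -/

namespace HarmonicLevelSet

/-- If a compact set `K` does not separate the plane and is an arc near one of its points, then
this point cuts `K` into two pieces, one on each side. -/
lemma exists_cut {K : Set ℂ} (hK : IsCompact K) (hc : IsPreconnected Kᶜ)
    (ψ : OpenPartialHomeomorph ℂ ℂ) {c : ℂ} (h0 : (0 : ℂ) ∈ ψ.source) (hψ : HasStrictDerivAt ψ c 0)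
    (hc0 : c ≠ 0) (hψK : ∀ u ∈ ψ.source, ψ u ∈ K ↔ u.re = 0) :
    ∃ X Y : Set ℂ, IsClosed X ∧ IsClosed Y ∧ X ∪ Y = K ∧ X ∩ Y = {ψ 0} ∧
      ∃ δ > 0, ∀ t : ℝ, 0 ≤ t → t ≤ δ → ψ (t * Complex.I) ∈ X ∧ ψ (-t * Complex.I) ∈ Y := by
  -- Take two points `ψ ε` and `ψ (-ε)` on the two sides of the arc. Since `K` does not separate
  -- them, the quotient `q` of the distances to them, as complex numbers, has a continuous logarithm
  -- `g` on `K`. Away from the arc `g` differs from the principal logarithm of `q` by a locally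
  -- constant function `D`. Along the arc the logarithm gains about `2 * π * I`, so `D` differs at
  -- the two ends of the arc, and the values of `D` separate `K`.
  obtain ⟨r₁, r₁0, hr₁⟩ := exists_norm_sub_le_of_hasStrictDerivAt hψ hc0
  obtain ⟨r₂, r₂0, hr₂⟩ := Metric.isOpen_iff.1 ψ.open_source 0 h0
  set δ := min r₁ r₂ / 2 with hδ
  have δ0 : 0 < δ := by positivity
  have hδ1 : δ < r₁ := by have := min_le_left r₁ r₂; have := lt_min r₁0 r₂0; linarith
  have hδ2 : δ < r₂ := by have := min_le_right r₁ r₂; have := lt_min r₁0 r₂0; linarith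
  have hsrc : ∀ u : ℂ, ‖u‖ ≤ δ → u ∈ ψ.source := fun u hu => hr₂ (by
    rw [mem_ball_zero_iff]; linarith)
  have hball : ∀ u : ℂ, ‖u‖ ≤ δ → u ∈ Metric.ball (0 : ℂ) r₁ := fun u hu => by
    rw [mem_ball_zero_iff]; linarith
  have hnI : ∀ t : ℝ, ‖(t * Complex.I : ℂ)‖ = |t| := fun t => by simp
  have hsegK : ∀ t : ℝ, |t| ≤ δ → ψ (t * Complex.I) ∈ K := fun t ht =>
    (hψK _ (hsrc _ (by rwa [hnI]))).2 (by simp)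
  set W := ψ '' Metric.ball 0 δ with hW
  have hWo : IsOpen W := ψ.isOpen_image_of_subset_source Metric.isOpen_ball
    (fun u hu => hsrc u (by rw [mem_ball_zero_iff] at hu; exact hu.le))
  have hxW : ψ 0 ∈ W := ⟨0, by simpa using δ0, rfl⟩
  have hnotW : ∀ u : ℂ, ‖u‖ = δ → ψ u ∉ W := by
    rintro u hu ⟨v, hv, hvu⟩
    rw [mem_ball_zero_iff] at hv
    have := ψ.injOn (hsrc v hv.le) (hsrc u hu.le) hvu
    rw [this] at hv; exact hv.ne hu
  obtain ⟨η, η0, hη⟩ := Metric.isOpen_iff.1 hWo _ hxW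
  have hcont0 : Filter.Tendsto ψ (𝓝 0) (𝓝 (ψ 0)) := ψ.continuousAt h0
  -- With both points within `η / 8` of `ψ 0`, for `z` in `K` off `W` the numerator of `q z - 1` is
  -- below `η / 4` and its denominator above `7 * η / 8`.
  obtain ⟨ε₁, ε₁0, hε₁⟩ := Metric.eventually_nhds_iff_ball.1
    (hcont0.eventually (Metric.ball_mem_nhds (ψ 0) (show 0 < η / 8 by positivity)))
  set ε := min ε₁ δ / 2 with hε
  have ε0 : 0 < ε := by positivity
  have hεε₁ : ε < ε₁ := by have := min_le_left ε₁ δ; have := lt_min ε₁0 δ0; linarith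
  have hεδ : ε < δ := by have := min_le_right ε₁ δ; have := lt_min ε₁0 δ0; linarith
  have hwε : ‖ψ ε - ψ 0‖ < η / 8 := by
    have := hε₁ ε (by rw [mem_ball_zero_iff]; simpa [abs_of_pos ε0] using hεε₁)
    rwa [dist_eq_norm] at this
  have hwε' : ‖ψ (-ε) - ψ 0‖ < η / 8 := by
    have := hε₁ (-ε) (by rw [mem_ball_zero_iff]; simpa [abs_of_pos ε0] using hεε₁)
    rwa [dist_eq_norm] at this
  have hnε : ‖(ε : ℂ)‖ ≤ δ := by simpa [abs_of_pos ε0] using hεδ.le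
  have hnε' : ‖(-ε : ℂ)‖ ≤ δ := by simpa [abs_of_pos ε0] using hεδ.le
  have hwK : ψ ε ∉ K := by rw [hψK _ (hsrc _ hnε)]; simpa using ε0.ne'
  have hwK' : ψ (-ε) ∉ K := by rw [hψK _ (hsrc _ hnε')]; simpa using ε0.ne'
  obtain ⟨g, hg, hgq⟩ := exists_continuousOn_exp_mul_sub_eq hK.isClosed hc hwK hwK'
  set q : ℂ → ℂ := fun z => (z - ψ ε) / (z - ψ (-ε)) with hq
  have hne : ∀ z ∈ K, z - ψ (-ε) ≠ 0 := fun z hz h => hwK' (sub_eq_zero.1 h ▸ hz)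
  have hexpg : ∀ z ∈ K, Complex.exp (g z) = q z := fun z hz => by
    rw [hq, eq_div_iff (hne z hz), hgq z hz]
  set K' := K \ W with hK'
  have hK'c : IsClosed K' := hK.isClosed.sdiff hWo
  have hq1 : ∀ z ∈ K', ‖q z - 1‖ < 1 := by
    rintro z ⟨hzK, hzW⟩
    have h1 : η ≤ ‖z - ψ 0‖ := by
      by_contra! h
      exact hzW (hη (by rwa [Metric.mem_ball, dist_eq_norm]))
    have h2 : 7 / 8 * η < ‖z - ψ (-ε)‖ := by
      have e : z - ψ 0 = (z - ψ (-ε)) + (ψ (-ε) - ψ 0) := by ring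
      have := norm_add_le (z - ψ (-ε)) (ψ (-ε) - ψ 0)
      rw [← e] at this
      linarith
    have h3 := hne z hzK
    have e : q z - 1 = ((ψ (-ε) - ψ 0) - (ψ ε - ψ 0)) / (z - ψ (-ε)) := by
      rw [hq]; field_simp; ring
    rw [e, norm_div, div_lt_one (by linarith)]
    have := norm_sub_le (ψ (-ε) - ψ 0) (ψ ε - ψ 0)
    linarith
  -- the comparison of `g` with the principal logarithm off the arc
  set D : ℂ → ℂ := fun z => g z - Complex.log (q z) with hD
  have hqc : ContinuousOn q K' := ContinuousOn.div (by fun_prop) (by fun_prop)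
    (fun z hz => hne z hz.1)
  have hqslit : ∀ z ∈ K', q z ∈ Complex.slitPlane := fun z hz =>
    Or.inl (re_pos_of_norm_sub_one_lt (hq1 z hz))
  have hDc : ContinuousOn D K' := (hg.mono sdiff_subset).sub (hqc.clog hqslit)
  have hDexp : ∀ z ∈ K', Complex.exp (D z) = 1 := fun z hz => by
    rw [hD, Complex.exp_sub, hexpg z hz.1, Complex.exp_log (Complex.slitPlane_ne_zero (hqslit z hz)),
      div_self (Complex.slitPlane_ne_zero (hqslit z hz))]
  -- the explicit logarithm on the arc
  set α : ℂ → ℂ → ℂ := fun u v => (ψ u - ψ v) / ((u - v) * c) with hα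
  set ρ : ℝ → ℂ := fun t => α (t * Complex.I) ε / α (t * Complex.I) (-ε) with hρ
  have hIε : ∀ t : ℝ, (t * Complex.I : ℂ) - ε ≠ 0 := fun t h => by
    have := congrArg Complex.re h; simp at this; exact ε0.ne' this
  have hIε' : ∀ t : ℝ, (t * Complex.I : ℂ) - (-ε) ≠ 0 := fun t h => by
    have := congrArg Complex.re h; simp at this; exact ε0.ne' this
  have hα1 : ∀ t : ℝ, |t| ≤ δ → ‖α (t * Complex.I) ε - 1‖ ≤ 1 / 8 := fun t ht =>
    hr₁ _ (hball _ (by rwa [hnI])) _ (hball _ hnε) (sub_ne_zero.1 (hIε t))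
  have hα2 : ∀ t : ℝ, |t| ≤ δ → ‖α (t * Complex.I) (-ε) - 1‖ ≤ 1 / 8 := fun t ht =>
    hr₁ _ (hball _ (by rwa [hnI])) _ (hball _ hnε') (sub_ne_zero.1 (hIε' t))
  have hρ1 : ∀ t : ℝ, |t| ≤ δ → ‖ρ t - 1‖ < 1 := fun t ht =>
    (norm_div_sub_one_lt (hα1 t ht) (hα2 t ht)).2
  have hρslit : ∀ t : ℝ, |t| ≤ δ → ρ t ∈ Complex.slitPlane := fun t ht =>
    Or.inl (re_pos_of_norm_sub_one_lt (hρ1 t ht))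
  set G : ℝ → ℂ := fun t =>
    Complex.log (ρ t) + 2 * ((t + Complex.I * ε : ℂ).arg : ℂ) * Complex.I with hG
  have hψI : ContinuousOn (fun t : ℝ => ψ (t * Complex.I)) (Icc (-δ) δ) :=
    ψ.continuousOn.comp (by fun_prop) (fun t ht => hsrc _ (by rw [hnI]; exact abs_le.2 ht))
  have hGc : ContinuousOn G (Icc (-δ) δ) := by
    refine ContinuousOn.add (ContinuousOn.clog (ContinuousOn.div ?_ ?_ ?_) ?_) ?_
    · exact ContinuousOn.div (hψI.sub continuousOn_const) (by fun_prop) fun t _ => mul_ne_zero (hIε t) hc0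
    · exact ContinuousOn.div (hψI.sub continuousOn_const) (by fun_prop) fun t _ => mul_ne_zero (hIε' t) hc0
    · exact fun t ht => (norm_div_sub_one_lt (hα1 t (abs_le.2 ht)) (hα2 t (abs_le.2 ht))).1
    · exact fun t ht => hρslit t (abs_le.2 ht)
    · have : Continuous fun t : ℝ => (t + Complex.I * ε : ℂ).arg := by
        refine continuous_iff_continuousAt.2 fun t => ?_
        refine ContinuousAt.comp (f := fun t : ℝ => (t + Complex.I * ε : ℂ))
          (Complex.continuousAt_arg (Or.inr ?_)) (by fun_prop)
        simpa using ε0.ne'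
      exact ((continuous_const.mul (Complex.continuous_ofReal.comp this)).mul
        continuous_const).continuousOn
  have hGexp : ∀ t : ℝ, |t| ≤ δ → Complex.exp (G t) = q (ψ (t * Complex.I)) := by
    intro t ht
    have h1 := exp_two_mul_arg_mul_I (t := t) ε0
    have h2 := hne _ (hsegK t ht)
    have h3 := (norm_div_sub_one_lt (hα1 t ht) (hα2 t ht)).1
    have h6 := hIε t
    have h7 := hIε' t
    rw [hG, Complex.exp_add, Complex.exp_log (Complex.slitPlane_ne_zero (hρslit t ht)), hρ, hα, hq]
    have h4 : (t : ℂ) - Complex.I * ε ≠ 0 := fun h => by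
      have := congrArg Complex.im h; simp at this; exact ε0.ne' this
    rw [← eq_div_iff h4] at h1
    simp only [h1]
    -- Numerator and denominator on the right are `I` times those on the left.
    have h5 : ((t : ℂ) + Complex.I * ε) / (t - Complex.I * ε) =
        (t * Complex.I - ε) / (t * Complex.I - (-ε)) := by
      rw [div_eq_div_iff h4 h7]
      ring_nf
      simp only [Complex.I_sq]
      ring
    rw [h5]
    field_simp
  have hd : ∀ s ∈ Icc (-δ) δ, ∀ t ∈ Icc (-δ) δ,
      g (ψ (s * Complex.I)) - G s = g (ψ (t * Complex.I)) - G t := by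
    intro s hs t ht
    refine eq_of_exp_eq_of_isPreconnected isPreconnected_Icc
      (d := fun t : ℝ => g (ψ (t * Complex.I)) - G t) ?_ (fun t ht => ?_) hs ht
    · exact ContinuousOn.sub (hg.comp hψI fun t ht => hsegK t (abs_le.2 ht)) hGc
    · have ht' := abs_le.2 ht
      rw [Complex.exp_sub, hGexp t ht', hexpg _ (hsegK t ht'), div_self]
      rw [← hexpg _ (hsegK t ht')]; exact Complex.exp_ne_zero _
  have hδm : δ ∈ Icc (-δ) δ := ⟨by linarith, le_rfl⟩
  have hδm' : -δ ∈ Icc (-δ) δ := ⟨le_rfl, by linarith⟩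
  have hδK : ψ (δ * Complex.I) ∈ K' := ⟨hsegK δ (abs_le.2 hδm), hnotW _ (by simp [abs_of_pos δ0])⟩
  have hδK' : ψ ((-δ : ℝ) * Complex.I) ∈ K' :=
    ⟨hsegK (-δ) (abs_le.2 hδm'), hnotW _ (by simp [abs_of_pos δ0])⟩
  have himG : ∀ t, (G t).im = (ρ t).arg + 2 * (t + Complex.I * ε : ℂ).arg := fun t => by
    simp [hG, Complex.log_im]
  have e1 : G δ = Complex.log (q (ψ (δ * Complex.I))) := by
    rw [← sub_eq_zero]
    apply eq_zero_of_exp_eq_one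
    · rw [Complex.exp_sub, hGexp _ (abs_le.2 hδm),
        Complex.exp_log (Complex.slitPlane_ne_zero (hqslit _ hδK)),
        div_self (Complex.slitPlane_ne_zero (hqslit _ hδK))]
    · rw [Complex.sub_im, himG, Complex.log_im]
      have h1 := abs_lt.1 (abs_arg_lt_of_norm_sub_one_lt (hρ1 δ (abs_le.2 hδm)))
      have h2 := abs_lt.1 (abs_arg_lt_of_norm_sub_one_lt (hq1 _ hδK))
      have h3 : |(δ + Complex.I * ε : ℂ).arg| < Real.pi / 2 :=
        Complex.abs_arg_lt_pi_div_two_iff.2 (Or.inl (by simpa using δ0))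
      have h4 : 0 ≤ (δ + Complex.I * ε : ℂ).arg := Complex.arg_nonneg_iff.2 (by simpa using ε0.le)
      have h3 := abs_lt.1 h3
      rw [abs_lt]; constructor <;> linarith
  -- At `-δ` the argument exceeds `π / 2`, so the imaginary part of `G` exceeds `π - π / 2`, whereas
  -- that of the principal logarithm stays below `π / 2`.
  have e2 : G (-δ) ≠ Complex.log (q (ψ ((-δ : ℝ) * Complex.I))) := by
    intro h
    have := congrArg Complex.im h
    rw [himG, Complex.log_im] at this
    have h1 := abs_lt.1 (abs_arg_lt_of_norm_sub_one_lt (hρ1 (-δ) (abs_le.2 hδm')))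
    have h2 := abs_lt.1 (abs_arg_lt_of_norm_sub_one_lt (hq1 _ hδK'))
    have h3 : Real.pi / 2 < ((-δ : ℝ) + Complex.I * ε : ℂ).arg := by
      by_contra! h
      rw [Complex.arg_le_pi_div_two_iff] at h
      rcases h with h | h
      · simp at h; linarith
      · simp at h; linarith
    linarith
  set d₀ := D (ψ (δ * Complex.I)) with hd₀
  have hD' : D (ψ ((-δ : ℝ) * Complex.I)) ≠ d₀ := by
    intro h
    have := hd _ hδm _ hδm'
    rw [e1] at this
    apply e2
    simp only [hd₀, hD] at h
    linear_combination h + this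
  -- Values of `D` differ by multiples of `2 * π * I`, so `D z ≠ d₀` is equivalent to a closed
  -- condition.
  have hdich : ∀ z ∈ K', D z ≠ d₀ → 1 ≤ ‖D z - d₀‖ := by
    intro z hz hne
    by_contra! h
    refine hne (sub_eq_zero.1 (eq_zero_of_exp_eq_one ?_ ?_))
    · rw [Complex.exp_sub, hDexp z hz, hDexp _ hδK, div_one]
    · have := Complex.abs_im_le_norm (D z - d₀)
      linarith [Real.pi_gt_three]
  have hK₁ : IsClosed (K' ∩ D ⁻¹' {d₀}) :=
    hDc.preimage_isClosed_of_isClosed hK'c isClosed_singleton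
  have hK₂ : IsClosed (K' ∩ D ⁻¹' {w | 1 ≤ ‖w - d₀‖}) :=
    hDc.preimage_isClosed_of_isClosed hK'c (isClosed_le (by fun_prop) (by fun_prop))
  have hS₁ : IsClosed ((fun t : ℝ => ψ (t * Complex.I)) '' Icc 0 δ) :=
    (isCompact_Icc.image_of_continuousOn
      (hψI.mono (Icc_subset_Icc_left (by linarith)))).isClosed
  have hS₂ : IsClosed ((fun t : ℝ => ψ (t * Complex.I)) '' Icc (-δ) 0) :=
    (isCompact_Icc.image_of_continuousOn
      (hψI.mono (Icc_subset_Icc_right (by linarith)))).isClosed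
  refine ⟨K' ∩ D ⁻¹' {d₀} ∪ (fun t : ℝ => ψ (t * Complex.I)) '' Icc 0 δ,
    K' ∩ D ⁻¹' {w | 1 ≤ ‖w - d₀‖} ∪ (fun t : ℝ => ψ (t * Complex.I)) '' Icc (-δ) 0,
    hK₁.union hS₁, hK₂.union hS₂, ?_, ?_, δ, δ0, ?_⟩
  · apply Subset.antisymm
    · rintro z ((⟨hz, -⟩ | ⟨t, ht, rfl⟩) | (⟨hz, -⟩ | ⟨t, ht, rfl⟩))
      · exact hz.1
      · exact hsegK t (abs_le.2 ⟨by linarith [ht.1], ht.2⟩)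
      · exact hz.1
      · exact hsegK t (abs_le.2 ⟨ht.1, by linarith [ht.2]⟩)
    · intro z hz
      by_cases hzW : z ∈ W
      · obtain ⟨u, hu, rfl⟩ := hzW
        rw [mem_ball_zero_iff] at hu
        have hre := (hψK u (hsrc u hu.le)).1 hz
        have hu' : u = (u.im : ℂ) * Complex.I := by
          apply Complex.ext <;> simp [hre]
        have him := (Complex.abs_im_le_norm u).trans hu.le
        rw [abs_le] at him
        rcases le_total 0 u.im with h | h
        · exact Or.inl (Or.inr ⟨u.im, ⟨h, him.2⟩, by simp only [← hu']⟩)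
        · exact Or.inr (Or.inr ⟨u.im, ⟨him.1, h⟩, by simp only [← hu']⟩)
      · by_cases h : D z = d₀
        · exact Or.inl (Or.inl ⟨⟨hz, hzW⟩, h⟩)
        · exact Or.inr (Or.inl ⟨⟨hz, hzW⟩, hdich z ⟨hz, hzW⟩ h⟩)
  · have hinj : ∀ s t : ℝ, |s| ≤ δ → |t| ≤ δ → ψ (s * Complex.I) = ψ (t * Complex.I) → s = t := by
      intro s t hs ht h
      have := ψ.injOn (hsrc _ (by rwa [hnI])) (hsrc _ (by rwa [hnI])) h
      simpa using this
    have hend : ∀ t : ℝ, |t| ≤ δ → ψ (t * Complex.I) ∈ K' → |t| = δ := by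
      intro t ht h
      by_contra h'
      exact h.2 ⟨_, by rw [mem_ball_zero_iff, hnI]; exact lt_of_le_of_ne ht h', rfl⟩
    apply Subset.antisymm
    · rintro z ⟨⟨hz, hz1⟩ | ⟨t, ht, rfl⟩, ⟨hz', hz2⟩ | ⟨s, hs, hst⟩⟩
      · exfalso
        simp only [mem_preimage, mem_singleton_iff] at hz1
        simp only [mem_preimage, mem_ofPred_eq, hz1, sub_self, norm_zero] at hz2
        linarith
      · exfalso
        subst hst
        have hs' : |s| ≤ δ := abs_le.2 ⟨hs.1, by linarith [hs.2]⟩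
        have := hend s hs' hz
        rw [abs_of_nonpos hs.2] at this
        obtain rfl : s = -δ := by linarith
        exact hD' hz1
      · exfalso
        have ht' : |t| ≤ δ := abs_le.2 ⟨by linarith [ht.1], ht.2⟩
        have := hend t ht' hz'
        rw [abs_of_nonneg ht.1] at this
        subst this
        simp only [mem_preimage, mem_ofPred_eq] at hz2
        rw [← hd₀, sub_self, norm_zero] at hz2
        linarith
      · have := hinj s t (abs_le.2 ⟨hs.1, by linarith [hs.2]⟩)
          (abs_le.2 ⟨by linarith [ht.1], ht.2⟩) hst
        obtain rfl : t = 0 := le_antisymm (this ▸ hs.2) ht.1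
        simp
    · rintro _ rfl
      exact ⟨Or.inr ⟨0, ⟨le_rfl, δ0.le⟩, by simp⟩, Or.inr ⟨0, ⟨by linarith, le_rfl⟩, by simp⟩⟩
  · intro t h0 hδ
    exact ⟨Or.inr ⟨t, ⟨h0, hδ⟩, rfl⟩, Or.inr ⟨-t, ⟨by linarith, by linarith⟩, by simp⟩⟩

end HarmonicLevelSet

namespace HarmonicLevelSet

/-! ### Local form of a holomorphic function -/

/-- Near every point a nonconstant holomorphic function is a power in a suitable local
coordinate. -/
lemma exists_chart {f : ℂ → ℂ} {y : ℂ} (hf : AnalyticAt ℂ f y) (hne : ¬ ∀ᶠ z in 𝓝 y, f z = f y)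
    {V : Set ℂ} (hV : V ∈ 𝓝 y) :
    ∃ (k : ℕ) (ρ : ℝ) (c : ℂ) (ψ : OpenPartialHomeomorph ℂ ℂ), k ≠ 0 ∧ 0 < ρ ∧ c ≠ 0 ∧
      ψ.source = Metric.ball 0 ρ ∧ ψ.target ⊆ V ∧ ψ 0 = y ∧ HasStrictDerivAt ψ c 0 ∧
      (∀ u ∈ ψ.source, f (ψ u) = f y + u ^ k) ∧
      ∀ u ∈ ψ.source, deriv f (ψ u) ≠ 0 ↔ u ≠ 0 ∨ k = 1 := by
  have hfa : AnalyticAt ℂ (fun z => f z - f y) y := hf.sub analyticAt_const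
  obtain ⟨n, g, hg, hg0, hfg⟩ := hfa.exists_eventuallyEq_pow_smul_nonzero_iff.2
    (by simpa only [sub_eq_zero] using hne)
  have hn : n ≠ 0 := by
    rintro rfl
    have := hfg.self_of_nhds
    simp at this
    exact hg0 this.symm
  have hnC : (n : ℂ) ≠ 0 := Nat.cast_ne_zero.2 hn
  -- A holomorphic `n`-th root of `g` near `y`: a fixed root of `g y` times the principal root of `g
  -- z / g y`, which is close to `1`. The chart is the local inverse of `φ z = (z - y) * G z`.
  set G : ℂ → ℂ := fun z => g y ^ (1 / n : ℂ) * Complex.exp (Complex.log (g z / g y) / n) with hG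
  have hGa : AnalyticAt ℂ G y := by
    refine analyticAt_const.mul (AnalyticAt.cexp' (AnalyticAt.div (AnalyticAt.clog
      (hg.div analyticAt_const hg0) ?_) analyticAt_const hnC))
    simp [hg0]
  have hGn : ∀ᶠ z in 𝓝 y, G z ^ n = g z := by
    filter_upwards [hg.continuousAt.eventually_ne hg0] with z hz
    simp only [hG]
    rw [mul_pow, ← Complex.exp_nat_mul, mul_div_cancel₀ _ hnC, Complex.exp_log (div_ne_zero hz hg0),
      one_div, Complex.cpow_nat_inv_pow _ hn, mul_div_cancel₀ _ hg0]
  have hG0 : G y ≠ 0 := by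
    intro h
    have := hGn.self_of_nhds
    rw [h, zero_pow hn] at this
    exact hg0 this.symm
  set φ : ℂ → ℂ := fun z => (z - y) * G z with hφ
  have hφa : AnalyticAt ℂ φ y := (analyticAt_id.sub analyticAt_const).mul hGa
  have hφy : φ y = 0 := by simp [hφ]
  have hφd : deriv φ y = G y := by
    have h1 : HasDerivAt φ (1 * G y + (y - y) * deriv G y) y :=
      ((hasDerivAt_id y).sub_const y).mul hGa.differentiableAt.hasDerivAt
    simpa using h1.deriv
  have hd0 : deriv φ y ≠ 0 := hφd ▸ hG0
  have hfφ : ∀ᶠ z in 𝓝 y, f z = f y + φ z ^ n := by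
    filter_upwards [hfg, hGn] with z h1 h2
    rw [hφ, mul_pow, h2, ← smul_eq_mul, ← h1]; ring
  have hfd : ∀ᶠ z in 𝓝 y, deriv f z = n * φ z ^ (n - 1) * deriv φ z := by
    filter_upwards [hfφ.eventually_nhds, hφa.eventually_analyticAt] with z h1 h2
    rw [Filter.EventuallyEq.deriv_eq h1]
    have := (h2.differentiableAt.hasDerivAt.pow n).const_add (f y)
    exact this.deriv
  have hφd0 : ∀ᶠ z in 𝓝 y, deriv φ z ≠ 0 := hφa.deriv.continuousAt.eventually_ne hd0
  set e := ((hφa.hasStrictDerivAt).hasStrictFDerivAt_equiv hd0).toOpenPartialHomeomorph φ with he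
  have hec : ⇑e = φ := rfl
  have hye : y ∈ e.source := HasStrictFDerivAt.mem_toOpenPartialHomeomorph_source _
  have h0e : (0 : ℂ) ∈ e.target := by have := e.map_source hye; rwa [hec, hφy] at this
  have hse : e.symm 0 = y := by have := e.left_inv hye; rwa [hec, hφy] at this
  have hcs : Filter.Tendsto e.symm (𝓝 0) (𝓝 y) := by
    have := e.continuousAt_symm h0e
    rwa [ContinuousAt, hse] at this
  obtain ⟨ρ, ρ0, hρ⟩ := Metric.eventually_nhds_iff_ball.1
    ((e.open_target.eventually_mem h0e).and (hcs.eventually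
      ((Filter.eventually_mem_set.2 hV).and (hfφ.and (hfd.and hφd0)))))
  have hsource : (e.symm.restrOpen (Metric.ball 0 ρ) Metric.isOpen_ball).source =
      Metric.ball 0 ρ := by
    rw [OpenPartialHomeomorph.restrOpen_source]
    exact inter_eq_right.2 fun u hu => (hρ u hu).1
  refine ⟨n, ρ, (deriv φ y)⁻¹, e.symm.restrOpen (Metric.ball 0 ρ) Metric.isOpen_ball, hn, ρ0,
    inv_ne_zero hd0, hsource, ?_, ?_, ?_, ?_, ?_⟩
  · intro z hz
    have h1 := OpenPartialHomeomorph.map_target _ hz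
    have h2 := OpenPartialHomeomorph.right_inv _ hz
    rw [hsource] at h1
    have := (hρ _ h1).2.1
    rw [← h2]
    exact this
  · exact hse
  · exact e.hasStrictDerivAt_symm h0e hd0 (by rw [hse]; exact hφa.hasStrictDerivAt)
  · intro u hu
    rw [hsource] at hu
    have h1 := (hρ u hu).2.2.1
    have h2 := e.right_inv (hρ u hu).1
    rw [hec] at h2
    rw [h2] at h1
    exact h1
  · intro u hu
    rw [hsource] at hu
    obtain ⟨h1, -, -, h3, h4⟩ := hρ u hu
    have h2 := e.right_inv h1
    rw [hec] at h2
    rw [h2] at h3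
    change deriv f (e.symm u) ≠ 0 ↔ _
    rw [h3]
    have : n = 1 ↔ n - 1 = 0 := by omega
    simp only [ne_eq, mul_eq_zero, hnC, h4, pow_eq_zero_iff', this]
    tauto

end HarmonicLevelSet

namespace HarmonicLevelSet

/-! ### Harmonic functions on the disc -/

/-- The functions considered: continuous on the disc, harmonic inside, analytic up to the open
upper arc, and without local extrema on the open upper arc. -/
structure IsAdmissible (h : ℂ → ℝ) : Prop where
  cont : ContinuousOn h disc
  harm : InnerProductSpace.HarmonicOnNhd h openDisc
  analytic : AnalyticOn ℝ h (disc \ lowerArc)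
  noExtr : ∀ p ∈ openUpperArc, ¬ IsLocalExtrOn h disc p

lemma isOpen_openDisc : IsOpen openDisc := Metric.isOpen_ball

lemma isCompact_disc : IsCompact disc := isCompact_closedBall 0 1

lemma openDisc_subset_disc : openDisc ⊆ disc := Metric.ball_subset_closedBall

lemma circle_subset_disc : circle ⊆ disc := Metric.sphere_subset_closedBall

lemma isClosed_circle : IsClosed circle := Metric.isClosed_sphere

lemma disc_eq_union : disc = openDisc ∪ circle := Metric.ball_union_sphere.symm

lemma closure_openDisc : closure openDisc = disc := closure_ball 0 one_ne_zero

lemma notMem_circle_of_mem_openDisc {z : ℂ} (hz : z ∈ openDisc) : z ∉ circle := by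
  intro h
  rw [openDisc, mem_ball_zero_iff] at hz
  rw [circle, mem_sphere_zero_iff_norm] at h
  exact hz.ne h

lemma mem_openDisc_of_mem_disc {z : ℂ} (hz : z ∈ disc) (hz' : z ∉ circle) : z ∈ openDisc := by
  rw [disc_eq_union] at hz
  exact hz.resolve_right hz'

lemma mem_lowerArc_or_mem_openUpperArc {z : ℂ} (hz : z ∈ circle) :
    z ∈ lowerArc ∨ z ∈ openUpperArc :=
  (le_or_gt z.im 0).imp (fun h => ⟨hz, h⟩) (fun h => ⟨hz, h⟩)

lemma openUpperArc_subset_upperArc : openUpperArc ⊆ upperArc := fun _ h => ⟨h.1, h.2.le⟩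

lemma lowerArc_subset_circle : lowerArc ⊆ circle := fun _ h => h.1

lemma isClosed_lowerArc : IsClosed lowerArc :=
  isClosed_circle.inter (isClosed_le Complex.continuous_im continuous_const)

lemma notMem_lowerArc_of_mem_openUpperArc {z : ℂ} (hz : z ∈ openUpperArc) : z ∉ lowerArc :=
  fun h => absurd hz.2 (not_lt.2 h.2)

lemma I_mem_openUpperArc : Complex.I ∈ openUpperArc := by
  constructor
  · rw [circle, mem_sphere_zero_iff_norm]; simp
  · simp

lemma openDisc_inter_ball_nonempty {z : ℂ} (hz : z ∈ disc) {r : ℝ} (hr : 0 < r) :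
    (openDisc ∩ Metric.ball z r).Nonempty := by
  rw [← closure_openDisc] at hz
  obtain ⟨w, hw, h⟩ := Metric.mem_closure_iff.1 hz r hr
  exact ⟨w, hw, by rwa [Metric.mem_ball, dist_comm]⟩

/-- A harmonic conjugate on the open disc. -/
lemma IsAdmissible.exists_analytic {h : ℂ → ℝ} (H : IsAdmissible h) :
    ∃ f : ℂ → ℂ, AnalyticOnNhd ℂ f openDisc ∧ ∀ z ∈ openDisc, (f z).re = h z :=
  H.harm.exists_analyticOnNhd_ball_re_eq

/-- Near a point of the open upper arc, the function is the real part of a holomorphic function. -/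
lemma IsAdmissible.exists_analytic_upper {h : ℂ → ℝ} (H : IsAdmissible h) {z : ℂ}
    (hz : z ∈ openUpperArc) :
    ∃ (g : ℂ → ℂ) (r : ℝ), 0 < r ∧ AnalyticOnNhd ℂ g (Metric.ball z r) ∧
      ∀ w ∈ disc ∩ Metric.ball z r, (g w).re = h w := by
  have hzD : z ∈ disc \ lowerArc :=
    ⟨circle_subset_disc hz.1, notMem_lowerArc_of_mem_openUpperArc hz⟩
  obtain ⟨k, -, hk, hka⟩ := analyticWithinAt_iff_exists_analyticAt'.1 (H.analytic z hzD)
  obtain ⟨r, r0, hr⟩ := Metric.eventually_nhds_iff_ball.1 (hka.eventually_analyticAt.and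
    (isClosed_lowerArc.isOpen_compl.eventually_mem (show z ∈ lowerArcᶜ from hzD.2)))
  have hkN : AnalyticOnNhd ℝ k (Metric.ball z r) := fun w hw => (hr w hw).1
  have hkh : ∀ w ∈ disc ∩ Metric.ball z r, k w = h w := fun w hw =>
    (hk (mem_insert_of_mem _ ⟨hw.1, (hr w hw.2).2⟩)).symm
  -- The extension `k` of `h` across the circle is so far only real-analytic. Its Laplacian is
  -- analytic as well and vanishes on the part of the ball inside the disc, hence on the whole ball
  -- by the identity theorem.
  have hΔ : AnalyticOnNhd ℝ (Laplacian.laplacian k) (Metric.ball z r) := by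
    rw [InnerProductSpace.laplacian_eq_iteratedFDeriv_complexPlane]
    intro w hw
    have h2 := hkN.iteratedFDeriv 2 w hw
    exact AnalyticAt.add
      ((ContinuousMultilinearMap.apply ℝ (fun _ : Fin 2 => ℂ) ℝ ![1, 1]).analyticAt _ |>.comp h2)
      ((ContinuousMultilinearMap.apply ℝ (fun _ : Fin 2 => ℂ) ℝ
        ![Complex.I, Complex.I]).analyticAt _ |>.comp h2)
  obtain ⟨w, hw, hwz⟩ := openDisc_inter_ball_nonempty hzD.1 r0
  have hkw : k =ᶠ[𝓝 w] h := by
    filter_upwards [isOpen_openDisc.mem_nhds hw, Metric.isOpen_ball.mem_nhds hwz] with v h1 h2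
    exact hkh v ⟨openDisc_subset_disc h1, h2⟩
  have hz0 := hΔ.eqOn_zero_of_preconnected_of_eventuallyEq_zero
    (convex_ball z r).isPreconnected hwz
    ((InnerProductSpace.harmonicAt_congr_nhds hkw).2 (H.harm w hw)).2
  have hkharm : InnerProductSpace.HarmonicOnNhd k (Metric.ball z r) := fun v hv =>
    ⟨(hkN v hv).contDiffAt, Filter.eventuallyEq_of_mem (Metric.isOpen_ball.mem_nhds hv) hz0⟩
  obtain ⟨g, hg, hgk⟩ := hkharm.exists_analyticOnNhd_ball_re_eq
  exact ⟨g, r, r0, hg, fun w hw => (hgk hw.2).trans (hkh w hw)⟩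

lemma IsLocalExtrOn_of_eventually_eq {h : ℂ → ℝ} {S : Set ℂ} {p : ℂ}
    (hp : ∀ᶠ w in 𝓝[S] p, h w = h p) : IsLocalExtrOn h S p :=
  Or.inl (hp.mono fun _ hw => hw.ge)

/-- By the open mapping theorem a nonconstant `f` takes, near `w`, all values near `f w`, among them
some with smaller and some with larger real part. -/
lemma eventually_eq_of_isLocalExtr_re {f : ℂ → ℂ} {w : ℂ} (hf : AnalyticAt ℂ f w)
    (he : IsLocalExtr (fun z => (f z).re) w) : ∀ᶠ z in 𝓝 w, f z = f w := by
  refine hf.eventually_constant_or_nhds_le_map_nhds.resolve_right fun hle => ?_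
  rcases he with he | he
  · have h1 : ∀ᶠ v in 𝓝 (f w), (f w).re ≤ v.re := hle he
    obtain ⟨ε, ε0, hε⟩ := Metric.eventually_nhds_iff_ball.1 h1
    have := hε (f w - (ε / 2 : ℝ)) (by
      rw [Metric.mem_ball, dist_eq_norm]; simp [abs_of_pos ε0, ε0])
    simp at this
    linarith
  · have h1 : ∀ᶠ v in 𝓝 (f w), v.re ≤ (f w).re := hle he
    obtain ⟨ε, ε0, hε⟩ := Metric.eventually_nhds_iff_ball.1 h1
    have := hε (f w + (ε / 2 : ℝ)) (by
      rw [Metric.mem_ball, dist_eq_norm]; simp [abs_of_pos ε0, ε0])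
    simp at this
    linarith

/-- By the identity theorem `h` would be constant on the disc, and so have an extremum at
`Complex.I`. -/
lemma IsAdmissible.not_eventually_eq {h : ℂ → ℝ} (H : IsAdmissible h) {f : ℂ → ℂ}
    (hf : AnalyticOnNhd ℂ f openDisc) (hfh : ∀ z ∈ openDisc, (f z).re = h z) {w : ℂ}
    (hw : w ∈ openDisc) : ¬ ∀ᶠ z in 𝓝 w, f z = f w := by
  intro he
  have h1 : EqOn f (fun _ => f w) openDisc :=
    hf.eqOn_of_preconnected_of_eventuallyEq analyticOnNhd_const
      (convex_ball (0 : ℂ) 1).isPreconnected hw he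
  have h2 : EqOn h (fun _ => (f w).re) openDisc := fun z hz => by rw [← hfh z hz, h1 hz]
  have h3 : EqOn h (fun _ => (f w).re) disc := by
    have := h2.of_subset_closure H.cont continuousOn_const openDisc_subset_disc
      closure_openDisc.ge
    exact this
  refine H.noExtr Complex.I I_mem_openUpperArc (IsLocalExtrOn_of_eventually_eq ?_)
  filter_upwards [self_mem_nhdsWithin] with z hz
  rw [h3 hz, h3 (circle_subset_disc I_mem_openUpperArc.1)]

/-- There are no local extrema away from the lower arc. -/
lemma IsAdmissible.not_isLocalExtrOn {h : ℂ → ℝ} (H : IsAdmissible h) {w : ℂ} (hw : w ∈ disc)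
    (hw' : w ∉ lowerArc) : ¬ IsLocalExtrOn h disc w := by
  rw [disc_eq_union] at hw
  rcases hw with hw | hw
  · intro he
    obtain ⟨f, hf, hfh⟩ := H.exists_analytic
    refine H.not_eventually_eq hf hfh hw (eventually_eq_of_isLocalExtr_re (hf w hw) ?_)
    have hD : disc ∈ 𝓝 w :=
      Filter.mem_of_superset (isOpen_openDisc.mem_nhds hw) openDisc_subset_disc
    have h1 : IsLocalExtr h w := he.isLocalExtr hD
    refine h1.congr ?_
    filter_upwards [isOpen_openDisc.mem_nhds hw] with z hz using (hfh z hz).symm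
  · exact H.noExtr w ((mem_lowerArc_or_mem_openUpperArc hw).resolve_left hw')

/-- Maximum principle: a relatively open piece of the disc, off the lower arc, cannot be bounded by
a level set. -/
lemma IsAdmissible.maximum_principle {h : ℂ → ℝ} (H : IsAdmissible h) {a : ℝ} {Ω : Set ℂ}
    (hΩ : Ω ⊆ disc) {w₀ : ℂ} (hw₀ : w₀ ∈ Ω) (hw₀l : w₀ ∉ lowerArc)
    (hw₀n : closure Ω ∈ 𝓝[disc] w₀)
    (hw : ∀ w ∈ closure Ω, h w ≠ a → w ∉ lowerArc ∧ closure Ω ∈ 𝓝[disc] w) : False := by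
  have hcl : closure Ω ⊆ disc := closure_minimal hΩ isCompact_disc.isClosed
  have hcomp : IsCompact (closure Ω) := isCompact_disc.of_isClosed_subset isClosed_closure hcl
  have hne : (closure Ω).Nonempty := ⟨w₀, subset_closure hw₀⟩
  obtain ⟨M, hM, hMmax⟩ := hcomp.exists_isMaxOn hne (H.cont.mono hcl)
  obtain ⟨m, hm, hmmin⟩ := hcomp.exists_isMinOn hne (H.cont.mono hcl)
  -- A maximum or minimum over the closure with value other than `a` would be a local extremum of
  -- `h` on the disc off the lower arc. So both values are `a` and `h` is constant near `w₀`.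
  have h1 : h M = a := by
    by_contra hMa
    obtain ⟨h1, h2⟩ := hw M hM hMa
    refine H.not_isLocalExtrOn (hcl hM) h1 (Or.inr ?_)
    filter_upwards [h2] with z hz using hMmax hz
  have h2 : h m = a := by
    by_contra hma
    obtain ⟨h1, h2⟩ := hw m hm hma
    refine H.not_isLocalExtrOn (hcl hm) h1 (Or.inl ?_)
    filter_upwards [h2] with z hz using hmmin hz
  have h3 : ∀ z ∈ closure Ω, h z = a := fun z hz =>
    le_antisymm (h1 ▸ hMmax hz) (h2 ▸ hmmin hz)
  refine H.not_isLocalExtrOn (hΩ hw₀) hw₀l (IsLocalExtrOn_of_eventually_eq ?_)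
  filter_upwards [hw₀n] with z hz
  rw [h3 z hz, h3 w₀ (subset_closure hw₀)]

/-- If `h = a` on the circle near a point of the open upper arc, then the derivative of the
holomorphic function with real part `h` vanishes there. -/
lemma isLocalExtrOn_of_deriv_ne_zero {h : ℂ → ℝ} {g : ℂ → ℂ} {z : ℂ} {a : ℝ} (hz : z ∈ circle)
    (hg : AnalyticAt ℂ g z) (hgh : ∀ᶠ w in 𝓝[disc] z, (g w).re = h w)
    (ha : ∀ᶠ w in 𝓝[circle] z, h w = a) (hd : deriv g z ≠ 0) : IsLocalExtrOn h disc z := by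
  have hz1 : ‖z‖ = 1 := by rwa [circle, mem_sphere_zero_iff_norm] at hz
  have hz0 : z ≠ 0 := norm_pos_iff.1 (by rw [hz1]; exact one_pos)
  -- In the coordinate `u = log (w / z)` the disc becomes the half plane `u.re ≤ 0` and the circle
  -- the imaginary axis.
  set G : ℂ → ℂ := fun u => g (z * Complex.exp u) with hG
  have hE : HasStrictDerivAt (fun u : ℂ => z * Complex.exp u) z 0 := by
    have := (Complex.hasStrictDerivAt_exp 0).const_mul z
    simpa using this
  set c := deriv g z * z with hc
  have hGd : HasStrictDerivAt G c 0 := by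
    have hg' : HasStrictDerivAt g (deriv g z) (z * Complex.exp 0) := by
      simpa using hg.hasStrictDerivAt
    exact hg'.comp (0 : ℂ) hE
  have hc0 : c ≠ 0 := mul_ne_zero hd hz0
  obtain ⟨r, r0, hr⟩ := exists_norm_sub_le_of_hasStrictDerivAt hGd hc0
  have hnormE : ∀ u : ℂ, ‖z * Complex.exp u‖ = Real.exp u.re := fun u => by
    rw [norm_mul, hz1, one_mul, Complex.norm_exp]
  have hEt : Filter.Tendsto (fun u : ℂ => z * Complex.exp u) (𝓝 0) (𝓝 z) := by
    have : ContinuousAt (fun u : ℂ => z * Complex.exp u) 0 := by fun_prop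
    simpa [ContinuousAt] using this
  -- on the imaginary axis the real part of `G` is `a`
  have hax : ∀ᶠ t : ℝ in 𝓝 0, (G (t * Complex.I)).re = a := by
    have ht : Filter.Tendsto (fun t : ℝ => z * Complex.exp (t * Complex.I)) (𝓝 0) (𝓝[circle] z) := by
      refine tendsto_nhdsWithin_iff.2 ⟨?_, Filter.Eventually.of_forall fun t => ?_⟩
      · have : ContinuousAt (fun t : ℝ => z * Complex.exp (t * Complex.I)) 0 := by fun_prop
        simpa [ContinuousAt] using this
      · rw [circle, mem_sphere_zero_iff_norm, hnormE]; simp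
    filter_upwards [ht.eventually ha,
      ht.eventually (hgh.filter_mono (nhdsWithin_mono z circle_subset_disc))] with t h1 h2
    rw [hG]; exact h2.trans h1
  -- On the imaginary axis the real part of `G` is constant, so its derivative `c * I` has real part
  -- zero.
  have hcim : c.im = 0 := by
    have h1 : HasDerivAt (fun t : ℝ => (t : ℂ) * Complex.I) Complex.I 0 := by
      simpa using (Complex.ofRealCLM.hasDerivAt (x := 0)).mul_const Complex.I
    have h2 : HasDerivAt (fun t : ℝ => G (t * Complex.I)) (c * Complex.I) 0 := by
      have : HasDerivAt G c ((0 : ℝ) * Complex.I) := by simpa using hGd.hasDerivAt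
      exact HasDerivAt.comp (h₂ := G) (h := fun t : ℝ => (t : ℂ) * Complex.I) (0 : ℝ) this h1
    have h3 : HasDerivAt (fun t : ℝ => (G (t * Complex.I)).re) (c * Complex.I).re 0 :=
      Complex.reCLM.hasFDerivAt.comp_hasDerivAt (0 : ℝ) h2
    have h4 : HasDerivAt (fun t : ℝ => (G (t * Complex.I)).re) 0 0 :=
      (hasDerivAt_const (0 : ℝ) a).congr_of_eventuallyEq hax
    have := h3.unique h4
    simpa using this
  have hcre : c.re ≠ 0 := fun h => hc0 (Complex.ext h hcim)
  obtain ⟨r', r'0, hr'⟩ := Metric.eventually_nhds_iff_ball.1 hax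
  -- the sign of `Re G - a` on the left half plane
  have hsign : ∀ᶠ u : ℂ in 𝓝 0, u.re ≤ 0 → ∃ l : ℝ, 0 ≤ l ∧ (G u).re = a - l * c.re := by
    filter_upwards [Metric.ball_mem_nhds (0 : ℂ) r0, Metric.ball_mem_nhds (0 : ℂ) r'0]
      with u hu hu' hre
    rw [mem_ball_zero_iff] at hu hu'
    have him : (G (u.im * Complex.I)).re = a := hr' _ (by
      rw [mem_ball_zero_iff]; exact (Complex.abs_im_le_norm u).trans_lt hu')
    rcases hre.eq_or_lt with h0 | h0
    · have : u = u.im * Complex.I := by apply Complex.ext <;> simp [h0]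
      refine ⟨0, le_rfl, ?_⟩
      rw [this, him]; simp
    · have hne : u ≠ u.im * Complex.I := fun h => by
        have := congrArg Complex.re h; simp at this; exact h0.ne this
      have hsub : u - u.im * Complex.I = (u.re : ℂ) := by apply Complex.ext <;> simp
      have := hr u (by rwa [mem_ball_zero_iff]) (u.im * Complex.I) (by
        rw [mem_ball_zero_iff]
        have := Complex.abs_im_le_norm u
        simp only [norm_mul, Complex.norm_real, Complex.norm_I, mul_one, Real.norm_eq_abs]
        linarith) hne
      -- Compare `u` with its projection to the imaginary axis, where `Re G = a`. The difference
      -- quotient is `c * e` with `c` real and `e` close to `1`, so `Re G u - a` has the sign of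
      -- `u.re * c.re`: one sign on the whole half disc.
      set e := (G u - G (u.im * Complex.I)) / ((u - u.im * Complex.I) * c) with he
      have hepos : 0 < e.re := re_pos_of_norm_sub_one_lt (by linarith)
      rw [hsub] at he
      have hu0 : (u.re : ℂ) ≠ 0 := by exact_mod_cast h0.ne
      have hGe : G u = G (u.im * Complex.I) + u.re * c * e := by
        rw [he]; field_simp; ring
      refine ⟨-u.re * e.re, mul_nonneg (by linarith) hepos.le, ?_⟩
      rw [hGe]
      simp [him, hcim]
      ring
  have hlog : Filter.Tendsto (fun w : ℂ => Complex.log (w / z)) (𝓝 z) (𝓝 0) := by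
    have : ContinuousAt (fun w : ℂ => Complex.log (w / z)) z := by
      refine ContinuousAt.clog (by fun_prop) ?_
      rw [div_self hz0]; simp
    simpa [ContinuousAt, div_self hz0] using this
  have key : ∀ᶠ w in 𝓝[disc] z, ∃ l : ℝ, 0 ≤ l ∧ h w = a - l * c.re := by
    filter_upwards [hgh, mem_nhdsWithin_of_mem_nhds (hlog.eventually hsign), self_mem_nhdsWithin,
      mem_nhdsWithin_of_mem_nhds (isOpen_ne.mem_nhds hz0)] with w h1 h2 h3 h4
    have hexp : z * Complex.exp (Complex.log (w / z)) = w := by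
      rw [Complex.exp_log (div_ne_zero h4 hz0), mul_div_cancel₀ _ hz0]
    rw [disc, mem_closedBall_zero_iff, ← hexp, hnormE] at h3
    rw [← h1]
    have := h2 (Real.exp_le_one_iff.1 h3)
    simp only [hG] at this
    rwa [hexp] at this
  have hza : h z = a := ha.self_of_nhdsWithin hz
  rcases hcre.lt_or_gt with hs | hs
  · left
    filter_upwards [key] with w hw
    obtain ⟨l, hl, e⟩ := hw
    rw [hza, e]; nlinarith
  · right
    filter_upwards [key] with w hw
    obtain ⟨l, hl, e⟩ := hw
    rw [hza, e]; nlinarith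

/-- The level sets meet the open upper arc in isolated points. -/
lemma IsAdmissible.eventually_ne_on_circle {h : ℂ → ℝ} (H : IsAdmissible h) (a : ℝ) {z : ℂ}
    (hz : z ∈ openUpperArc) : ∀ᶠ w in 𝓝[circle] z, h w = a → w = z := by
  obtain ⟨g, r, r0, hg, hgh⟩ := H.exists_analytic_upper hz
  have hz1 : ‖z‖ = 1 := by have := hz.1; rwa [circle, mem_sphere_zero_iff_norm] at this
  have hz0 : z ≠ 0 := norm_pos_iff.1 (by rw [hz1]; exact one_pos)
  have hcirc : ∀ t : ℝ, z * Complex.exp (t * Complex.I) ∈ circle := fun t => by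
    rw [circle, mem_sphere_zero_iff_norm, norm_mul, hz1, Complex.norm_exp]; simp
  set E : ℝ → ℂ := fun t => z * Complex.exp (t * Complex.I) with hE
  have hEc : Continuous E := by fun_prop
  have hE0 : E 0 = z := by simp [hE]
  have hEt : Filter.Tendsto E (𝓝 0) (𝓝 z) := by
    have := hEc.tendsto 0; rwa [hE0] at this
  -- the angle of a point of the circle
  have harg : Filter.Tendsto (fun w : ℂ => (w / z).arg) (𝓝 z) (𝓝 0) := by
    have : ContinuousAt (fun w : ℂ => (w / z).arg) z := by
      refine ContinuousAt.comp (f := fun w : ℂ => w / z) (Complex.continuousAt_arg ?_) (by fun_prop)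
      rw [div_self hz0]; simp
    simpa [ContinuousAt, div_self hz0] using this
  have hEarg : ∀ w ∈ circle, E (w / z).arg = w := by
    intro w hw
    rw [circle, mem_sphere_zero_iff_norm] at hw
    have := Complex.norm_mul_exp_arg_mul_I (w / z)
    rw [norm_div, hw, hz1, div_one, Complex.ofReal_one, one_mul] at this
    rw [hE]; simp only; rw [this, mul_div_cancel₀ _ hz0]
  have hFa : AnalyticAt ℝ (fun t : ℝ => (g (E t)).re - a) 0 := by
    have h1 : AnalyticAt ℝ E 0 := by
      refine analyticAt_const.mul ?_
      have h2 : AnalyticAt ℝ (fun t : ℝ => (t : ℂ) * Complex.I) 0 :=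
        (Complex.ofRealCLM.analyticAt 0).mul analyticAt_const
      exact (analyticAt_cexp.restrictScalars (𝕜 := ℝ)).comp h2
    have h3 : AnalyticAt ℝ g (E 0) := by
      rw [hE0]; exact (hg z (Metric.mem_ball_self r0)).restrictScalars
    have h4 : AnalyticAt ℝ (fun t => g (E t)) 0 := h3.comp h1
    exact ((Complex.reCLM.analyticAt _).comp h4).sub analyticAt_const
  -- A real-analytic function of the angle either has an isolated zero or vanishes identically near
  -- it. In the second case `h = a` on an arc, so the derivative of `g` vanishes along that arc, `g`
  -- is constant near `z`, and `z` is an extremum.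
  rcases hFa.eventually_eq_zero_or_eventually_ne_zero with hF | hF
  · exfalso
    obtain ⟨ρ, ρ0, hρ⟩ := Metric.eventually_nhds_iff_ball.1
      (hF.and ((hEt.eventually (Metric.ball_mem_nhds z r0)).and
      (hEt.eventually ((isOpen_lt continuous_const Complex.continuous_im).eventually_mem hz.2))))
    have hd : ∀ t ∈ Metric.ball (0 : ℝ) ρ, deriv g (E t) = 0 := by
      intro t ht
      by_contra hne
      obtain ⟨h1, h2, h3⟩ := hρ t ht
      refine H.noExtr (E t) ⟨hcirc t, h3⟩
        (isLocalExtrOn_of_deriv_ne_zero (a := a) (hcirc t) (hg _ h2) ?_ ?_ hne)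
      · filter_upwards [self_mem_nhdsWithin,
          mem_nhdsWithin_of_mem_nhds (Metric.isOpen_ball.mem_nhds h2)] with w h4 h5
        exact hgh w ⟨h4, h5⟩
      · have h4 : Filter.Tendsto (fun w : ℂ => t + (w / E t).arg) (𝓝 (E t)) (𝓝 t) := by
          have hEt0 : E t ≠ 0 := mul_ne_zero hz0 (Complex.exp_ne_zero _)
          have : ContinuousAt (fun w : ℂ => t + (w / E t).arg) (E t) := by
            refine ContinuousAt.add continuousAt_const ?_
            refine ContinuousAt.comp (f := fun w : ℂ => w / E t) (Complex.continuousAt_arg ?_)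
              (by fun_prop)
            rw [div_self hEt0]; simp
          simpa [ContinuousAt, div_self hEt0] using this
        filter_upwards [self_mem_nhdsWithin, mem_nhdsWithin_of_mem_nhds
          (h4.eventually (Metric.isOpen_ball.mem_nhds ht))] with w hw h5
        have hw1 : ‖w‖ = 1 := by rwa [circle, mem_sphere_zero_iff_norm] at hw
        have hEt1 : ‖E t‖ = 1 := by
          have := hcirc t; rwa [circle, mem_sphere_zero_iff_norm] at this
        have hEt0 : E t ≠ 0 := norm_pos_iff.1 (by rw [hEt1]; exact one_pos)
        have e : E (t + (w / E t).arg) = w := by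
          have h6 := Complex.norm_mul_exp_arg_mul_I (w / E t)
          rw [norm_div, hw1, hEt1, div_one, Complex.ofReal_one, one_mul] at h6
          have h7 : E (t + (w / E t).arg) = E t * Complex.exp ((w / E t).arg * Complex.I) := by
            simp only [hE]
            rw [mul_assoc, ← Complex.exp_add]; push_cast; ring_nf
          rw [h7, h6, mul_div_cancel₀ _ hEt0]
        obtain ⟨h8, h9, -⟩ := hρ _ h5
        rw [e] at h8 h9
        rw [← hgh w ⟨circle_subset_disc hw, h9⟩]
        linarith
    have hfreq : ∃ᶠ w in 𝓝[≠] z, deriv g w = 0 := by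
      have ht : Filter.Tendsto E (𝓝[≠] 0) (𝓝[≠] z) := by
        refine tendsto_nhdsWithin_iff.2 ⟨hEt.mono_left nhdsWithin_le_nhds, ?_⟩
        filter_upwards [self_mem_nhdsWithin, mem_nhdsWithin_of_mem_nhds
          (Metric.ball_mem_nhds (0 : ℝ) Real.pi_pos)] with t ht htp h
        rw [mem_ball_zero_iff, Real.norm_eq_abs] at htp
        have h1 : Complex.exp (t * Complex.I) = 1 := by
          have : z * Complex.exp (t * Complex.I) = z * 1 := by rw [mul_one]; exact h
          exact mul_left_cancel₀ hz0 this
        have := eq_zero_of_exp_eq_one h1 (by simp; linarith [Real.pi_pos])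
        simp at this
        exact ht this
      refine ht.frequently (Filter.Eventually.frequently ?_)
      filter_upwards [mem_nhdsWithin_of_mem_nhds (Metric.ball_mem_nhds (0 : ℝ) ρ0)] with t ht
        using hd t ht
    have hev := ((hg z (Metric.mem_ball_self r0)).deriv.frequently_zero_iff_eventually_zero).1 hfreq
    obtain ⟨s, s0, hs⟩ := Metric.eventually_nhds_iff_ball.1
      (hev.and (Metric.isOpen_ball.eventually_mem (Metric.mem_ball_self r0 : z ∈ Metric.ball z r)))
    have hconst : ∀ w ∈ Metric.ball z s, g w = g z := fun w hw =>
      Metric.isOpen_ball.is_const_of_deriv_eq_zero (convex_ball z s).isPreconnected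
        (fun v hv => (hg v (hs v hv).2).differentiableAt.differentiableWithinAt)
        (fun v hv => (hs v hv).1) hw (Metric.mem_ball_self s0)
    refine H.noExtr z hz (IsLocalExtrOn_of_eventually_eq ?_)
    filter_upwards [self_mem_nhdsWithin, mem_nhdsWithin_of_mem_nhds (Metric.ball_mem_nhds z s0)]
      with w h1 h2
    rw [← hgh w ⟨h1, (hs w h2).2⟩, hconst w h2,
      hgh z ⟨circle_subset_disc hz.1, Metric.mem_ball_self r0⟩]
  · rw [eventually_nhdsWithin_iff] at hF
    filter_upwards [self_mem_nhdsWithin, mem_nhdsWithin_of_mem_nhds (harg.eventually hF),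
      mem_nhdsWithin_of_mem_nhds (Metric.ball_mem_nhds z r0)] with w h1 h2 h3 h4
    have h5 : (w / z).arg = 0 := by
      by_contra h6
      apply h2 h6
      rw [hEarg w h1, hgh w ⟨circle_subset_disc h1, h3⟩, h4, sub_self]
    have := hEarg w h1
    rw [h5, hE0] at this
    exact this.symm

end HarmonicLevelSet

namespace HarmonicLevelSet

/-! ### Level sets do not separate the plane -/

lemma isPreconnected_compl_disc : IsPreconnected discᶜ := by
  have h1 : IsPreconnected (Complex.exp '' {u | 0 < u.re}) :=
    (convex_halfSpace_re_gt 0).isPreconnected.image _ Complex.continuous_exp.continuousOn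
  convert h1 using 1
  ext z
  rw [disc, mem_compl_iff, mem_closedBall_zero_iff, not_le]
  constructor
  · intro hz
    have hz0 : z ≠ 0 := norm_pos_iff.1 (one_pos.trans hz)
    exact ⟨Complex.log z, by simpa [Complex.log_re] using Real.log_pos hz, Complex.exp_log hz0⟩
  · rintro ⟨u, hu, rfl⟩
    rw [Complex.norm_exp]
    exact Real.one_lt_exp_iff.2 hu

/-- A compact subset of the disc which separates the plane has a bounded complementary
component. -/
lemma exists_component_of_not_isPreconnected_compl {K : Set ℂ} (hK : IsClosed K) (hKd : K ⊆ disc)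
    (hc : ¬ IsPreconnected Kᶜ) :
    ∃ Ω : Set ℂ, Ω.Nonempty ∧ IsOpen Ω ∧ Ω ⊆ openDisc ∧ closure Ω ⊆ Ω ∪ K ∧
      ∀ S, IsPreconnected S → S ⊆ Kᶜ → (S ∩ Ω).Nonempty → S ⊆ Ω := by
  -- The point `2` marks the unbounded component, which contains the connected exterior of the disc.
  -- Every other component lies in the disc.
  have h2 : (2 : ℂ) ∈ discᶜ := by rw [disc, mem_compl_iff, mem_closedBall_zero_iff]; norm_num
  have hdK : discᶜ ⊆ Kᶜ := compl_subset_compl.2 hKd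
  have hO : discᶜ ⊆ connectedComponentIn Kᶜ 2 :=
    isPreconnected_compl_disc.subset_connectedComponentIn h2 hdK
  obtain ⟨w, hw, hwO⟩ : ∃ w ∈ Kᶜ, w ∉ connectedComponentIn Kᶜ 2 := by
    by_contra! h
    refine hc ?_
    rw [← (connectedComponentIn_subset Kᶜ 2).antisymm h]
    exact isPreconnected_connectedComponentIn
  have hS : ∀ S, IsPreconnected S → S ⊆ Kᶜ → (S ∩ connectedComponentIn Kᶜ w).Nonempty →
      S ⊆ connectedComponentIn Kᶜ w := by
    rintro S hS hSK ⟨v, hvS, hv⟩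
    rw [connectedComponentIn_eq hv]
    exact hS.subset_connectedComponentIn hvS hSK
  have hopen : IsOpen (connectedComponentIn Kᶜ w) := hK.isOpen_compl.connectedComponentIn
  refine ⟨connectedComponentIn Kᶜ w, ⟨w, mem_connectedComponentIn hw⟩, hopen, ?_, ?_, hS⟩
  · have : connectedComponentIn Kᶜ w ⊆ disc := by
      intro v hv
      by_contra hvd
      apply hwO
      rw [connectedComponentIn_eq (hO hvd), ← connectedComponentIn_eq hv]
      exact mem_connectedComponentIn hw
    have h3 := interior_maximal this hopen
    rwa [disc, interior_closedBall _ one_ne_zero] at h3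
  · intro v hv
    by_contra h
    rw [mem_union, not_or] at h
    have h4 : IsOpen (connectedComponentIn Kᶜ v) := hK.isOpen_compl.connectedComponentIn
    obtain ⟨u, hu1, hu2⟩ := mem_closure_iff.1 hv _ h4 (mem_connectedComponentIn h.2)
    apply h.1
    rw [connectedComponentIn_eq hu2, ← connectedComponentIn_eq hu1]
    exact mem_connectedComponentIn h.2

lemma notMem_lowerArc_of_mem_openDisc {z : ℂ} (hz : z ∈ openDisc) : z ∉ lowerArc :=
  fun h => notMem_circle_of_mem_openDisc hz h.1

lemma closure_mem_nhdsWithin_of_isOpen {Ω : Set ℂ} (h : IsOpen Ω) {w : ℂ} (hw : w ∈ Ω) :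
    closure Ω ∈ 𝓝[disc] w :=
  mem_nhdsWithin_of_mem_nhds (Filter.mem_of_superset (h.mem_nhds hw) subset_closure)

/-- A bounded complementary component would be a region inside the disc with `h = a` on its
boundary, against the maximum principle. -/
lemma IsAdmissible.isPreconnected_compl {h : ℂ → ℝ} (H : IsAdmissible h) {a : ℝ} {P : Set ℂ}
    (hP : IsCompact P) (hPL : P ⊆ levelSet h a) : IsPreconnected Pᶜ := by
  by_contra hc
  obtain ⟨Ω, ⟨w₀, hw₀⟩, hΩo, hΩd, hΩc, -⟩ := exists_component_of_not_isPreconnected_compl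
    hP.isClosed (fun z hz => (hPL hz).1) hc
  refine H.maximum_principle (hΩd.trans openDisc_subset_disc) hw₀
    (notMem_lowerArc_of_mem_openDisc (hΩd hw₀)) (closure_mem_nhdsWithin_of_isOpen hΩo hw₀)
    (a := a) fun w hw hwa => ?_
  have hwΩ : w ∈ Ω := (hΩc hw).resolve_right fun h => hwa (hPL h).2
  exact ⟨notMem_lowerArc_of_mem_openDisc (hΩd hwΩ), closure_mem_nhdsWithin_of_isOpen hΩo hwΩ⟩

/-! ### The upper arc -/

/-- The point of the circle at a given angle. -/
noncomputable def circlePoint (t : ℝ) : ℂ := Complex.exp (t * Complex.I)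

lemma continuous_circlePoint : Continuous circlePoint := by unfold circlePoint; fun_prop

lemma circlePoint_im (t : ℝ) : (circlePoint t).im = Real.sin t := Complex.exp_ofReal_mul_I_im t

lemma circlePoint_mem_circle (t : ℝ) : circlePoint t ∈ circle := by
  rw [circle, mem_sphere_zero_iff_norm]; exact Complex.norm_exp_ofReal_mul_I t

lemma circlePoint_injective {s t : ℝ} (h : circlePoint s = circlePoint t)
    (hst : |s - t| < 2 * Real.pi) : s = t := by
  have h1 : Complex.exp (s * Complex.I - t * Complex.I) = 1 := by
    rw [Complex.exp_sub]; exact (div_eq_one_iff_eq (Complex.exp_ne_zero _)).2 h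
  have := eq_zero_of_exp_eq_one h1 (by simpa using hst)
  rw [← sub_mul, mul_eq_zero, or_iff_left Complex.I_ne_zero] at this
  exact_mod_cast sub_eq_zero.1 this

lemma circlePoint_mem_openUpperArc {t : ℝ} (h0 : 0 < t) (h1 : t < Real.pi) :
    circlePoint t ∈ openUpperArc :=
  ⟨circlePoint_mem_circle t, by rw [circlePoint_im]; exact Real.sin_pos_of_pos_of_lt_pi h0 h1⟩

lemma exists_circlePoint_of_mem_upperArc {p : ℂ} (hp : p ∈ upperArc) :
    ∃ t ∈ Icc 0 Real.pi, circlePoint t = p := by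
  refine ⟨p.arg, ⟨Complex.arg_nonneg_iff.2 hp.2, Complex.arg_le_pi p⟩, ?_⟩
  have h1 := hp.1
  rw [circle, mem_sphere_zero_iff_norm] at h1
  have := Complex.norm_mul_exp_arg_mul_I p
  rwa [h1, Complex.ofReal_one, one_mul] at this

/-- A set which is cut by a point is disconnected by the removal of this point. -/
lemma not_isPreconnected_diff_of_cut {K X Y : Set ℂ} {x : ℂ} (hX : IsClosed X) (hY : IsClosed Y)
    (hXY : X ∪ Y = K) (hx : X ∩ Y = {x}) {p q : ℂ} (hp : p ∈ X) (hpx : p ≠ x) (hq : q ∈ Y)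
    (hqx : q ≠ x) : ¬ IsPreconnected (K \ {x}) := by
  intro hc
  obtain ⟨z, hz, hz'⟩ := isPreconnected_closed_iff.1 hc X Y hX hY
    (hXY ▸ sdiff_subset) ⟨p, ⟨hXY ▸ Or.inl hp, hpx⟩, hp⟩ ⟨q, ⟨hXY ▸ Or.inr hq, hqx⟩, hq⟩
  rw [hx] at hz'
  exact hz.2 hz'

/-- Points of the level set are isolated on the open upper arc, so points just beyond the midpoint
of the arc are not in `P`. -/
lemma IsAdmissible.exists_circlePoint_notMem {h : ℂ → ℝ} (H : IsAdmissible h) {a : ℝ} {P : Set ℂ}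
    (hPL : P ⊆ levelSet h a) {s t : ℝ} (hs : 0 ≤ s) (hst : s < t) (ht : t ≤ Real.pi) :
    ∃ r ∈ Ioo s t, circlePoint r ∉ P := by
  set m := (s + t) / 2 with hm
  have hmem : circlePoint m ∈ openUpperArc :=
    circlePoint_mem_openUpperArc (by linarith) (by linarith)
  have h1 := H.eventually_ne_on_circle a hmem
  have h2 : Filter.Tendsto circlePoint (𝓝 m) (𝓝[circle] circlePoint m) :=
    tendsto_nhdsWithin_iff.2 ⟨continuous_circlePoint.tendsto m,
      Filter.Eventually.of_forall circlePoint_mem_circle⟩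
  obtain ⟨ε, ε0, hε⟩ := Metric.eventually_nhds_iff_ball.1 (h2.eventually h1)
  set δ := min ε (t - m) / 2 with hδ
  have h0 : 0 < min ε (t - m) := lt_min ε0 (by linarith)
  have h3 : δ < ε := by have := min_le_left ε (t - m); linarith
  have h4 : δ < t - m := by have := min_le_right ε (t - m); linarith
  refine ⟨m + δ, ⟨by linarith, by linarith⟩, fun hP => ?_⟩
  have h5 := hε (m + δ) (by
    rw [Metric.mem_ball, Real.dist_eq, add_sub_cancel_left, abs_of_pos (by linarith)]; exact h3)
    (hPL hP).2
  have := circlePoint_injective h5 (by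
    rw [add_sub_cancel_left, abs_of_pos (by linarith)]; linarith [Real.pi_pos])
  linarith

/-- The exponential chart of the plane at a point of the circle. -/
lemma exists_circle_chart (θ : ℝ) {r : ℝ} (hr : r ≤ Real.pi) :
    ∃ ψ : OpenPartialHomeomorph ℂ ℂ, ψ.source = Metric.ball 0 r ∧
      ∀ u, ψ u = circlePoint θ * Complex.exp u := by
  have h0 : circlePoint θ ≠ 0 := Complex.exp_ne_zero _
  refine ⟨(Complex.expOpenPartialHomeomorph.trans
    (Homeomorph.mulLeft₀ (circlePoint θ) h0).toOpenPartialHomeomorph).restrOpen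
    (Metric.ball 0 r) Metric.isOpen_ball, ?_, fun u => rfl⟩
  rw [OpenPartialHomeomorph.restrOpen_source]
  refine inter_eq_right.2 fun u hu => ?_
  simp only [OpenPartialHomeomorph.trans_source, Homeomorph.toOpenPartialHomeomorph_source,
    preimage_univ, inter_univ]
  rw [mem_ball_zero_iff] at hu
  have := (Complex.abs_im_le_norm u).trans_lt (hu.trans_le hr)
  exact abs_lt.1 this

/-- A connected part of a level set meets the upper arc at most once. -/
lemma IsAdmissible.subsingleton_inter_upperArc {h : ℂ → ℝ} (H : IsAdmissible h) {a : ℝ} {P : Set ℂ}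
    (hP : IsCompact P) (hPc : IsPreconnected P) (hPL : P ⊆ levelSet h a) :
    (P ∩ upperArc).Subsingleton := by
  suffices key : ∀ s t : ℝ, 0 ≤ s → s < t → t ≤ Real.pi → circlePoint s ∈ P →
      circlePoint t ∈ P → False by
    rintro p ⟨hp, hpu⟩ q ⟨hq, hqu⟩
    obtain ⟨s, hs, rfl⟩ := exists_circlePoint_of_mem_upperArc hpu
    obtain ⟨t, ht, rfl⟩ := exists_circlePoint_of_mem_upperArc hqu
    rcases lt_trichotomy s t with hst | rfl | hst
    · exact (key s t hs.1 hst ht.2 hp hq).elim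
    · rfl
    · exact (key t s ht.1 hst hs.2 hq hp).elim
  intro s t hs hst ht hsP htP
  obtain ⟨θ, hθ, hθP⟩ := H.exists_circlePoint_notMem hPL hs hst ht
  set K := P ∪ circlePoint '' Icc s t with hK
  have harc : IsCompact (circlePoint '' Icc s t) := isCompact_Icc.image continuous_circlePoint
  have hKc : IsCompact K := hP.union harc
  have hKd : K ⊆ disc := by
    rintro z (hz | ⟨r, -, rfl⟩)
    · exact (hPL hz).1
    · exact circle_subset_disc (circlePoint_mem_circle r)
  -- If `K` does not separate the plane, the point at angle `θ`, off `P`, cuts `K`. But removing it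
  -- leaves two half-open arcs, each attached to the connected set `P`.
  by_cases hc : IsPreconnected Kᶜ
  · have hcont : Filter.Tendsto (fun u => circlePoint θ * Complex.exp u) (𝓝 0)
        (𝓝 (circlePoint θ)) := by
      have : ContinuousAt (fun u => circlePoint θ * Complex.exp u) 0 := by fun_prop
      simpa [ContinuousAt] using this
    obtain ⟨r₀, r₀0, hr₀⟩ := Metric.eventually_nhds_iff_ball.1
      (hcont.eventually (hP.isClosed.isOpen_compl.eventually_mem hθP))
    set r := min (min r₀ Real.pi) (min (θ - s) (t - θ)) with hr
    have hr0 : 0 < r := lt_min (lt_min r₀0 Real.pi_pos)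
      (lt_min (by linarith [hθ.1]) (by linarith [hθ.2]))
    have hrr₀ : r ≤ r₀ := (min_le_left _ _).trans (min_le_left _ _)
    have hrpi : r ≤ Real.pi := (min_le_left _ _).trans (min_le_right _ _)
    have hrs : r ≤ θ - s := (min_le_right _ _).trans (min_le_left _ _)
    have hrt : r ≤ t - θ := (min_le_right _ _).trans (min_le_right _ _)
    obtain ⟨ψ, hψs, hψ⟩ := exists_circle_chart θ hrpi
    have hψe : ⇑ψ = fun u => circlePoint θ * Complex.exp u := funext hψ
    have hψd : HasStrictDerivAt ψ (circlePoint θ) 0 := by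
      rw [hψe]
      simpa using (Complex.hasStrictDerivAt_exp 0).const_mul (circlePoint θ)
    have hadd : ∀ v : ℝ, ψ (v * Complex.I) = circlePoint (θ + v) := fun v => by
      rw [hψ, circlePoint, circlePoint, ← Complex.exp_add]; push_cast; ring_nf
    have hψK : ∀ u ∈ ψ.source, ψ u ∈ K ↔ u.re = 0 := by
      intro u hu
      rw [hψs, mem_ball_zero_iff] at hu
      constructor
      · rintro (h1 | ⟨v, -, h1⟩)
        · rw [hψ] at h1
          exact absurd h1 (hr₀ u (by rw [mem_ball_zero_iff]; linarith))
        · have h2 := circlePoint_mem_circle v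
          have h3 := circlePoint_mem_circle θ
          rw [circle, mem_sphere_zero_iff_norm] at h2 h3
          rw [h1, hψ, norm_mul, h3, one_mul, Complex.norm_exp] at h2
          simpa using h2
      · intro hre
        have hu' : u = (u.im : ℂ) * Complex.I := by apply Complex.ext <;> simp [hre]
        have him := abs_lt.1 ((Complex.abs_im_le_norm u).trans_lt hu)
        rw [hu', hadd]
        exact Or.inr ⟨_, ⟨by linarith, by linarith⟩, rfl⟩
    obtain ⟨X, Y, hX, hY, hXY, hXYx, δ, δ0, hδ⟩ := exists_cut hKc hc ψ
      (by rw [hψs]; exact Metric.mem_ball_self hr0) hψd (Complex.exp_ne_zero _) hψK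
    have hψ0 : ψ 0 = circlePoint θ := by rw [hψ]; simp
    rw [hψ0] at hXYx
    set v := min δ 1 with hv
    have hv0 : 0 < v := lt_min δ0 one_pos
    have hv1 : v ≤ 1 := min_le_right _ _
    have hpX := (hδ v hv0.le (min_le_left _ _)).1
    have hqY := (hδ v hv0.le (min_le_left _ _)).2
    rw [hadd] at hpX
    have e : (-v : ℂ) * Complex.I = ((-v : ℝ) : ℂ) * Complex.I := by push_cast; ring
    rw [e, hadd] at hqY
    refine not_isPreconnected_diff_of_cut hX hY hXY hXYx hpX (fun h => ?_) hqY (fun h => ?_) ?_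
    · have := circlePoint_injective h (by
        rw [add_sub_cancel_left, abs_of_pos hv0]; linarith [Real.pi_gt_three])
      linarith
    · have := circlePoint_injective h (by
        rw [add_sub_cancel_left, abs_neg, abs_of_pos hv0]; linarith [Real.pi_gt_three])
      linarith
    · have hset : K \ {circlePoint θ} =
          (P ∪ circlePoint '' Ico s θ) ∪ circlePoint '' Ioc θ t := by
        ext z
        constructor
        · rintro ⟨hz | ⟨v, hv, rfl⟩, hzx⟩
          · exact Or.inl (Or.inl hz)
          · rcases lt_trichotomy v θ with h1 | rfl | h1
            · exact Or.inl (Or.inr ⟨v, ⟨hv.1, h1⟩, rfl⟩)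
            · exact absurd rfl hzx
            · exact Or.inr ⟨v, ⟨h1, hv.2⟩, rfl⟩
        · have hne : ∀ v ∈ Icc s t, circlePoint v = circlePoint θ → v = θ := fun v hv h =>
            circlePoint_injective h (by
              rw [abs_lt]; constructor <;> linarith [hv.1, hv.2, hθ.1, hθ.2, Real.pi_pos])
          rintro ((hz | ⟨v, hv, rfl⟩) | ⟨v, hv, rfl⟩)
          · exact ⟨Or.inl hz, fun h => hθP (h ▸ hz)⟩
          · have hv' : v ∈ Icc s t := ⟨hv.1, by linarith [hv.2, hθ.2]⟩
            exact ⟨Or.inr ⟨v, hv', rfl⟩, fun h => hv.2.ne (hne v hv' h)⟩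
          · have hv' : v ∈ Icc s t := ⟨by linarith [hv.1, hθ.1], hv.2⟩
            exact ⟨Or.inr ⟨v, hv', rfl⟩, fun h => hv.1.ne' (hne v hv' h)⟩
      rw [hset]
      refine IsPreconnected.union (circlePoint t) (Or.inl htP) ⟨t, ⟨hθ.2, le_rfl⟩, rfl⟩
        (IsPreconnected.union (circlePoint s) hsP ⟨s, ⟨le_rfl, hθ.1⟩, rfl⟩ hPc
        (isPreconnected_Ico.image _ continuous_circlePoint.continuousOn))
        (isPreconnected_Ioc.image _ continuous_circlePoint.continuousOn)
  -- If `K` separates the plane, the maximum principle applies to a bounded region `Ω`. A boundary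
  -- point with `h ≠ a` lies on the open upper arc off `P`. Near it the disc interior is connected
  -- and misses `K`, hence lies in `Ω`, so the closure of `Ω` is a full neighborhood in the disc.
  · obtain ⟨Ω, ⟨w₀, hw₀⟩, hΩo, hΩd, hΩc, hΩS⟩ := exists_component_of_not_isPreconnected_compl
      hKc.isClosed hKd hc
    refine H.maximum_principle (hΩd.trans openDisc_subset_disc) hw₀
      (notMem_lowerArc_of_mem_openDisc (hΩd hw₀)) (closure_mem_nhdsWithin_of_isOpen hΩo hw₀)
      (a := a) fun w hw hwa => ?_
    rcases hΩc hw with hwΩ | hwP | ⟨v, hv, rfl⟩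
    · exact ⟨notMem_lowerArc_of_mem_openDisc (hΩd hwΩ), closure_mem_nhdsWithin_of_isOpen hΩo hwΩ⟩
    · exact absurd (hPL hwP).2 hwa
    · have hvP : circlePoint v ∉ P := fun h => hwa (hPL h).2
      have hvs : s < v := lt_of_le_of_ne hv.1 fun h => hvP (h ▸ hsP)
      have hvt : v < t := lt_of_le_of_ne hv.2 fun h => hvP (h ▸ htP)
      refine ⟨notMem_lowerArc_of_mem_openUpperArc
        (circlePoint_mem_openUpperArc (by linarith) (by linarith)), ?_⟩
      obtain ⟨r, r0, hr⟩ := Metric.isOpen_iff.1 hP.isClosed.isOpen_compl _ hvP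
      have hsub : Metric.ball (circlePoint v) r ∩ openDisc ⊆ Ω := by
        refine hΩS _ ((convex_ball _ _).inter (convex_ball (0 : ℂ) 1)).isPreconnected ?_ ?_
        · rintro z ⟨hz1, hz2⟩ (hz | ⟨x, -, rfl⟩)
          · exact hr hz1 hz
          · exact notMem_circle_of_mem_openDisc hz2 (circlePoint_mem_circle x)
        · obtain ⟨z, hz1, hz2⟩ := mem_closure_iff.1 hw _ Metric.isOpen_ball
            (Metric.mem_ball_self r0)
          exact ⟨z, ⟨hz1, hΩd hz2⟩, hz2⟩
      filter_upwards [self_mem_nhdsWithin,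
        mem_nhdsWithin_of_mem_nhds (Metric.ball_mem_nhds (circlePoint v) r0)] with z hz1 hz2
      rw [← closure_openDisc] at hz1
      exact closure_mono hsub (Metric.isOpen_ball.inter_closure ⟨hz2, hz1⟩)

end HarmonicLevelSet

namespace HarmonicLevelSet

/-! ### Systems of curves -/

/-- `α` is a family of disjoint arms leaving `c`, along which `T` increases, and which cover the
points near `c` with larger value of `T`. -/
structure IsArmSystem (P R : Set ℂ) (T : ℂ → ℝ) (c : ℂ) (ρ : ℝ) {ι : Type} (α : ι → ℝ → ℂ) :
    Prop where
  cont : ∀ i, ContinuousOn (α i) (Ico 0 ρ)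
  zero : ∀ i, α i 0 = c
  mem : ∀ i, ∀ s ∈ Ioo 0 ρ, α i s ∈ R
  map : ∀ i, ∀ s ∈ Ioo 0 ρ, T (α i s) = T c + s
  inj : ∀ i j, ∀ s ∈ Ioo 0 ρ, α i s = α j s → i = j
  cover : ∀ᶠ z in 𝓝[P] c, T c < T z → ∃ i, z = α i (T z - T c)

/-- The point `x` cuts `P` into the pieces `X` and `Y`, the first containing the points near `x`
with larger value of `T`, the second those with smaller value. -/
structure IsCut (P : Set ℂ) (T : ℂ → ℝ) (x : ℂ) (X Y : Set ℂ) : Prop where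
  closed_left : IsClosed X
  closed_right : IsClosed Y
  union : X ∪ Y = P
  inter : X ∩ Y = {x}
  left : ∀ᶠ z in 𝓝[P] x, T x ≤ T z → z ∈ X
  right : ∀ᶠ z in 𝓝[P] x, T z ≤ T x → z ∈ Y

/-- A continuum `P` which, away from the finite set `B`, is a curve parametrized by the values of
`T`, except for the branch points in `C`, and which is cut by each of its regular points. -/
structure IsCurveSystem (P B C : Set ℂ) (T : ℂ → ℝ) : Prop where
  compact : IsCompact P
  conn : IsConnected P
  finite : B.Finite
  subset : B ⊆ P
  branch_subset : C ⊆ P \ B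
  cont : ContinuousOn T (P \ B)
  cut : ∀ x ∈ P \ (B ∪ C), ∃ X Y, IsCut P T x X Y
  regular : ∀ x ∈ P \ (B ∪ C), ∃ (σ : ℝ → ℂ) (ρ : ℝ), 0 < ρ ∧
    ContinuousOn σ (Ioo (T x - ρ) (T x + ρ)) ∧ σ (T x) = x ∧
    (∀ t ∈ Ioo (T x - ρ) (T x + ρ), σ t ∈ P \ (B ∪ C) ∧ T (σ t) = t) ∧
    ∀ᶠ z in 𝓝[P] x, z = σ (T z)
  branch : ∀ c ∈ C, ∃ (ι : Type) (ρ : ℝ) (α β : ι → ℝ → ℂ), Nontrivial ι ∧ 0 < ρ ∧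
    IsArmSystem P (P \ (B ∪ C)) T c ρ α ∧ IsArmSystem P (P \ (B ∪ C)) (fun z => -T z) c ρ β

/-- In a splitting of `X`, add `Y` to the part containing `x`. As `Y` meets `X` only at `x`, this
would split the union. -/
lemma isPreconnected_of_union_of_inter_eq_singleton {X Y : Set ℂ} {x : ℂ} (hX : IsClosed X)
    (hY : IsClosed Y) (h : IsPreconnected (X ∪ Y)) (hx : X ∩ Y = {x}) : IsPreconnected X := by
  have hxX : x ∈ X := (hx.ge rfl).1
  have hxY : x ∈ Y := (hx.ge rfl).2
  have key : ∀ u v : Set ℂ, IsClosed u → IsClosed v → X ⊆ u ∪ v → (X ∩ v).Nonempty → x ∈ u →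
      (X ∩ (u ∩ v)).Nonempty := by
    intro u v hu hv huv ⟨z, hzX, hzv⟩ hxu
    obtain ⟨w, -, hw1, hw2⟩ := isPreconnected_closed_iff.1 h (X ∩ u ∪ Y) (X ∩ v)
      ((hX.inter hu).union hY) (hX.inter hv) (by
        rintro w (hw | hw)
        · exact (huv hw).imp (fun h' => Or.inl ⟨hw, h'⟩) (fun h' => ⟨hw, h'⟩)
        · exact Or.inl (Or.inr hw))
      ⟨x, Or.inl hxX, Or.inr hxY⟩ ⟨z, Or.inl hzX, hzX, hzv⟩
    rcases hw1 with hw1 | hw1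
    · exact ⟨w, hw1.1, hw1.2, hw2.2⟩
    · obtain rfl : w = x := hx.le ⟨hw2.1, hw1⟩
      exact ⟨w, hw2.1, hxu, hw2.2⟩
  refine isPreconnected_closed_iff.2 fun u v hu hv huv hXu hXv => ?_
  rcases huv hxX with hxu | hxv
  · exact key u v hu hv huv hXv hxu
  · rw [inter_comm u v]
    exact key v u hv hu (by rwa [union_comm]) hXu hxv

variable {P B C : Set ℂ} {T : ℂ → ℝ}

/-! ### The two sides of a cut. -/

namespace IsCut

lemma neg {x : ℂ} {X Y : Set ℂ} (h : IsCut P T x X Y) : IsCut P (fun z => -T z) x Y X where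
  closed_left := h.closed_right
  closed_right := h.closed_left
  union := by rw [union_comm, h.union]
  inter := by rw [inter_comm, h.inter]
  left := h.right.mono fun z hz h' => hz (neg_le_neg_iff.1 h')
  right := h.left.mono fun z hz h' => hz (neg_le_neg_iff.1 h')

variable {x : ℂ} {X Y : Set ℂ}

lemma subset_left (h : IsCut P T x X Y) : X ⊆ P := h.union ▸ subset_union_left

lemma subset_right (h : IsCut P T x X Y) : Y ⊆ P := h.union ▸ subset_union_right

lemma mem_left (h : IsCut P T x X Y) : x ∈ X := (h.inter.ge rfl).1

lemma mem_right (h : IsCut P T x X Y) : x ∈ Y := (h.inter.ge rfl).2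

lemma eq_of_mem (h : IsCut P T x X Y) {z : ℂ} (hz : z ∈ X) (hz' : z ∈ Y) : z = x :=
  h.inter.le ⟨hz, hz'⟩

lemma subset_or_subset (h : IsCut P T x X Y) {S : Set ℂ} (hS : IsPreconnected S) (hSP : S ⊆ P)
    (hx : x ∉ S) : S ⊆ X ∧ Disjoint S Y ∨ S ⊆ Y ∧ Disjoint S X := by
  have hd : S ∩ (X ∩ Y) = ∅ := by
    rw [h.inter]; exact inter_singleton_eq_empty.2 hx
  have hu : S ⊆ X ∪ Y := h.union ▸ hSP
  rcases isPreconnected_iff_subset_of_disjoint_closed.1 hS X Y h.closed_left h.closed_right hu hd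
    with h1 | h1
  · refine Or.inl ⟨h1, disjoint_left.2 fun z hz hzY => ?_⟩
    exact hd.le ⟨hz, h1 hz, hzY⟩
  · refine Or.inr ⟨h1, disjoint_left.2 fun z hz hzX => ?_⟩
    exact hd.le ⟨hz, hzX, h1 hz⟩

lemma left_mem_nhdsWithin (h : IsCut P T x X Y) {z : ℂ} (hz : z ∈ X) (hzx : z ≠ x) :
    X ∈ 𝓝[P] z := by
  have hzY : z ∉ Y := fun h' => hzx (h.eq_of_mem hz h')
  filter_upwards [self_mem_nhdsWithin,
    mem_nhdsWithin_of_mem_nhds (h.closed_right.isOpen_compl.mem_nhds hzY)] with w hw hw'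
  rw [← h.union] at hw
  exact hw.resolve_right hw'

lemma right_mem_nhdsWithin (h : IsCut P T x X Y) {z : ℂ} (hz : z ∈ Y) (hzx : z ≠ x) :
    Y ∈ 𝓝[P] z :=
  h.neg.left_mem_nhdsWithin hz hzx

lemma isPreconnected_left (h : IsCut P T x X Y) (hP : IsPreconnected P) : IsPreconnected X :=
  isPreconnected_of_union_of_inter_eq_singleton h.closed_left h.closed_right (h.union ▸ hP) h.inter

lemma isPreconnected_right (h : IsCut P T x X Y) (hP : IsPreconnected P) : IsPreconnected Y :=
  h.neg.isPreconnected_left hP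

end IsCut

/-! ### Finiteness of the set of edges. -/

namespace IsCurveSystem

lemma neg (S : IsCurveSystem P B C T) : IsCurveSystem P B C (fun z => -T z) where
  compact := S.compact
  conn := S.conn
  finite := S.finite
  subset := S.subset
  branch_subset := S.branch_subset
  cont := S.cont.neg
  cut x hx := by
    obtain ⟨X, Y, h⟩ := S.cut x hx
    exact ⟨Y, X, h.neg⟩
  regular x hx := by
    obtain ⟨σ, ρ, ρ0, h1, h2, h3, h4⟩ := S.regular x hx
    have hm : ∀ t ∈ Ioo (-T x - ρ) (-T x + ρ), -t ∈ Ioo (T x - ρ) (T x + ρ) := fun t ht =>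
      ⟨by linarith [ht.2], by linarith [ht.1]⟩
    refine ⟨fun t => σ (-t), ρ, ρ0, h1.comp continuous_neg.continuousOn hm, by simpa using h2,
      fun t ht => ⟨(h3 _ (hm t ht)).1, by rw [(h3 _ (hm t ht)).2, neg_neg]⟩, ?_⟩
    filter_upwards [h4] with z hz
    rw [neg_neg]; exact hz
  branch c hc := by
    obtain ⟨ι, ρ, α, β, h0, h1, h2, h3⟩ := S.branch c hc
    exact ⟨ι, ρ, β, α, h0, h1, h3, by simpa only [neg_neg] using h2⟩

lemma mem_of_regular (x : ℂ) (hx : x ∈ P \ (B ∪ C)) : x ∈ P \ B :=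
  ⟨hx.1, fun h => hx.2 (Or.inl h)⟩

lemma regular_of_notMem {x : ℂ} (hx : x ∈ P \ B) (hxC : x ∉ C) : x ∈ P \ (B ∪ C) :=
  ⟨hx.1, fun h => h.elim hx.2 hxC⟩

lemma diff_mem_nhdsWithin (S : IsCurveSystem P B C T) {x : ℂ} (hx : x ∈ P \ B) :
    P \ B ∈ 𝓝[P] x :=
  Filter.inter_mem self_mem_nhdsWithin
    (mem_nhdsWithin_of_mem_nhds (S.finite.isClosed.isOpen_compl.mem_nhds hx.2))

lemma tendsto (S : IsCurveSystem P B C T) {x : ℂ} (hx : x ∈ P \ B) :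
    Filter.Tendsto T (𝓝[P] x) (𝓝 (T x)) := by
  have h1 := S.cont x hx
  exact h1.mono_left (nhdsWithin_le_iff.2 (S.diff_mem_nhdsWithin hx))

/-- The function `T` has no local maximum on `P \ B`. -/
lemma frequently_lt (S : IsCurveSystem P B C T) {x : ℂ} (hx : x ∈ P \ B) :
    ∃ᶠ z in 𝓝[P] x, T x < T z := by
  by_cases hxC : x ∈ C
  · obtain ⟨ι, ρ, α, β, h0, ρ0, hα, -⟩ := S.branch x hxC
    obtain ⟨i⟩ := h0.to_nonempty
    have h1 : Filter.Tendsto (α i) (𝓝[Ioo 0 ρ] 0) (𝓝[P] x) := by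
      refine tendsto_nhdsWithin_iff.2 ⟨?_, ?_⟩
      · have := (hα.cont i 0 ⟨le_rfl, ρ0⟩).mono Ioo_subset_Ico_self
        rwa [ContinuousWithinAt, hα.zero] at this
      · filter_upwards [self_mem_nhdsWithin] with s hs using (hα.mem i s hs).1
    have : (𝓝[Ioo 0 ρ] (0 : ℝ)).NeBot := by
      rw [nhdsWithin_Ioo_eq_nhdsGT ρ0]; infer_instance
    refine h1.frequently (Filter.Eventually.frequently ?_)
    filter_upwards [self_mem_nhdsWithin] with s hs
    rw [hα.map i s hs]; linarith [hs.1]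
  · obtain ⟨σ, ρ, ρ0, h1, h2, h3, -⟩ := S.regular x (regular_of_notMem hx hxC)
    have hsub : Ioo (T x) (T x + ρ) ⊆ Ioo (T x - ρ) (T x + ρ) :=
      Ioo_subset_Ioo_left (by linarith)
    have h4 : Filter.Tendsto σ (𝓝[Ioo (T x) (T x + ρ)] (T x)) (𝓝[P] x) := by
      refine tendsto_nhdsWithin_iff.2 ⟨?_, ?_⟩
      · have := (h1 (T x) ⟨by linarith, by linarith⟩).mono hsub
        rwa [ContinuousWithinAt, h2] at this
      · filter_upwards [self_mem_nhdsWithin] with s hs using (h3 s (hsub hs)).1.1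
    have : (𝓝[Ioo (T x) (T x + ρ)] (T x)).NeBot := by
      rw [nhdsWithin_Ioo_eq_nhdsGT (by linarith)]; infer_instance
    refine h4.frequently (Filter.Eventually.frequently ?_)
    filter_upwards [self_mem_nhdsWithin] with s hs
    rw [(h3 s (hsub hs)).2]; exact hs.1

/-- A compact part of `P \ B` has an end at which `T` is maximal. -/
lemma exists_end (S : IsCurveSystem P B C T) {M : Set ℂ} (hM : IsCompact M) (hMP : M ⊆ P \ B)
    (hne : M.Nonempty) : ∃ y ∈ M, (∀ z ∈ M, T z ≤ T y) ∧
      ¬ ∀ᶠ z in 𝓝[P] y, T y ≤ T z → z ∈ M := by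
  obtain ⟨y, hy, hmax⟩ := hM.exists_isMaxOn hne (S.cont.mono hMP)
  refine ⟨y, hy, hmax, fun h => ?_⟩
  obtain ⟨z, hz1, hz2⟩ := ((S.frequently_lt (hMP hy)).and_eventually h).exists
  exact (not_le.2 hz1) (hmax (hz2 hz1.le))

/-- If `X` missed `B`, then `T` would attain a maximum on `X`. Yet near each of its points,
including the cut point `x`, `X` contains all points of `P` with larger `T`, and such points exist.
-/
lemma left_inter_nonempty (S : IsCurveSystem P B C T) {x : ℂ} {X Y : Set ℂ}
    (h : IsCut P T x X Y) : (X ∩ B).Nonempty := by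
  by_contra hB
  rw [not_nonempty_iff_eq_empty] at hB
  obtain ⟨y, hy, -, hy2⟩ := S.exists_end (S.compact.of_isClosed_subset h.closed_left h.subset_left)
    (fun z hz => ⟨h.subset_left hz, fun hzB => hB.le ⟨hz, hzB⟩⟩) ⟨x, h.mem_left⟩
  apply hy2
  by_cases hyx : y = x
  · subst hyx; exact h.left
  · filter_upwards [h.left_mem_nhdsWithin hy hyx] with z hz _ using hz

lemma right_inter_nonempty (S : IsCurveSystem P B C T) {x : ℂ} {X Y : Set ℂ}
    (h : IsCut P T x X Y) : (Y ∩ B).Nonempty :=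
  S.neg.left_inter_nonempty h.neg

/-- Two points on different arms at a branch point: the parts of `P` beyond them are disjoint. -/
lemma exists_disjoint_cuts (S : IsCurveSystem P B C T) {c : ℂ} (hc : c ∈ C) {V : Set ℂ}
    (hV : V ∈ 𝓝[P] c) :
    ∃ y₁ y₂ X₁ Y₁ X₂ Y₂, IsCut P T y₁ X₁ Y₁ ∧ IsCut P T y₂ X₂ Y₂ ∧ y₁ ∈ V ∧ y₂ ∈ V ∧
      T c < T y₁ ∧ T c < T y₂ ∧ Disjoint X₁ X₂ := by
  obtain ⟨ι, ρ, α, β, h0, ρ0, hα, -⟩ := S.branch c hc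
  obtain ⟨i, j, hij⟩ := h0.exists_pair_ne
  have hev : ∀ k, ∀ᶠ s in 𝓝[>] (0 : ℝ), α k s ∈ V := by
    intro k
    have h1 : Filter.Tendsto (α k) (𝓝[Ioo 0 ρ] 0) (𝓝[P] c) := by
      refine tendsto_nhdsWithin_iff.2 ⟨?_, ?_⟩
      · have := (hα.cont k 0 ⟨le_rfl, ρ0⟩).mono Ioo_subset_Ico_self
        rwa [ContinuousWithinAt, hα.zero] at this
      · filter_upwards [self_mem_nhdsWithin] with s hs using (hα.mem k s hs).1
    rw [nhdsWithin_Ioo_eq_nhdsGT ρ0] at h1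
    exact h1.eventually hV
  obtain ⟨s, ⟨hs1, hs2⟩, hs⟩ := (((hev i).and (hev j)).and (Ioo_mem_nhdsGT ρ0)).exists
  have hcR : ∀ k, ∀ t ∈ Ioo 0 ρ, α k t ≠ c := by
    intro k t ht h
    have := hα.map k t ht
    rw [h] at this
    linarith [ht.1]
  -- the closed arm up to the parameter `s`
  have hseg : ∀ k, IsPreconnected (α k '' Icc 0 s) := fun k =>
    isPreconnected_Icc.image _ ((hα.cont k).mono (Icc_subset_Ico_right hs.2))
  have hsegP : ∀ k, α k '' Icc 0 s ⊆ P := by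
    rintro k _ ⟨t, ht, rfl⟩
    rcases ht.1.eq_or_lt with rfl | h1
    · rw [hα.zero]; exact (S.branch_subset hc).1
    · exact (hα.mem k t ⟨h1, ht.2.trans_lt hs.2⟩).1
  have hcseg : ∀ k, c ∈ α k '' Icc 0 s := fun k => ⟨0, ⟨le_rfl, hs.1.le⟩, hα.zero k⟩
  have hnot : ∀ k l, k ≠ l → α k s ∉ α l '' Icc 0 s := by
    rintro k l hkl ⟨t, ht, h⟩
    rcases ht.1.eq_or_lt with rfl | h1
    · rw [hα.zero] at h; exact hcR k s hs h.symm
    · have ht' : t ∈ Ioo 0 ρ := ⟨h1, ht.2.trans_lt hs.2⟩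
      have := hα.map l t ht'
      rw [h, hα.map k s hs] at this
      obtain rfl : s = t := by linarith
      exact hkl (hα.inj k l s hs h.symm)
  obtain ⟨X₁, Y₁, h₁⟩ := S.cut _ (hα.mem i s hs)
  obtain ⟨X₂, Y₂, h₂⟩ := S.cut _ (hα.mem j s hs)
  -- the branch point lies on the lower side
  have hcY : ∀ k X Y, IsCut P T (α k s) X Y → c ∈ Y := by
    intro k X Y h
    have hpre : IsPreconnected (α k '' Ico 0 s) :=
      isPreconnected_Ico.image _ ((hα.cont k).mono (Ico_subset_Ico_right hs.2.le))
    have hsub : α k '' Ico 0 s ⊆ P := (image_mono Ico_subset_Icc_self).trans (hsegP k)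
    have hx : α k s ∉ α k '' Ico 0 s := by
      rintro ⟨t, ht, h'⟩
      rcases ht.1.eq_or_lt with rfl | h1
      · rw [hα.zero] at h'; exact hcR k s hs h'.symm
      · have := hα.map k t ⟨h1, ht.2.trans hs.2⟩
        rw [h', hα.map k s hs] at this
        linarith [ht.2]
    have hc0 : c ∈ α k '' Ico 0 s := ⟨0, ⟨le_rfl, hs.1⟩, hα.zero k⟩
    have h1 : Filter.Tendsto (α k) (𝓝[Ioo 0 s] s) (𝓝[P] (α k s)) := by
      refine tendsto_nhdsWithin_iff.2 ⟨?_, ?_⟩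
      · exact (hα.cont k s ⟨hs.1.le, hs.2⟩).mono
          (Ioo_subset_Ico_self.trans (Ico_subset_Ico_right hs.2.le))
      · filter_upwards [self_mem_nhdsWithin] with t ht using
          (hα.mem k t ⟨ht.1, ht.2.trans hs.2⟩).1
    have hnb : (𝓝[Ioo 0 s] s).NeBot := by
      rw [nhdsWithin_Ioo_eq_nhdsLT hs.1]; infer_instance
    obtain ⟨t, ht1, ht⟩ := ((h1.eventually h.right).and self_mem_nhdsWithin).exists
    have htY : α k t ∈ Y := ht1 (by
      rw [hα.map k s hs, hα.map k t ⟨ht.1, ht.2.trans hs.2⟩]; linarith [ht.2])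
    rcases h.subset_or_subset hpre hsub hx with ⟨-, h2⟩ | ⟨h2, -⟩
    · exact (disjoint_left.1 h2 ⟨t, ⟨ht.1.le, ht.2⟩, rfl⟩ htY).elim
    · exact h2 hc0
  have hother : ∀ k l X Y, k ≠ l → IsCut P T (α k s) X Y → α l s ∈ Y ∧ α l s ∉ X := by
    intro k l X Y hkl h
    have hl : α l s ∈ α l '' Icc 0 s := ⟨s, ⟨hs.1.le, le_rfl⟩, rfl⟩
    rcases h.subset_or_subset (hseg l) (hsegP l) (hnot k l hkl) with ⟨-, h2⟩ | ⟨h2, h3⟩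
    · exact (disjoint_left.1 h2 (hcseg l) (hcY k X Y h)).elim
    · exact ⟨h2 hl, disjoint_left.1 h3 hl⟩
  refine ⟨α i s, α j s, X₁, Y₁, X₂, Y₂, h₁, h₂, hs1, hs2, ?_, ?_, ?_⟩
  · rw [hα.map i s hs]; linarith [hs.1]
  · rw [hα.map j s hs]; linarith [hs.1]
  -- Each cut has `c`, and with it the other arm, on its lower side. The connected set `X₁`
  -- therefore avoids the second cut point and lies on one side of it, which cannot be `X₂` since
  -- its own cut point is not there.
  · obtain ⟨h3, h4⟩ := hother i j X₁ Y₁ hij h₁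
    obtain ⟨h5, h6⟩ := hother j i X₂ Y₂ hij.symm h₂
    rcases h₂.subset_or_subset (h₁.isPreconnected_left S.conn.isPreconnected) h₁.subset_left h4
      with ⟨h7, -⟩ | ⟨-, h7⟩
    · exact (h6 (h7 h₁.mem_left)).elim
    · exact h7

/-- The part of `P` between two regular points which divide `B` in the same way. -/
lemma exists_connecting (S : IsCurveSystem P B C T) {x x' : ℂ} {X Y X' Y' : Set ℂ}
    (hx : x ∈ P \ (B ∪ C)) (hx' : x' ∈ P \ (B ∪ C)) (h : IsCut P T x X Y)
    (h' : IsCut P T x' X' Y') (hB : X ∩ B = X' ∩ B) (hxx' : x' ∈ X) (hne : x ≠ x') :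
    ∃ M, IsPreconnected M ∧ M ⊆ P \ (B ∪ C) ∧ x ∈ M ∧ x' ∈ M := by
  have hP := S.conn.isPreconnected
  have hx'Y : x' ∉ Y := fun hY => hne (h.eq_of_mem hxx' hY).symm
  have hYY' : Y ⊆ Y' := by
    rcases h'.subset_or_subset (h.isPreconnected_right hP) h.subset_right hx'Y
      with ⟨h1, -⟩ | ⟨h1, -⟩
    · exfalso
      obtain ⟨b, hbY, hbB⟩ := S.right_inter_nonempty h
      have hbX : b ∈ X ∩ B := hB ▸ ⟨h1 hbY, hbB⟩
      exact hx.2 (Or.inl (h.eq_of_mem hbX.1 hbY ▸ hbB))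
    · exact h1
  -- The part between the two points is `X ∩ Y'`. It contains no point of `B`, because both cuts
  -- divide `B` in the same way, so on closed parts of it `T` attains its extrema, and these can
  -- only occur at `x` and `x'`.
  have hMc : IsClosed (X ∩ Y') := h.closed_left.inter h'.closed_right
  have hMB : ∀ z ∈ X ∩ Y', z ∉ B := by
    rintro z ⟨hzX, hzY'⟩ hzB
    have hzX' : z ∈ X' ∩ B := hB ▸ ⟨hzX, hzB⟩
    exact hx'.2 (Or.inl (h'.eq_of_mem hzX'.1 hzY' ▸ hzB))
  have hMP : X ∩ Y' ⊆ P \ B := fun z hz => ⟨h.subset_left hz.1, hMB z hz⟩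
  have hxM : x ∈ X ∩ Y' := ⟨h.mem_left, hYY' h.mem_right⟩
  have hx'M : x' ∈ X ∩ Y' := ⟨hxx', h'.mem_right⟩
  have hxX' : x ∉ X' := fun h1 => hne (h'.eq_of_mem h1 hxM.2)
  have hnhds : ∀ z ∈ X ∩ Y', z ≠ x → z ≠ x' → X ∩ Y' ∈ 𝓝[P] z := fun z hz h1 h2 =>
    Filter.inter_mem (h.left_mem_nhdsWithin hz.1 h1) (h'.right_mem_nhdsWithin hz.2 h2)
  have hnx : ∀ᶠ z in 𝓝[P] x, T x ≤ T z → z ∈ X ∩ Y' := by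
    filter_upwards [h.left, h'.right_mem_nhdsWithin hxM.2 hne] with z h1 h2 h3 using ⟨h1 h3, h2⟩
  have hnx' : ∀ᶠ z in 𝓝[P] x', T z ≤ T x' → z ∈ X ∩ Y' := by
    filter_upwards [h'.right, h.left_mem_nhdsWithin hx'M.1 hne.symm] with z h1 h2 h3
      using ⟨h2, h1 h3⟩
  -- the value of `T` is smallest at `x`
  have hmin : ∀ N ⊆ X ∩ Y', IsClosed N → N.Nonempty →
      (∀ z ∈ N, z ≠ x → z ≠ x' → N ∈ 𝓝[P] z) →
      (x' ∈ N → ∀ᶠ z in 𝓝[P] x', T z ≤ T x' → z ∈ N) → x ∈ N ∧ ∀ z ∈ N, T x ≤ T z := by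
    intro N hN hNc hNn hN1 hN2
    obtain ⟨y, hy, hymin, hy'⟩ := S.neg.exists_end
      (S.compact.of_isClosed_subset hNc (hN.trans fun z hz => (hMP hz).1)) (hN.trans hMP) hNn
    simp only [neg_le_neg_iff] at hymin hy'
    by_cases hyx : y = x
    · subst hyx; exact ⟨hy, hymin⟩
    · by_cases hyx' : y = x'
      · subst hyx'; exact (hy' (hN2 hy)).elim
      · exact (hy' (by filter_upwards [hN1 y hy hyx hyx'] with z hz _ using hz)).elim
  refine ⟨X ∩ Y', ?_, ?_, hxM, hx'M⟩
  · rw [isPreconnected_iff_subset_of_disjoint_closed]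
    -- a closed-open part containing neither end nor only one of them is empty
    have key : ∀ u v : Set ℂ, IsClosed u → IsClosed v → X ∩ Y' ⊆ u ∪ v →
        X ∩ Y' ∩ (u ∩ v) = ∅ → x ∈ u → X ∩ Y' ⊆ u := by
      intro u v hu hv huv hd hxu
      by_contra hcon
      have hvne : (X ∩ Y' ∩ v).Nonempty := by
        obtain ⟨z, hz, hzu⟩ := not_subset.1 hcon
        exact ⟨z, hz, (huv hz).resolve_left hzu⟩
      have hev : ∀ z ∈ X ∩ Y' ∩ v, ∀ᶠ w in 𝓝[P] z, w ∈ X ∩ Y' → w ∈ X ∩ Y' ∩ v := by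
        intro z hz
        have hzu : z ∉ u := fun hzu => hd.le ⟨hz.1, hzu, hz.2⟩
        filter_upwards [mem_nhdsWithin_of_mem_nhds (hu.isOpen_compl.mem_nhds hzu)] with w h1 h2
        exact ⟨h2, (huv h2).resolve_left h1⟩
      have := (hmin (X ∩ Y' ∩ v) inter_subset_left (hMc.inter hv) hvne
        (fun z hz h1 h2 => by
          filter_upwards [hev z hz, hnhds z hz.1 h1 h2] with w h3 h4 using h3 h4)
        (fun hz => by
          filter_upwards [hev x' hz, hnx'] with w h3 h4 h5 using h3 (h4 h5))).1
      exact hd.le ⟨this.1, hxu, this.2⟩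
    intro u v hu hv huv hd
    rcases huv hxM with h1 | h1
    · exact Or.inl (key u v hu hv huv hd h1)
    · exact Or.inr (key v u hv hu (by rwa [union_comm]) (by rwa [inter_comm v u]) h1)
  · intro c hc
    refine regular_of_notMem (hMP hc) fun hcC => ?_
    have hcx : c ≠ x := fun e => hx.2 (Or.inr (e ▸ hcC))
    have hcx' : c ≠ x' := fun e => hx'.2 (Or.inr (e ▸ hcC))
    have hTc : T x ≤ T c := (hmin (X ∩ Y') Subset.rfl hMc ⟨x, hxM⟩ hnhds (fun _ => hnx')).2 c hc
    -- From a branch point two arms lead upwards into disjoint parts. On each part `T` would attain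
    -- its maximum over `X ∩ Y'` at `x'`, which cannot belong to both.
    obtain ⟨y₁, y₂, X₁, Y₁, X₂, Y₂, h₁, h₂, hy₁, hy₂, hT₁, hT₂, hdis⟩ :=
      S.exists_disjoint_cuts hcC (hnhds c hc hcx hcx')
    have claim : ∀ y X₀ Y₀, IsCut P T y X₀ Y₀ → y ∈ X ∩ Y' → T c < T y → x' ∈ X₀ := by
      intro y X₀ Y₀ h₀ hy hTy
      obtain ⟨w, hw, hwmax, hw'⟩ := S.exists_end (M := X₀ ∩ (X ∩ Y'))
        (S.compact.of_isClosed_subset (h₀.closed_left.inter hMc) (inter_subset_left.trans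
        h₀.subset_left)) (inter_subset_right.trans hMP) ⟨y, h₀.mem_left, hy⟩
      by_cases hwx' : w = x'
      · exact hwx' ▸ hw.1
      · exfalso
        apply hw'
        have hTw := hwmax y ⟨h₀.mem_left, hy⟩
        have hwx : w ≠ x := by rintro rfl; linarith
        have h3 := hnhds w hw.2 hwx hwx'
        by_cases hwy : w = y
        · subst hwy
          filter_upwards [h₀.left, h3] with z h4 h5 h6 using ⟨h4 h6, h5⟩
        · filter_upwards [h₀.left_mem_nhdsWithin hw.1 hwy, h3] with z h4 h5 _ using ⟨h4, h5⟩
    exact disjoint_left.1 hdis (claim y₁ X₁ Y₁ h₁ hy₁ hT₁) (claim y₂ X₂ Y₂ h₂ hy₂ hT₂)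

/-- After possibly exchanging the points, one lies on the upper side of the other. The remaining
case, `X ⊆ Y'`, would put a point of `X ∩ B = X' ∩ B` into `X' ∩ Y'`. -/
lemma connectedComponentIn_eq_of_inter_eq (S : IsCurveSystem P B C T) {x x' : ℂ}
    {X Y X' Y' : Set ℂ} (hx : x ∈ P \ (B ∪ C)) (hx' : x' ∈ P \ (B ∪ C)) (h : IsCut P T x X Y)
    (h' : IsCut P T x' X' Y') (hB : X ∩ B = X' ∩ B) :
    connectedComponentIn (P \ (B ∪ C)) x = connectedComponentIn (P \ (B ∪ C)) x' := by
  have key : ∀ M, IsPreconnected M ∧ M ⊆ P \ (B ∪ C) ∧ x ∈ M ∧ x' ∈ M →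
      connectedComponentIn (P \ (B ∪ C)) x = connectedComponentIn (P \ (B ∪ C)) x' := by
    rintro M ⟨h1, h2, h3, h4⟩
    exact connectedComponentIn_eq (h1.subset_connectedComponentIn h3 h2 h4)
  by_cases hne : x = x'
  · rw [hne]
  by_cases hxx' : x' ∈ X
  · obtain ⟨M, hM⟩ := S.exists_connecting hx hx' h h' hB hxx' hne
    exact key M hM
  · rcases h'.subset_or_subset (h.isPreconnected_left S.conn.isPreconnected) h.subset_left hxx'
      with ⟨h1, -⟩ | ⟨h1, -⟩
    · obtain ⟨M, hM1, hM2, hM3, hM4⟩ := S.exists_connecting hx' hx h' h hB.symm (h1 h.mem_left)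
        (Ne.symm hne)
      exact key M ⟨hM1, hM2, hM4, hM3⟩
    · exfalso
      obtain ⟨b, hbX, hbB⟩ := S.left_inter_nonempty h
      have hbX' : b ∈ X' ∩ B := hB ▸ ⟨hbX, hbB⟩
      exact hx'.2 (Or.inl (h'.eq_of_mem hbX'.1 (h1 hbX) ▸ hbB))

/-- There are only finitely many components of the regular part. -/
lemma finite_components (S : IsCurveSystem P B C T) : (components (P \ (B ∪ C))).Finite := by
  choose! X Y hXY using S.cut
  choose! y hy hyE using fun (E : Set ℂ) (hE : E ∈ components (P \ (B ∪ C))) => hE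
  -- An edge is determined by the subset of the finite set `B` that lies above any one of its
  -- points.
  refine Finite.of_finite_image (f := fun E => X (y E) ∩ B) ?_ ?_
  · exact S.finite.finite_subsets.subset (by rintro _ ⟨E, -, rfl⟩; exact inter_subset_right)
  · intro E hE E' hE' h
    rw [hyE E hE, hyE E' hE']
    exact S.connectedComponentIn_eq_of_inter_eq (hy E hE) (hy E' hE') (hXY _ (hy E hE))
      (hXY _ (hy E' hE')) h

end IsCurveSystem

end HarmonicLevelSet

namespace HarmonicLevelSet

variable {P B C : Set ℂ} {T : ℂ → ℝ}

/-! ### Parametrization of the edges -/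

/-- If `γ` does not converge to its cluster point `p`, then by connectedness it crosses a small
sphere about `p` again and again. Compactness yields a cluster point on the sphere, which can be
chosen to miss the finite set `N`. -/
lemma exists_tendsto_of_clusterPt_finite {l : Filter ℝ} [l.NeBot] {γ : ℝ → ℂ} {s₀ : Set ℝ}
    (hl : ∀ s ∈ l, ∃ t ∈ l, t ⊆ s ∧ IsPreconnected t) (hs₀ : s₀ ∈ l) (hγ : ContinuousOn γ s₀)
    (hP : IsCompact P) (hγP : ∀ t ∈ s₀, γ t ∈ P) {N : Set ℂ} (hN : N.Finite)
    (hc : ∀ p ∈ P, MapClusterPt p l γ → p ∈ N) : ∃ p ∈ N, Filter.Tendsto γ l (𝓝 p) := by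
  obtain ⟨p, hpP, hp⟩ := hP.exists_mapClusterPt (f := l) (u := γ)
    (Filter.le_principal_iff.2 (Filter.mem_map.2 (Filter.mem_of_superset hs₀ hγP)))
  have hpN := hc p hpP hp
  refine ⟨p, hpN, ?_⟩
  obtain ⟨r, r0, hr⟩ := Metric.isOpen_iff.1 (hN.subset (sdiff_subset (t := {p}))).isClosed.isOpen_compl
    p (fun h => h.2 rfl)
  by_contra hcon
  rw [Metric.tendsto_nhds] at hcon
  push Not at hcon
  obtain ⟨ε₀, ε₀0, hε₀⟩ := hcon
  set ε := min ε₀ r / 2 with hε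
  have hmin : 0 < min ε₀ r := lt_min ε₀0 r0
  have h1 : ε ≤ ε₀ := by have := min_le_left ε₀ r; linarith
  have h2 : ε < r := by have := min_le_right ε₀ r; linarith
  have hfreq : ∃ᶠ t in l, γ t ∈ P ∩ Metric.sphere p ε := by
    rw [Filter.frequently_iff]
    intro U hU
    obtain ⟨t, ht, htU, htc⟩ := hl (U ∩ s₀) (Filter.inter_mem hU hs₀)
    obtain ⟨u, hu1, hu2⟩ := Filter.frequently_iff.1 hε₀ ht
    obtain ⟨v, hv1, hv2⟩ := Filter.frequently_iff.1 (mapClusterPt_iff_frequently.1 hp _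
      (Metric.ball_mem_nhds p (show 0 < ε by positivity))) ht
    obtain ⟨w, hw1, hw2⟩ := htc.intermediate_value hv1 hu1 (f := fun t => dist (γ t) p)
      ((continuous_id.dist continuous_const).comp_continuousOn
        (hγ.mono (htU.trans inter_subset_right)))
      (show ε ∈ _ from ⟨(Metric.mem_ball.1 hv2).le, h1.trans hu2⟩)
    exact ⟨w, (htU hw1).1, hγP w (htU hw1).2, hw2⟩
  obtain ⟨q, hq, hqc⟩ := (hP.inter_right Metric.isClosed_sphere).exists_mapClusterPt_of_frequently
    hfreq
  have hqp : dist q p = ε := hq.2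
  have hne : q ≠ p := by
    rintro rfl
    rw [dist_self] at hqp
    linarith
  exact hr (show q ∈ Metric.ball p r by rw [Metric.mem_ball, hqp]; exact h2) ⟨hc q hq.1 hqc, hne⟩

lemma exists_isPreconnected_of_mem_nhdsGT {a : ℝ} {s : Set ℝ} (hs : s ∈ 𝓝[>] a) :
    ∃ t ∈ 𝓝[>] a, t ⊆ s ∧ IsPreconnected t := by
  obtain ⟨u, hu, h⟩ := mem_nhdsGT_iff_exists_Ioo_subset.1 hs
  exact ⟨Ioo a u, Ioo_mem_nhdsGT hu, h, isPreconnected_Ioo⟩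

/-- A parametrization of the edge `E`, by the arctangent of `T`. -/
structure IsParam (E : Set ℂ) (T : ℂ → ℝ) (a b : ℝ) (γ : ℝ → ℂ) : Prop where
  lt : a < b
  cont : ContinuousOn γ (Ioo a b)
  image : γ '' Ioo a b = E
  arctan : ∀ t ∈ Ioo a b, Real.arctan (T (γ t)) = t

namespace IsParam

variable {E : Set ℂ} {a b : ℝ} {γ : ℝ → ℂ}

lemma neg (h : IsParam E T a b γ) : IsParam E (fun z => -T z) (-b) (-a) (fun t => γ (-t)) where
  lt := neg_lt_neg h.lt
  cont := h.cont.comp continuous_neg.continuousOn fun t ht =>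
    ⟨by linarith [ht.2], by linarith [ht.1]⟩
  image := by
    rw [← h.image, show (fun t => γ (-t)) = γ ∘ Neg.neg from rfl, image_comp]
    simp
  arctan t ht := by
    rw [Real.arctan_neg, h.arctan (-t) ⟨by linarith [ht.2], by linarith [ht.1]⟩, neg_neg]

lemma mem (h : IsParam E T a b γ) {t : ℝ} (ht : t ∈ Ioo a b) : γ t ∈ E := h.image ▸ ⟨t, ht, rfl⟩

lemma arctan_mem (h : IsParam E T a b γ) {z : ℂ} (hz : z ∈ E) :
    Real.arctan (T z) ∈ Ioo a b ∧ γ (Real.arctan (T z)) = z := by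
  rw [← h.image] at hz
  obtain ⟨t, ht, rfl⟩ := hz
  rw [h.arctan t ht]
  exact ⟨ht, rfl⟩

lemma injOn (h : IsParam E T a b γ) : InjOn γ (Ioo a b) := fun s hs t ht hst => by
  rw [← h.arctan s hs, hst, h.arctan t ht]

lemma injOn_edge (h : IsParam E T a b γ) : InjOn T E := fun x hx y hy hxy => by
  rw [← (h.arctan_mem hx).2, hxy, (h.arctan_mem hy).2]

end IsParam

namespace IsCurveSystem

lemma connectedComponentIn_mem_nhdsWithin (S : IsCurveSystem P B C T) {x : ℂ}
    (hx : x ∈ P \ (B ∪ C)) : connectedComponentIn (P \ (B ∪ C)) x ∈ 𝓝[P] x := by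
  obtain ⟨σ, ρ, ρ0, h1, h2, h3, h4⟩ := S.regular x hx
  have hm : Ioo (T x - ρ) (T x + ρ) ∈ 𝓝 (T x) := Ioo_mem_nhds (by linarith) (by linarith)
  have hsub : σ '' Ioo (T x - ρ) (T x + ρ) ⊆ connectedComponentIn (P \ (B ∪ C)) x :=
    (isPreconnected_Ioo.image _ h1).subset_connectedComponentIn
      ⟨T x, mem_of_mem_nhds hm, h2⟩ (by rintro _ ⟨t, ht, rfl⟩; exact (h3 t ht).1)
  filter_upwards [h4, (S.tendsto (mem_of_regular x hx)).eventually hm] with z h5 h6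
  exact hsub ⟨T z, h6, h5.symm⟩

lemma mem_component_of_mem_closure (S : IsCurveSystem P B C T) {E : Set ℂ}
    (hE : E ∈ components (P \ (B ∪ C))) {z : ℂ} (hz : z ∈ closure E) (hz' : z ∈ P \ (B ∪ C)) :
    z ∈ E := by
  obtain ⟨x, hx, rfl⟩ := hE
  have hsub := connectedComponentIn_subset (P \ (B ∪ C)) x
  have h1 := S.connectedComponentIn_mem_nhdsWithin hz'
  obtain ⟨V, hV, hVsub⟩ := mem_nhdsWithin_iff_exists_mem_nhds_inter.1 h1
  obtain ⟨w, hw1, hw2⟩ := mem_closure_iff_nhds.1 hz V hV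
  rw [connectedComponentIn_eq hw2, ← connectedComponentIn_eq (hVsub ⟨hw1, (hsub hw2).1⟩)]
  exact mem_connectedComponentIn hz'

/-- Uniqueness of sections of `T` over an interval. -/
lemma section_eq (S : IsCurveSystem P B C T) {J : Set ℝ} (hJ : IsPreconnected J) {s₁ s₂ : ℝ → ℂ}
    (h₁ : ContinuousOn s₁ J) (h₂ : ContinuousOn s₂ J)
    (h₁' : ∀ t ∈ J, s₁ t ∈ P \ (B ∪ C) ∧ T (s₁ t) = t)
    (h₂' : ∀ t ∈ J, s₂ t ∈ P \ (B ∪ C) ∧ T (s₂ t) = t) {t u : ℝ} (ht : t ∈ J) (hu : u ∈ J)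
    (h : s₁ t = s₂ t) : s₁ u = s₂ u := by
  refine (hJ.induction₂ (fun t u => s₁ t = s₂ t ↔ s₁ u = s₂ u) (fun t ht => ?_)
    (fun _ _ _ _ _ _ => Iff.trans) (fun _ _ _ _ => Iff.symm) ht hu).1 h
  by_cases he : s₁ t = s₂ t
  · obtain ⟨σ, ρ, ρ0, -, -, -, h4⟩ := S.regular _ (h₁' t ht).1
    have e1 : Filter.Tendsto s₁ (𝓝[J] t) (𝓝[P] (s₁ t)) := tendsto_nhdsWithin_iff.2
      ⟨h₁ t ht, by filter_upwards [self_mem_nhdsWithin] with v hv using (h₁' v hv).1.1⟩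
    have e2 : Filter.Tendsto s₂ (𝓝[J] t) (𝓝[P] (s₁ t)) := tendsto_nhdsWithin_iff.2
      ⟨he ▸ h₂ t ht, by filter_upwards [self_mem_nhdsWithin] with v hv using (h₂' v hv).1.1⟩
    filter_upwards [e1.eventually h4, e2.eventually h4, self_mem_nhdsWithin] with v h5 h6 hv
    rw [(h₁' v hv).2] at h5
    rw [(h₂' v hv).2] at h6
    simp only [he, true_iff]
    rw [h5, h6]
  · have hev : ∀ᶠ v in 𝓝[J] t, s₁ v ≠ s₂ v :=
      (((h₁ t ht).sub (h₂ t ht)).eventually_ne (sub_ne_zero.2 he)).mono fun v hv =>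
        sub_ne_zero.1 hv
    filter_upwards [hev] with v hv
    simp only [he, hv]

/-- The function `T` is injective on the edges. -/
lemma injOn_component (S : IsCurveSystem P B C T) {E : Set ℂ}
    (hE : E ∈ components (P \ (B ∪ C))) : InjOn T E := by
  have hEc : IsPreconnected E := by
    obtain ⟨x, -, rfl⟩ := hE
    exact isPreconnected_connectedComponentIn
  have hER : E ⊆ P \ (B ∪ C) := by
    obtain ⟨x, -, rfl⟩ := hE
    exact connectedComponentIn_subset _ _
  have key : ∀ x ∈ E, ∀ y ∈ E, ∃ (J : Set ℝ) (s : ℝ → ℂ), IsOpen J ∧ OrdConnected J ∧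
      T x ∈ J ∧ T y ∈ J ∧ ContinuousOn s J ∧ s (T x) = x ∧ s (T y) = y ∧
      ∀ t ∈ J, s t ∈ P \ (B ∪ C) ∧ T (s t) = t := by
    intro x hx y hy
    refine hEc.induction₂ (fun x y => ∃ (J : Set ℝ) (s : ℝ → ℂ), IsOpen J ∧ OrdConnected J ∧
      T x ∈ J ∧ T y ∈ J ∧ ContinuousOn s J ∧ s (T x) = x ∧ s (T y) = y ∧
      ∀ t ∈ J, s t ∈ P \ (B ∪ C) ∧ T (s t) = t) (fun x hx => ?_) ?_ ?_ hx hy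
    · obtain ⟨σ, ρ, ρ0, h1, h2, h3, h4⟩ := S.regular x (hER hx)
      have hm : Ioo (T x - ρ) (T x + ρ) ∈ 𝓝 (T x) := Ioo_mem_nhds (by linarith) (by linarith)
      have hEP : E ⊆ P := hER.trans sdiff_subset
      filter_upwards [nhdsWithin_mono x hEP h4, nhdsWithin_mono x hEP
        ((S.tendsto (mem_of_regular x (hER hx))).eventually hm)] with z h5 h6
      exact ⟨_, σ, isOpen_Ioo, ordConnected_Ioo, mem_of_mem_nhds hm, h6, h1, h2, h5.symm, h3⟩
    -- Transitivity: two sections through the same point agree on the common interval by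
    -- `section_eq`, and so glue.
    · rintro x y z - - - ⟨J, s, h1, h2, h3, h4, h5, h6, h7, h8⟩
        ⟨J', s', h1', h2', h3', h4', h5', h6', h7', h8'⟩
      classical
      have heq : ∀ t ∈ J ∩ J', s t = s' t := fun t ht =>
        S.section_eq (h2.inter h2').isPreconnected (h5.mono inter_subset_left)
          (h5'.mono inter_subset_right) (fun t ht => h8 t ht.1) (fun t ht => h8' t ht.2)
          ⟨h4, h3'⟩ ht (h7.trans h6'.symm)
      have hs : EqOn (J.piecewise s s') s J := piecewise_eqOn _ _ _
      have hs' : EqOn (J.piecewise s s') s' J' := fun t ht => by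
        by_cases htJ : t ∈ J
        · rw [hs htJ, heq t ⟨htJ, ht⟩]
        · exact piecewise_eq_of_notMem _ _ _ htJ
      refine ⟨J ∪ J', J.piecewise s s', h1.union h1', ?_, Or.inl h3, Or.inr h4', ?_, ?_, ?_, ?_⟩
      · exact (h2.isPreconnected.union (T y) h4 h3' h2'.isPreconnected).ordConnected
      · exact (h5.congr hs).union_of_isOpen (h5'.congr hs') h1 h1'
      · rw [hs h3, h6]
      · rw [hs' h4', h7']
      · rintro t (ht | ht)
        · rw [hs ht]; exact h8 t ht
        · rw [hs' ht]; exact h8' t ht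
    · rintro x y - - ⟨J, s, h1, h2, h3, h4, h5, h6, h7, h8⟩
      exact ⟨J, s, h1, h2, h4, h3, h5, h7, h6, h8⟩
  intro x hx y hy hxy
  obtain ⟨J, s, -, -, -, -, -, h6, h7, -⟩ := key x hx y hy
  rw [← h6, hxy, h7]

/-- On an edge `T` is injective with local continuous sections, so its inverse is continuous on an
open interval. That interval may be unbounded, since nothing bounds `T` near `B`; the arctangent
makes it bounded. -/
lemma exists_isParam (S : IsCurveSystem P B C T) {E : Set ℂ}
    (hE : E ∈ components (P \ (B ∪ C))) : ∃ a b γ, IsParam E T a b γ := by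
  have hinj := S.injOn_component hE
  obtain ⟨x₀, hx₀, rfl⟩ := hE
  set E := connectedComponentIn (P \ (B ∪ C)) x₀ with hEdef
  have hx₀E : x₀ ∈ E := mem_connectedComponentIn hx₀
  have hEc : IsPreconnected E := isPreconnected_connectedComponentIn
  have hER : E ⊆ P \ (B ∪ C) := connectedComponentIn_subset _ _
  have hTE : ContinuousOn T E := S.cont.mono fun z hz => mem_of_regular z (hER hz)
  set g := Function.invFunOn T E with hg
  have hgT : ∀ z ∈ E, g (T z) = z := fun z hz => hinj.leftInvOn_invFunOn hz
  -- local description of the image and of the inverse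
  have hloc : ∀ x ∈ E, ∃ ρ > 0, Ioo (T x - ρ) (T x + ρ) ⊆ T '' E ∧
      ContinuousOn g (Ioo (T x - ρ) (T x + ρ)) := by
    intro x hx
    obtain ⟨σ, ρ, ρ0, h1, h2, h3, -⟩ := S.regular x (hER hx)
    have hsub : σ '' Ioo (T x - ρ) (T x + ρ) ⊆ E := by
      rw [hEdef, connectedComponentIn_eq hx]
      exact (isPreconnected_Ioo.image _ h1).subset_connectedComponentIn
        ⟨T x, ⟨by linarith, by linarith⟩, h2⟩ (by rintro _ ⟨t, ht, rfl⟩; exact (h3 t ht).1)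
    refine ⟨ρ, ρ0, fun t ht => ⟨σ t, hsub ⟨t, ht, rfl⟩, (h3 t ht).2⟩, h1.congr fun t ht => ?_⟩
    have := hgT _ (hsub ⟨t, ht, rfl⟩)
    rwa [(h3 t ht).2] at this
  have hopen : IsOpen (T '' E) := by
    rw [Metric.isOpen_iff]
    rintro _ ⟨x, hx, rfl⟩
    obtain ⟨ρ, ρ0, h, -⟩ := hloc x hx
    exact ⟨ρ, ρ0, by rwa [Real.ball_eq_Ioo]⟩
  have hgc : ContinuousOn g (T '' E) := by
    rintro _ ⟨x, hx, rfl⟩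
    obtain ⟨ρ, ρ0, -, h⟩ := hloc x hx
    exact (h.continuousAt (Ioo_mem_nhds (by linarith) (by linarith))).continuousWithinAt
  set I := Ioo (-(Real.pi / 2)) (Real.pi / 2) ∩ Real.tan ⁻¹' (T '' E) with hI
  have hIo : IsOpen I := Real.continuousOn_tan_Ioo.isOpen_inter_preimage isOpen_Ioo hopen
  have hIeq : I = Real.arctan '' (T '' E) := by
    ext t
    constructor
    · rintro ⟨ht, h⟩
      exact ⟨_, h, Real.arctan_tan ht.1 ht.2⟩
    · rintro ⟨u, hu, rfl⟩
      exact ⟨Real.arctan_mem_Ioo u, by rwa [mem_preimage, Real.tan_arctan]⟩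
  have hIc : IsConnected I := by
    rw [hIeq]
    exact ⟨⟨_, _, ⟨x₀, hx₀E, rfl⟩, rfl⟩,
      (hEc.image _ hTE).image _ Real.continuous_arctan.continuousOn⟩
  have hbb : BddBelow I := ⟨_, fun t ht => ht.1.1.le⟩
  have hba : BddAbove I := ⟨_, fun t ht => ht.1.2.le⟩
  have hIoo : Ioo (sInf I) (sSup I) = I := by
    refine (hIc.Ioo_csInf_csSup_subset hbb hba).antisymm fun t ht => ?_
    obtain ⟨ε, ε0, hε⟩ := Metric.isOpen_iff.1 hIo t ht
    rw [Real.ball_eq_Ioo] at hε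
    constructor
    · exact (csInf_le hbb (hε (show t - ε / 2 ∈ _ from
        ⟨by linarith, by linarith⟩))).trans_lt (by linarith)
    · exact (show t < t + ε / 2 by linarith).trans_le
        (le_csSup hba (hε (show t + ε / 2 ∈ _ from ⟨by linarith, by linarith⟩)))
  refine ⟨sInf I, sSup I, g ∘ Real.tan, ?_, ?_, ?_, ?_⟩
  · obtain ⟨t, ht⟩ := hIc.nonempty
    rw [← hIoo] at ht
    exact ht.1.trans ht.2
  · rw [hIoo]
    exact hgc.comp (Real.continuousOn_tan_Ioo.mono inter_subset_left) fun t ht => ht.2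
  · rw [hIoo, hIeq, image_image, image_image]
    have : ∀ z ∈ E, (g ∘ Real.tan) (Real.arctan (T z)) = z := fun z hz => by
      rw [Function.comp_apply, Real.tan_arctan, hgT z hz]
    rw [image_congr this, image_id']
  · rw [hIoo]
    rintro t ⟨ht, z, hz, hzt⟩
    rw [Function.comp_apply, ← hzt, hgT z hz, hzt, Real.arctan_tan ht.1 ht.2]

/-- An arm at the branch point `c` on the edge `E` shows that `c` is the lower end of `E`. -/
lemma tendsto_of_arm {E : Set ℂ} (hE : E ∈ components (P \ (B ∪ C)))
    {a b : ℝ} {γ : ℝ → ℂ} (h : IsParam E T a b γ) {c : ℂ} (hc : c ∈ C) {ρ : ℝ} (hρ : 0 < ρ)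
    {ι : Type} {α : ι → ℝ → ℂ} (hα : IsArmSystem P (P \ (B ∪ C)) T c ρ α) {i : ι}
    (hi : (α i '' Ioo 0 ρ ∩ E).Nonempty) :
    α i '' Ioo 0 ρ ⊆ E ∧ Filter.Tendsto γ (𝓝[>] a) (𝓝 c) := by
  have hsub : α i '' Ioo 0 ρ ⊆ E := by
    obtain ⟨z, hz, hzE⟩ := hi
    obtain ⟨x, hx, rfl⟩ := hE
    rw [connectedComponentIn_eq hzE]
    exact (isPreconnected_Ioo.image _ ((hα.cont i).mono
      Ioo_subset_Ico_self)).subset_connectedComponentIn hz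
      (by rintro _ ⟨t, ht, rfl⟩; exact hα.mem i t ht)
  have hcE : c ∉ E := fun hcE => by
    obtain ⟨x, hx, rfl⟩ := hE
    exact (connectedComponentIn_subset _ _ hcE).2 (Or.inr hc)
  refine ⟨hsub, ?_⟩
  have hval : ∀ s ∈ Ioo 0 ρ, Real.arctan (T c + s) ∈ Ioo a b ∧ γ (Real.arctan (T c + s)) = α i s :=
    fun s hs => by
      have := h.arctan_mem (hsub ⟨s, hs, rfl⟩)
      rwa [hα.map i s hs] at this
  have hlim : Filter.Tendsto (α i) (𝓝[>] 0) (𝓝 c) := by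
    have := (hα.cont i 0 ⟨le_rfl, hρ⟩).mono Ioo_subset_Ico_self
    rwa [ContinuousWithinAt, hα.zero, nhdsWithin_Ioo_eq_nhdsGT hρ] at this
  have hatan : Filter.Tendsto (fun s => Real.arctan (T c + s)) (𝓝[>] 0)
      (𝓝[>] (Real.arctan (T c))) := by
    refine tendsto_nhdsWithin_iff.2 ⟨?_, ?_⟩
    · have : ContinuousAt (fun s => Real.arctan (T c + s)) 0 := by
        exact Real.continuous_arctan.continuousAt.comp (by fun_prop)
      have h2 : Filter.Tendsto (fun s => Real.arctan (T c + s)) (𝓝 0)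
        (𝓝 (Real.arctan (T c + 0))) := this
      rw [add_zero] at h2
      exact h2.mono_left nhdsWithin_le_nhds
    · filter_upwards [self_mem_nhdsWithin] with s hs
      exact Real.arctan_strictMono (lt_add_of_pos_right _ hs)
  have hev : ∀ᶠ s in 𝓝[>] (0 : ℝ), s ∈ Ioo 0 ρ := Ioo_mem_nhdsGT hρ
  have hγlim : Filter.Tendsto (fun s => γ (Real.arctan (T c + s))) (𝓝[>] 0) (𝓝 c) :=
    hlim.congr' (hev.mono fun s hs => (hval s hs).2.symm)
  -- Along the arm the parameter decreases to `arctan (T c)`. Were this an inner point of the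
  -- interval, continuity of `γ` would put `c` on the edge.
  have hta : Real.arctan (T c) = a := by
    have h1 : a ≤ Real.arctan (T c) := ge_of_tendsto (hatan.mono_right nhdsWithin_le_nhds)
      (hev.mono fun s hs => (hval s hs).1.1.le)
    refine le_antisymm (not_lt.1 fun h2 => hcE ?_) h1
    have h3 : Real.arctan (T c) ∈ Ioo a b :=
      ⟨h2, (Real.arctan_strictMono (show T c < T c + ρ / 2 by linarith)).trans
        (hval (ρ / 2) ⟨by linarith, by linarith⟩).1.2⟩
    have h4 : Filter.Tendsto γ (𝓝[>] (Real.arctan (T c))) (𝓝 (γ (Real.arctan (T c)))) :=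
      (h.cont.continuousAt (isOpen_Ioo.mem_nhds h3)).tendsto.mono_left nhdsWithin_le_nhds
    rw [tendsto_nhds_unique hγlim (h4.comp hatan)]
    exact h.mem h3
  -- transport the limit along the arctangent
  have hback : Filter.Tendsto (fun t => Real.tan t - T c) (𝓝[>] a) (𝓝[>] 0) := by
    rw [← hta]
    have hmem := Real.arctan_mem_Ioo (T c)
    refine tendsto_nhdsWithin_iff.2 ⟨?_, ?_⟩
    · have h1 : ContinuousAt (fun t => Real.tan t - T c) (Real.arctan (T c)) :=
        (Real.continuousOn_tan_Ioo.continuousAt (isOpen_Ioo.mem_nhds hmem)).sub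
          continuousAt_const
      have h2 : Filter.Tendsto (fun t => Real.tan t - T c) (𝓝 (Real.arctan (T c)))
        (𝓝 (Real.tan (Real.arctan (T c)) - T c)) := h1
      rw [Real.tan_arctan, sub_self] at h2
      exact h2.mono_left nhdsWithin_le_nhds
    · filter_upwards [Ioo_mem_nhdsGT hmem.2] with t ht
      have h1 : T c < Real.tan t := by
        rw [← Real.arctan_strictMono.lt_iff_lt, Real.arctan_tan (hmem.1.trans ht.1) ht.2]
        exact ht.1
      exact sub_pos.2 h1
  refine (hγlim.comp hback).congr' ?_
  have hab := h.lt
  filter_upwards [Ioo_mem_nhdsGT (show a < Real.pi / 2 from hta ▸ Real.arctan_lt_pi_div_two _)]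
    with t ht
  simp only [Function.comp_apply, add_sub_cancel]
  rw [Real.arctan_tan ((hta ▸ (Real.arctan_mem_Ioo (T c)).1).trans ht.1) ht.2]

/-- Each branch point is the lower end of an edge; an edge has only one lower end, and there are
finitely many edges. -/
lemma finite_branch (S : IsCurveSystem P B C T) : C.Finite := by
  have hex : ∀ c ∈ C, ∃ E ∈ components (P \ (B ∪ C)), ∀ a b γ, IsParam E T a b γ →
      Filter.Tendsto γ (𝓝[>] a) (𝓝 c) := by
    intro c hc
    obtain ⟨ι, ρ, α, β, h0, ρ0, hα, -⟩ := S.branch c hc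
    obtain ⟨i⟩ := h0.to_nonempty
    have hm : ρ / 2 ∈ Ioo 0 ρ := ⟨by linarith, by linarith⟩
    have hR := hα.mem i _ hm
    refine ⟨_, ⟨_, hR, rfl⟩, fun a b γ h => ?_⟩
    exact (tendsto_of_arm ⟨_, hR, rfl⟩ h hc ρ0 hα
      ⟨_, ⟨ρ / 2, hm, rfl⟩, mem_connectedComponentIn hR⟩).2
  choose! E hE hEl using hex
  refine Finite.of_finite_image (f := E) (S.finite_components.subset ?_) ?_
  · rintro _ ⟨c, hc, rfl⟩; exact hE c hc
  · intro c hc c' hc' hcc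
    obtain ⟨a, b, γ, h⟩ := S.exists_isParam (hE c hc)
    exact tendsto_nhds_unique (hEl c hc a b γ h) (hEl c' hc' a b γ (hcc ▸ h))

lemma finite_nodes (S : IsCurveSystem P B C T) : (B ∪ C).Finite := S.finite.union S.finite_branch

/-- A regular cluster point of `γ` at `a` would lie on `E`, since edges are closed in the regular
part. There `arctan T` exceeds `a`, whereas along `γ` it tends to `a`. -/
lemma exists_lower_end (S : IsCurveSystem P B C T) {E : Set ℂ}
    (hE : E ∈ components (P \ (B ∪ C))) {a b : ℝ} {γ : ℝ → ℂ} (h : IsParam E T a b γ) :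
    ∃ p ∈ B ∪ C, Filter.Tendsto γ (𝓝[>] a) (𝓝 p) := by
  have hER : E ⊆ P \ (B ∪ C) := by
    obtain ⟨x, -, rfl⟩ := hE
    exact connectedComponentIn_subset _ _
  have hIoo : Ioo a b ∈ 𝓝[>] a := Ioo_mem_nhdsGT h.lt
  refine exists_tendsto_of_clusterPt_finite (fun s => exists_isPreconnected_of_mem_nhdsGT)
    hIoo h.cont S.compact (fun t ht => (hER (h.mem ht)).1) S.finite_nodes fun p hpP hp => ?_
  by_contra hpN
  have hpR : p ∈ P \ (B ∪ C) := ⟨hpP, hpN⟩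
  have hpE : p ∈ E := by
    refine S.mem_component_of_mem_closure hE (mem_closure_iff_nhds.2 fun V hV => ?_) hpR
    obtain ⟨t, ht1, ht2⟩ := ((mapClusterPt_iff_frequently.1 hp V hV).and_eventually hIoo).exists
    exact ⟨γ t, ht1, h.mem ht2⟩
  have hpA := (h.arctan_mem hpE).1
  have h1 : Filter.Tendsto (fun z => Real.arctan (T z)) (𝓝[P] p) (𝓝 (Real.arctan (T p))) :=
    (Real.continuous_arctan.tendsto _).comp (S.tendsto (mem_of_regular p hpR))
  set m := (a + Real.arctan (T p)) / 2 with hm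
  have h2 := h1.eventually (lt_mem_nhds (show m < Real.arctan (T p) by linarith [hpA.1]))
  obtain ⟨V, hV, hVsub⟩ := mem_nhdsWithin_iff_exists_mem_nhds_inter.1 h2
  obtain ⟨t, ⟨ht1, ht2⟩, ht3⟩ := (((mapClusterPt_iff_frequently.1 hp V hV).and_eventually
    hIoo).and_eventually (Ioo_mem_nhdsGT (show a < m by linarith [hpA.1]))).exists
  have h3 : m < Real.arctan (T (γ t)) := hVsub ⟨ht1, (hER (h.mem ht2)).1⟩
  rw [h.arctan t ht2] at h3
  exact lt_asymm h3 ht3.2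

lemma tendsto_nhdsLT_of_neg {γ : ℝ → ℂ} {b : ℝ} {p : ℂ}
    (h : Filter.Tendsto (fun t => γ (-t)) (𝓝[>] (-b)) (𝓝 p)) : Filter.Tendsto γ (𝓝[<] b) (𝓝 p) := by
  have h1 : Filter.Tendsto (fun t : ℝ => -t) (𝓝[<] b) (𝓝[>] (-b)) := by
    refine tendsto_nhdsWithin_iff.2 ⟨(continuous_neg.tendsto b).mono_left nhdsWithin_le_nhds, ?_⟩
    filter_upwards [self_mem_nhdsWithin] with t ht
    exact neg_lt_neg (show t < b from ht)
  simpa [Function.comp_def] using h.comp h1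

lemma tendsto_nhdsGT_neg {γ : ℝ → ℂ} {b : ℝ} {p : ℂ} (h : Filter.Tendsto γ (𝓝[<] b) (𝓝 p)) :
    Filter.Tendsto (fun t => γ (-t)) (𝓝[>] (-b)) (𝓝 p) := by
  refine h.comp (tendsto_nhdsWithin_iff.2 ⟨?_, ?_⟩)
  · have := (continuous_neg.tendsto (-b)).mono_left (nhdsWithin_le_nhds (s := Ioi (-b)))
    rwa [neg_neg] at this
  · filter_upwards [self_mem_nhdsWithin] with t ht
    exact neg_lt.1 (show -b < t from ht)

lemma exists_upper_end (S : IsCurveSystem P B C T) {E : Set ℂ}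
    (hE : E ∈ components (P \ (B ∪ C))) {a b : ℝ} {γ : ℝ → ℂ} (h : IsParam E T a b γ) :
    ∃ p ∈ B ∪ C, Filter.Tendsto γ (𝓝[<] b) (𝓝 p) := by
  obtain ⟨p, hp, hl⟩ := S.neg.exists_lower_end hE h.neg
  exact ⟨p, hp, tendsto_nhdsLT_of_neg hl⟩

/-- The edges as curves on the unit interval. -/
lemma exists_curve (S : IsCurveSystem P B C T) {E : Set ℂ}
    (hE : E ∈ components (P \ (B ∪ C))) : ∃ (a b : ℝ) (γ : ℝ → ℂ) (c : C(unitInterval, ℂ)),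
      IsParam E T a b γ ∧ c 0 ∈ B ∪ C ∧ c 1 ∈ B ∪ C ∧ c '' Ioo 0 1 = E ∧ InjOn c (Ioo 0 1) ∧
      StrictMonoOn (fun s => T (c s)) (Ioo 0 1) ∧
      Filter.Tendsto γ (𝓝[>] a) (𝓝 (c 0)) ∧ Filter.Tendsto γ (𝓝[<] b) (𝓝 (c 1)) := by
  obtain ⟨a, b, γ, h⟩ := S.exists_isParam hE
  obtain ⟨p, hp, hpl⟩ := S.exists_lower_end hE h
  obtain ⟨q, hq, hql⟩ := S.exists_upper_end hE h
  have hba : 0 < b - a := sub_pos.2 h.lt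
  have hG := continuousOn_Icc_extendFrom_Ioo h.cont hpl hql
  have hGa : extendFrom (Ioo a b) γ a = p := eq_lim_at_left_extendFrom_Ioo h.lt hpl
  have hGb : extendFrom (Ioo a b) γ b = q := eq_lim_at_right_extendFrom_Ioo h.lt hql
  have hGi : ∀ t ∈ Ioo a b, extendFrom (Ioo a b) γ t = γ t := fun t ht =>
    extendFrom_extends h.cont t ht
  have hmaps : ∀ s : unitInterval, a + (b - a) * s ∈ Icc a b := fun s =>
    ⟨by nlinarith [s.2.1], by nlinarith [s.2.2]⟩
  have hmaps' : ∀ s ∈ Ioo (0 : unitInterval) 1, a + (b - a) * s ∈ Ioo a b := fun s hs => by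
    have h0 : (0 : ℝ) < s := hs.1
    have h1 : (s : ℝ) < 1 := hs.2
    exact ⟨by nlinarith, by nlinarith⟩
  set c : C(unitInterval, ℂ) := ⟨fun s => extendFrom (Ioo a b) γ (a + (b - a) * s),
    hG.comp_continuous (by fun_prop) hmaps⟩ with hc
  have hci : ∀ s ∈ Ioo (0 : unitInterval) 1, c s = γ (a + (b - a) * s) := fun s hs =>
    hGi _ (hmaps' s hs)
  have hc0 : c 0 = p := by simp [hc, hGa]
  have hc1 : c 1 = q := by simp [hc, hGb]
  refine ⟨a, b, γ, c, h, hc0 ▸ hp, hc1 ▸ hq, ?_, ?_, ?_, hc0 ▸ hpl, hc1 ▸ hql⟩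
  · rw [← h.image]
    ext z
    constructor
    · rintro ⟨s, hs, rfl⟩
      exact ⟨_, hmaps' s hs, (hci s hs).symm⟩
    · rintro ⟨t, ht, rfl⟩
      have h0 : 0 < (t - a) / (b - a) := div_pos (by linarith [ht.1]) hba
      have h1 : (t - a) / (b - a) < 1 := (div_lt_one hba).2 (by linarith [ht.2])
      refine ⟨⟨(t - a) / (b - a), h0.le, h1.le⟩, ⟨h0, h1⟩, ?_⟩
      rw [hci _ ⟨h0, h1⟩]
      congr 1
      simp only
      field_simp
      ring
  · intro s hs t ht hst
    rw [hci s hs, hci t ht] at hst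
    have := h.injOn (hmaps' s hs) (hmaps' t ht) hst
    apply Subtype.ext
    nlinarith
  · intro s hs t ht hst
    have hst' : (s : ℝ) < t := hst
    simp only
    rw [hci s hs, hci t ht, ← Real.arctan_strictMono.lt_iff_lt, h.arctan _ (hmaps' s hs),
      h.arctan _ (hmaps' t ht)]
    nlinarith

/-- The edges starting at a branch point correspond to the arms leaving it. -/
lemma encard_lower_end (S : IsCurveSystem P B C T)
    {a b : components (P \ (B ∪ C)) → ℝ} {γ : components (P \ (B ∪ C)) → ℝ → ℂ}
    {v : components (P \ (B ∪ C)) → ℂ} (h : ∀ E, IsParam E.1 T (a E) (b E) (γ E))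
    (hv : ∀ E, Filter.Tendsto (γ E) (𝓝[>] (a E)) (𝓝 (v E))) {c : ℂ} (hc : c ∈ C) {ρ : ℝ}
    (hρ : 0 < ρ) {ι : Type} {α : ι → ℝ → ℂ} (hα : IsArmSystem P (P \ (B ∪ C)) T c ρ α) :
    {E | v E = c}.encard = ENat.card ι := by
  have hm : ρ / 2 ∈ Ioo 0 ρ := ⟨by linarith, by linarith⟩
  set F : ι → components (P \ (B ∪ C)) := fun i => ⟨_, α i (ρ / 2), hα.mem i _ hm, rfl⟩ with hF
  have hF' : ∀ i, α i '' Ioo 0 ρ ⊆ (F i).1 ∧ v (F i) = c := fun i => by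
    have := tendsto_of_arm (F i).2 (h (F i)) hc hρ hα (i := i)
      ⟨_, ⟨ρ / 2, hm, rfl⟩, mem_connectedComponentIn (hα.mem i _ hm)⟩
    exact ⟨this.1, tendsto_nhds_unique (hv (F i)) this.2⟩
  -- At equal parameters all arms have the same value of `T`, which is injective on an edge.
  have hFinj : Function.Injective F := fun i j hij => by
    have hi := (hF' i).1 ⟨ρ / 2, hm, rfl⟩
    have hj := (hF' j).1 ⟨ρ / 2, hm, rfl⟩
    rw [← hij] at hj
    refine hα.inj i j (ρ / 2) hm ((h (F i)).injOn_edge hi hj ?_)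
    rw [hα.map i _ hm, hα.map j _ hm]
  have hFrange : range F = {E | v E = c} := by
    refine Subset.antisymm (by rintro _ ⟨i, rfl⟩; exact (hF' i).2) fun E hE => ?_
    have hER : E.1 ⊆ P \ (B ∪ C) := by
      obtain ⟨x, -, hx⟩ := E.2
      rw [hx]
      exact connectedComponentIn_subset _ _
    have hab := (h E).lt
    have hIoo : ∀ᶠ t in 𝓝[>] (a E), t ∈ Ioo (a E) (b E) := Ioo_mem_nhdsGT hab
    have hlim : Filter.Tendsto (γ E) (𝓝[>] (a E)) (𝓝[P] c) := tendsto_nhdsWithin_iff.2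
      ⟨hE ▸ hv E, hIoo.mono fun t ht => (hER ((h E).mem ht)).1⟩
    have hTlim := (S.tendsto (S.branch_subset hc)).comp hlim
    have hmono : ∀ t ∈ Ioo (a E) (b E), T c < T (γ E t) := by
      intro t ht
      set u := (a E + t) / 2 with hu
      have hu' : u ∈ Ioo (a E) (b E) := ⟨by linarith [ht.1], by linarith [ht.1, ht.2]⟩
      have h1 : T (γ E u) < T (γ E t) := by
        rw [← Real.arctan_strictMono.lt_iff_lt, (h E).arctan u hu', (h E).arctan t ht]
        linarith [ht.1]
      refine lt_of_le_of_lt (le_of_tendsto hTlim ?_) h1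
      filter_upwards [Ioo_mem_nhdsGT hu'.1] with w hw
      rw [Function.comp_apply, ← Real.arctan_strictMono.le_iff_le, (h E).arctan u hu',
        (h E).arctan w ⟨hw.1, hw.2.trans hu'.2⟩]
      exact hw.2.le
    -- Close to its lower end `c` the edge has `T` slightly above `T c`, so it runs into the region
    -- covered by the arms.
    obtain ⟨t, ⟨ht1, ht2⟩, ht3⟩ := ((hIoo.and (hlim.eventually hα.cover)).and
      (hTlim.eventually (gt_mem_nhds (show T c < T c + ρ by linarith)))).exists
    simp only [Function.comp_apply] at ht3
    have h2 := hmono t ht1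
    obtain ⟨i, hi⟩ := ht2 h2
    refine ⟨i, Subtype.ext ?_⟩
    have h3 : γ E t ∈ (F i).1 := (hF' i).1 ⟨_, ⟨sub_pos.2 h2, by linarith⟩, hi.symm⟩
    have h4 : γ E t ∈ E.1 := (h E).mem ht1
    obtain ⟨x, -, hx⟩ := E.2
    rw [hx] at h4 ⊢
    rw [connectedComponentIn_eq h4]
    exact connectedComponentIn_eq h3
  rw [← hFrange, ← image_univ, hFinj.encard_image, encard_univ]

end IsCurveSystem

end HarmonicLevelSet

namespace HarmonicLevelSet

/-! ### Trees are simply connected -/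

/-- `A` is a strong deformation retract of `Q`. -/
def DeformsTo (Q A : Set ℂ) : Prop :=
  ∃ H : ℂ × ℝ → ℂ, ContinuousOn H (Q ×ˢ Icc 0 1) ∧ (∀ z ∈ Q, ∀ t ∈ Icc (0 : ℝ) 1, H (z, t) ∈ Q) ∧
    (∀ z ∈ Q, H (z, 0) = z) ∧ (∀ z ∈ Q, H (z, 1) ∈ A) ∧
    ∀ z ∈ A, ∀ t ∈ Icc (0 : ℝ) 1, H (z, t) = z

lemma deformsTo_refl (Q : Set ℂ) : DeformsTo Q Q :=
  ⟨Prod.fst, continuous_fst.continuousOn, fun _ hz _ _ => hz, fun _ _ => rfl, fun _ hz => hz,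
    fun _ _ _ _ => rfl⟩

/-- The homotopy fixes `D` pointwise, so it glues with the identity of `A`. -/
lemma DeformsTo.union {Q A D : Set ℂ} (hA : IsClosed A) (hQ : IsClosed Q) (h : DeformsTo Q D)
    (hD : A ∩ Q = D) : DeformsTo (A ∪ Q) A := by
  classical
  obtain ⟨H, h1, h2, h3, h4, h5⟩ := h
  set G : ℂ × ℝ → ℂ := (A ×ˢ univ).piecewise Prod.fst H with hG
  have hGA : ∀ z ∈ A, ∀ t, G (z, t) = z := fun z hz t =>
    piecewise_eq_of_mem _ _ _ (mk_mem_prod hz (mem_univ t))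
  have hGQ : ∀ z ∈ Q, ∀ t ∈ Icc (0 : ℝ) 1, G (z, t) = H (z, t) := fun z hz t ht => by
    by_cases hzA : z ∈ A
    · rw [hGA z hzA, h5 z (hD ▸ ⟨hzA, hz⟩) t ht]
    · exact piecewise_eq_of_notMem _ _ _ fun h => hzA h.1
  refine ⟨G, ?_, ?_, ?_, ?_, fun z hz t _ => hGA z hz t⟩
  · rw [union_prod]
    refine ContinuousOn.union_of_isClosed ?_ ?_ (hA.prod isClosed_Icc) (hQ.prod isClosed_Icc)
    · exact continuous_fst.continuousOn.congr fun p hp => hGA p.1 hp.1 p.2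
    · exact h1.congr fun p hp => hGQ p.1 hp.1 p.2 hp.2
  · rintro z (hz | hz) t ht
    · rw [hGA z hz]; exact Or.inl hz
    · rw [hGQ z hz t ht]; exact Or.inr (h2 z hz t ht)
  · rintro z (hz | hz)
    · rw [hGA z hz]
    · rw [hGQ z hz 0 ⟨le_rfl, zero_le_one⟩, h3 z hz]
  · rintro z (hz | hz)
    · rw [hGA z hz]; exact hz
    · rw [hGQ z hz 1 ⟨zero_le_one, le_rfl⟩]
      have := h4 z hz
      rw [← hD] at this
      exact this.1

lemma DeformsTo.trans {Q A D : Set ℂ} (hQ : IsClosed Q) (hAQ : A ⊆ Q) (hDA : D ⊆ A)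
    (h : DeformsTo Q A) (h' : DeformsTo A D) : DeformsTo Q D := by
  classical
  obtain ⟨H, h1, h2, h3, h4, h5⟩ := h
  obtain ⟨H', h1', h2', h3', h4', h5'⟩ := h'
  set F₁ : ℂ × ℝ → ℂ := fun p => H (p.1, 2 * p.2) with hF₁
  set F₂ : ℂ × ℝ → ℂ := fun p => H' (H (p.1, 1), 2 * p.2 - 1) with hF₂
  set G : ℂ × ℝ → ℂ := (univ ×ˢ Iic (1 / 2)).piecewise F₁ F₂ with hG
  have hG1 : ∀ z, ∀ t ≤ (1 / 2 : ℝ), G (z, t) = H (z, 2 * t) := fun z t ht =>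
    piecewise_eq_of_mem _ _ _ (mk_mem_prod (mem_univ z) ht)
  have hG2 : ∀ z ∈ Q, ∀ t ≥ (1 / 2 : ℝ), G (z, t) = H' (H (z, 1), 2 * t - 1) := by
    intro z hz t ht
    rcases (show 1 / 2 ≤ t from ht).eq_or_lt with rfl | ht'
    · rw [hG1 z _ le_rfl]
      norm_num
      rw [h3' _ (h4 z hz)]
    · exact piecewise_eq_of_notMem _ _ _ fun h => absurd h.2 (not_le.2 ht')
  have hIcc : Icc (0 : ℝ) 1 = Icc 0 (1 / 2) ∪ Icc (1 / 2) 1 :=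
    (Icc_union_Icc_eq_Icc (by norm_num) (by norm_num)).symm
  have hc1 : ContinuousOn (fun z => H (z, (1 : ℝ))) Q :=
    h1.comp (by fun_prop) fun z hz => ⟨hz, zero_le_one, le_rfl⟩
  refine ⟨G, ?_, ?_, ?_, ?_, ?_⟩
  · rw [hIcc, prod_union]
    refine ContinuousOn.union_of_isClosed ?_ ?_ (hQ.prod isClosed_Icc) (hQ.prod isClosed_Icc)
    · refine ContinuousOn.congr (f := F₁) ?_ fun p hp => hG1 p.1 p.2 hp.2.2
      exact h1.comp (by fun_prop) fun p hp =>
        ⟨hp.1, by linarith [hp.2.1], by linarith [hp.2.2]⟩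
    · refine ContinuousOn.congr (f := F₂) ?_ fun p hp => hG2 p.1 hp.1 p.2 hp.2.1
      refine h1'.comp (ContinuousOn.prodMk (hc1.comp continuousOn_fst fun p hp => hp.1)
        (by fun_prop)) fun p hp => ⟨h4 _ hp.1, by linarith [hp.2.1], by linarith [hp.2.2]⟩
  · intro z hz t ht
    rcases le_total t (1 / 2) with h | h
    · rw [hG1 z t h]; exact h2 z hz _ ⟨by linarith [ht.1], by linarith⟩
    · rw [hG2 z hz t h]; exact hAQ (h2' _ (h4 z hz) _ ⟨by linarith, by linarith [ht.2]⟩)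
  · intro z hz
    rw [hG1 z 0 (by norm_num), mul_zero, h3 z hz]
  · intro z hz
    rw [hG2 z hz 1 (by norm_num)]
    norm_num
    exact h4' _ (h4 z hz)
  · intro z hz t ht
    rcases le_total t (1 / 2) with h | h
    · rw [hG1 z t h]; exact h5 z (hDA hz) _ ⟨by linarith [ht.1], by linarith⟩
    · rw [hG2 z (hAQ (hDA hz)) t h, h5 z (hDA hz) 1 ⟨zero_le_one, le_rfl⟩]
      exact h5' z hz _ ⟨by linarith, by linarith [ht.2]⟩

lemma DeformsTo.isSimplyConnected {Q : Set ℂ} {v : ℂ} (hv : v ∈ Q) (h : DeformsTo Q {v}) :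
    IsSimplyConnected Q := by
  obtain ⟨H, h1, h2, h3, h4, -⟩ := h
  have : ContractibleSpace Q := by
    rw [contractible_iff_id_nullhomotopic]
    refine ⟨⟨v, hv⟩, ⟨⟨⟨fun p => ⟨H (p.2, p.1), h2 _ p.2.2 _ p.1.2⟩, ?_⟩, ?_, ?_⟩⟩⟩
    · exact Continuous.subtype_mk
        (h1.comp_continuous (by fun_prop) fun p => ⟨p.2.2, p.1.2⟩) _
    · intro z
      exact Subtype.ext (h3 z z.2)
    · intro z
      exact Subtype.ext (h4 z z.2)
  exact SimplyConnectedSpace.ofContractible Q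

/-- An injective curve on the compact interval is an embedding, so the arc shrinks to its end by
scaling the parameter. -/
lemma deformsTo_range {c : C(unitInterval, ℂ)} (hc : Function.Injective c) :
    DeformsTo (range c) {c 0} := by
  have he : IsEmbedding c := (c.continuous.isClosedEmbedding hc).isEmbedding
  set s : ℂ → unitInterval := Function.invFun c with hs
  have hsc : ∀ t, s (c t) = t := Function.leftInverse_invFun hc
  have hscont : ContinuousOn s (range c) := by
    rw [continuousOn_iff_continuous_domRestrict]
    convert he.toHomeomorph.symm.continuous using 1
    ext z : 1
    obtain ⟨z, t, rfl⟩ := z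
    rw [domRestrict_apply, hsc, eq_comm, Homeomorph.symm_apply_eq]
    rfl
  refine ⟨fun p => c (s p.1 * unitInterval.symm (projIcc 0 1 zero_le_one p.2)), ?_, ?_, ?_, ?_, ?_⟩
  · refine c.continuous.comp_continuousOn (ContinuousOn.mul
      (hscont.comp continuousOn_fst fun p hp => hp.1) ?_)
    exact (unitInterval.continuous_symm.comp
      (continuous_projIcc.comp continuous_snd)).continuousOn
  · exact fun z _ t _ => ⟨_, rfl⟩
  · rintro _ ⟨t, rfl⟩
    simp [hsc]
  · rintro _ ⟨t, rfl⟩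
    simp
  · rintro _ rfl t ht
    simp [hsc]

lemma deformsTo_range' {c : C(unitInterval, ℂ)} (hc : Function.Injective c) :
    DeformsTo (range c) {c 1} := by
  have := deformsTo_range (c := c.comp ⟨unitInterval.symm, unitInterval.continuous_symm⟩)
    (hc.comp unitInterval.symm_bijective.injective)
  have hr : range (c.comp ⟨unitInterval.symm, unitInterval.continuous_symm⟩) = range c := by
    rw [ContinuousMap.coe_comp, range_comp]
    simp [unitInterval.symm_bijective.surjective.range_eq]
  rw [hr] at this
  simpa using this

/-- Two pieces joined by an arc. -/
lemma DeformsTo.join {A K D : Set ℂ} {p q v : ℂ} (hA : IsClosed A) (hK : IsClosed K)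
    (hD : IsClosed D) (hAK : A ∩ K = {p}) (hDK : D ∩ K = {q}) (hAD : Disjoint A D)
    (hKp : DeformsTo K {p}) (hDq : DeformsTo D {q}) (hv : v ∈ A) (hAv : DeformsTo A {v}) :
    DeformsTo (A ∪ K ∪ D) {v} := by
  have h1 : DeformsTo (A ∪ K ∪ D) (A ∪ K) := DeformsTo.union (hA.union hK) hD hDq (by
    rw [union_inter_distrib_right, disjoint_iff_inter_eq_empty.1 hAD, empty_union, inter_comm, hDK])
  have h2 : DeformsTo (A ∪ K) A := DeformsTo.union hA hK hKp hAK
  exact DeformsTo.trans ((hA.union hK).union hD) subset_union_left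
    (singleton_subset_iff.2 (Or.inl hv)) h1
    (DeformsTo.trans (hA.union hK) subset_union_left (singleton_subset_iff.2 hv) h2 hAv)

variable {P B C : Set ℂ} {T : ℂ → ℝ}

namespace IsCurveSystem

lemma isClosed_diff_component (S : IsCurveSystem P B C T) {E : Set ℂ}
    (hE : E ∈ components (P \ (B ∪ C))) : IsClosed (P \ E) := by
  rw [← closure_subset_iff_isClosed]
  intro z hz
  have hzP : z ∈ P := closure_minimal sdiff_subset S.compact.isClosed hz
  refine ⟨hzP, fun hzE => ?_⟩
  obtain ⟨x, hx, rfl⟩ := hE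
  have h1 := S.connectedComponentIn_mem_nhdsWithin (connectedComponentIn_subset _ _ hzE)
  obtain ⟨V, hV, hVsub⟩ := mem_nhdsWithin_iff_exists_mem_nhds_inter.1 h1
  obtain ⟨w, hw1, hw2⟩ := mem_closure_iff_nhds.1 hz V hV
  apply hw2.2
  rw [connectedComponentIn_eq hzE]
  exact hVsub ⟨hw1, hw2.1⟩

lemma eq_of_mem_components {R E E' : Set ℂ} (hE : E ∈ components R) (hE' : E' ∈ components R)
    {z : ℂ} (hz : z ∈ E) (hz' : z ∈ E') : E = E' := by
  obtain ⟨x, -, rfl⟩ := hE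
  obtain ⟨x', -, rfl⟩ := hE'
  rw [connectedComponentIn_eq hz, connectedComponentIn_eq hz']

/-- Induction on the number of edges in `Q`, a closed connected union of edges and nodes. A cut at
an inner point of an edge leaves, after removal of the edge, one piece on each side. Both are again
closed, connected and saturated, have fewer edges, and meet the closed edge in one end each, so they
and the edge contract one after the other. -/
lemma deformsTo_of_saturated (S : IsCurveSystem P B C T) (n : ℕ) : ∀ Q ⊆ P, IsClosed Q →
    IsPreconnected Q → (∀ E ∈ components (P \ (B ∪ C)), E ⊆ Q ∨ Disjoint E Q) →
    {E | E ∈ components (P \ (B ∪ C)) ∧ E ⊆ Q}.ncard = n → ∀ v ∈ Q ∩ (B ∪ C),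
    DeformsTo Q {v} := by
  induction n using Nat.strong_induction_on with
  | _ n ih =>
  intro Q hQP hQ hQc hsat hn v hv
  by_cases hex : ∃ E ∈ components (P \ (B ∪ C)), E ⊆ Q
  swap
  -- Without edges, `Q` is a connected subset of the finite set of nodes, hence one point.
  · have hsub : Q ⊆ B ∪ C := by
      intro z hz
      by_contra hzN
      have hzR : z ∈ P \ (B ∪ C) := ⟨hQP hz, hzN⟩
      rcases hsat _ ⟨z, hzR, rfl⟩ with h | h
      · exact hex ⟨_, ⟨z, hzR, rfl⟩, h⟩
      · exact disjoint_left.1 h (mem_connectedComponentIn hzR) hz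
    have hss : Q.Subsingleton := by
      rw [← not_nontrivial_iff]
      exact fun h => hQc.infinite_of_nontrivial h (S.finite_nodes.subset hsub)
    rw [hss.eq_singleton_of_mem hv.1]
    exact deformsTo_refl _
  obtain ⟨E, hE, hEQ⟩ := hex
  obtain ⟨a, b, γ, c, -, hc0, hc1, hcE, hcinj, hcT, -, -⟩ := S.exists_curve hE
  have hER : E ⊆ P \ (B ∪ C) := by
    obtain ⟨x, -, rfl⟩ := hE
    exact connectedComponentIn_subset _ _
  have hcm : ∀ s ∈ Ioo (0 : unitInterval) 1, c s ∈ E := fun s hs => hcE ▸ ⟨s, hs, rfl⟩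
  have hNE : ∀ z ∈ B ∪ C, z ∉ E := fun z hz hzE => (hER hzE).2 hz
  have hcl : ∀ s, c s ∈ closure E := by
    intro s
    have h1 : c '' closure (Ioo 0 1) ⊆ closure E := by
      rw [← hcE]; exact image_closure_subset_closure_image c.continuous
    rw [closure_Ioo zero_ne_one] at h1
    exact h1 ⟨s, ⟨s.2.1, s.2.2⟩, rfl⟩
  have hcQ : ∀ s, c s ∈ Q := fun s => closure_minimal hEQ hQ (hcl s)
  -- As `T` increases along `c`, the end `c 1` lies above the cut at `x` and `c 0` below it. In
  -- particular the edge is not a loop, and `c` is injective up to its ends.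
  obtain ⟨x₀, h0, h1⟩ : ∃ s : unitInterval, 0 < s ∧ s < 1 := exists_between zero_lt_one
  set x := c x₀ with hx
  have hxE : x ∈ E := hcm x₀ ⟨h0, h1⟩
  obtain ⟨X, Y, hXY⟩ := S.cut x (hER hxE)
  have hlim : Filter.Tendsto c (𝓝 x₀) (𝓝[P] x) := tendsto_nhdsWithin_iff.2
    ⟨c.continuous.tendsto x₀, Filter.Eventually.of_forall fun s => hQP (hcQ s)⟩
  have hxne : ∀ s, s ≠ x₀ → c s ≠ x := by
    intro s hs h
    rcases eq_or_ne s 0 with rfl | hs0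
    · exact hNE _ hc0 (h ▸ hxE)
    rcases eq_or_ne s 1 with rfl | hs1
    · exact hNE _ hc1 (h ▸ hxE)
    exact hs (hcinj ⟨pos_iff_ne_zero.2 hs0, lt_of_le_of_ne s.2.2 hs1⟩ ⟨h0, h1⟩ h)
  have hc1X : c 1 ∈ X := by
    have hev := (hlim.mono_left nhdsWithin_le_nhds : Filter.Tendsto c (𝓝[>] x₀) _).eventually
      hXY.left
    have hnb : (𝓝[>] x₀).NeBot := nhdsGT_neBot_of_exists_gt ⟨1, h1⟩
    obtain ⟨s, hs1, hs2⟩ := (hev.and (Ioo_mem_nhdsGT h1)).exists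
    have hsX := hs1 (hcT ⟨h0, h1⟩ ⟨h0.trans hs2.1, hs2.2⟩ hs2.1).le
    have hpre : IsPreconnected (c '' Ioc x₀ 1) := isPreconnected_Ioc.image _ c.continuous.continuousOn
    rcases hXY.subset_or_subset hpre (by rintro _ ⟨s, -, rfl⟩; exact hQP (hcQ s))
      (by rintro ⟨s, hs, h⟩; exact hxne s hs.1.ne' h) with ⟨h, -⟩ | ⟨-, h⟩
    · exact h ⟨1, ⟨h1, le_rfl⟩, rfl⟩
    · exact (disjoint_left.1 h ⟨s, ⟨hs2.1, hs2.2.le⟩, rfl⟩ hsX).elim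
  have hc0Y : c 0 ∈ Y := by
    have hev := (hlim.mono_left nhdsWithin_le_nhds : Filter.Tendsto c (𝓝[<] x₀) _).eventually
      hXY.right
    have hnb : (𝓝[<] x₀).NeBot := nhdsLT_neBot_of_exists_lt ⟨0, h0⟩
    obtain ⟨s, hs1, hs2⟩ := (hev.and (Ioo_mem_nhdsLT h0)).exists
    have hsY := hs1 (hcT ⟨hs2.1, hs2.2.trans h1⟩ ⟨h0, h1⟩ hs2.2).le
    have hpre : IsPreconnected (c '' Ico 0 x₀) := isPreconnected_Ico.image _ c.continuous.continuousOn
    rcases hXY.subset_or_subset hpre (by rintro _ ⟨s, -, rfl⟩; exact hQP (hcQ s))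
      (by rintro ⟨s, hs, h⟩; exact hxne s hs.2.ne h) with ⟨-, h⟩ | ⟨h, -⟩
    · exact (disjoint_left.1 h ⟨s, ⟨hs2.1.le, hs2.2⟩, rfl⟩ hsY).elim
    · exact h ⟨0, ⟨le_rfl, h0⟩, rfl⟩
  have hEXY : ∀ z ∈ X, z ∈ Y → z ∈ E := fun z h1 h2 => hXY.eq_of_mem h1 h2 ▸ hxE
  have hc0X : c 0 ∉ X := fun h => hNE _ hc0 (hEXY _ h hc0Y)
  have hc1Y : c 1 ∉ Y := fun h => hNE _ hc1 (hEXY _ hc1X h)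
  have hrange : ∀ z ∈ range c, z ∈ E ∨ z = c 0 ∨ z = c 1 := by
    rintro _ ⟨s, rfl⟩
    rcases eq_or_ne s 0 with rfl | hs0
    · exact Or.inr (Or.inl rfl)
    rcases eq_or_ne s 1 with rfl | hs1
    · exact Or.inr (Or.inr rfl)
    exact Or.inl (hcm s ⟨pos_iff_ne_zero.2 hs0, lt_of_le_of_ne s.2.2 hs1⟩)
  have hErange : E ⊆ range c := hcE ▸ image_subset_range _ _
  have hcinj' : Function.Injective c := by
    have hpos : ∀ s : unitInterval, s = 0 ∨ s = 1 ∨ s ∈ Ioo (0 : unitInterval) 1 := fun s => by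
      rcases eq_or_ne s 0 with hs0 | hs0
      · exact Or.inl hs0
      rcases eq_or_ne s 1 with hs1 | hs1
      · exact Or.inr (Or.inl hs1)
      exact Or.inr (Or.inr ⟨pos_iff_ne_zero.2 hs0, lt_of_le_of_ne s.2.2 hs1⟩)
    intro s t hst
    rcases hpos s with rfl | rfl | hs <;> rcases hpos t with rfl | rfl | ht
    · rfl
    · exact (hc0X (hst ▸ hc1X)).elim
    · exact (hNE _ hc0 (hst ▸ hcm t ht)).elim
    · exact (hc0X (hst ▸ hc1X)).elim
    · rfl
    · exact (hNE _ hc1 (hst ▸ hcm t ht)).elim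
    · exact (hNE _ hc0 (hst ▸ hcm s hs)).elim
    · exact (hNE _ hc1 (hst ▸ hcm s hs)).elim
    · exact hcinj hs ht hst
  have hKc : IsClosed (range c) := (isCompact_range c.continuous).isClosed
  have hPE := S.isClosed_diff_component hE
  -- the two pieces left after removing the edge
  set A := Q ∩ Y ∩ (P \ E) with hA
  set D := Q ∩ X ∩ (P \ E) with hD
  have hAc : IsClosed A := (hQ.inter hXY.closed_right).inter hPE
  have hDc : IsClosed D := (hQ.inter hXY.closed_left).inter hPE
  have hAK : A ∩ range c = {c 0} := by
    refine Subset.antisymm ?_ (singleton_subset_iff.2 ⟨⟨⟨hcQ 0, hc0Y⟩, hQP (hcQ 0), hNE _ hc0⟩,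
      ⟨0, rfl⟩⟩)
    rintro z ⟨hz, hzc⟩
    rcases hrange z hzc with h | h | h
    · exact (hz.2.2 h).elim
    · exact h
    · exact (hc1Y (h ▸ hz.1.2)).elim
  have hDK : D ∩ range c = {c 1} := by
    refine Subset.antisymm ?_ (singleton_subset_iff.2 ⟨⟨⟨hcQ 1, hc1X⟩, hQP (hcQ 1), hNE _ hc1⟩,
      ⟨1, rfl⟩⟩)
    rintro z ⟨hz, hzc⟩
    rcases hrange z hzc with h | h | h
    · exact (hz.2.2 h).elim
    · exact (hc0X (h ▸ hz.1.2)).elim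
    · exact h
  have hAD : Disjoint A D := disjoint_left.2 fun z h1 h2 => h1.2.2 (hEXY z h2.1.2 h1.1.2)
  have hunion : A ∪ range c ∪ D = Q := by
    refine Subset.antisymm ?_ fun z hz => ?_
    · rintro z ((hz | ⟨s, rfl⟩) | hz)
      · exact hz.1.1
      · exact hcQ s
      · exact hz.1.1
    · by_cases hzE : z ∈ E
      · exact Or.inl (Or.inr (hErange hzE))
      · have := hQP hz
        rw [← hXY.union] at this
        rcases this with h | h
        · exact Or.inr ⟨⟨hz, h⟩, hQP hz, hzE⟩
        · exact Or.inl (Or.inl ⟨⟨hz, h⟩, hQP hz, hzE⟩)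
  have hunion' : D ∪ range c ∪ A = Q := by
    rw [← hunion, union_right_comm, union_comm D A, union_right_comm]
  have hApre : IsPreconnected A := by
    refine isPreconnected_of_union_of_inter_eq_singleton hAc (hKc.union hDc) (x := c 0) ?_ ?_
    · rwa [← union_assoc, hunion]
    · rw [inter_union_distrib_left, hAK, disjoint_iff_inter_eq_empty.1 hAD, union_empty]
  have hDpre : IsPreconnected D := by
    refine isPreconnected_of_union_of_inter_eq_singleton hDc (hKc.union hAc) (x := c 1) ?_ ?_
    · rwa [← union_assoc, hunion']
    · rw [inter_union_distrib_left, hDK, disjoint_iff_inter_eq_empty.1 hAD.symm, union_empty]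
  have hside : ∀ E' ∈ components (P \ (B ∪ C)), E' ≠ E → E' ⊆ Q →
      E' ⊆ D ∧ Disjoint E' A ∨ E' ⊆ A ∧ Disjoint E' D := by
    intro E' hE' hne hE'Q
    have hE'R : E' ⊆ P \ (B ∪ C) := by
      obtain ⟨y, -, rfl⟩ := hE'
      exact connectedComponentIn_subset _ _
    have hE'c : IsPreconnected E' := by
      obtain ⟨y, -, rfl⟩ := hE'
      exact isPreconnected_connectedComponentIn
    have hdis : ∀ z ∈ E', z ∉ E := fun z hz hz' => hne (eq_of_mem_components hE' hE hz hz')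
    rcases hXY.subset_or_subset hE'c (hE'Q.trans hQP) (fun h => hdis x h hxE) with ⟨h, h'⟩ | ⟨h, h'⟩
    · exact Or.inl ⟨fun z hz => ⟨⟨hE'Q hz, h hz⟩, hQP (hE'Q hz), hdis z hz⟩,
        h'.mono_right fun z hz => hz.1.2⟩
    · exact Or.inr ⟨fun z hz => ⟨⟨hE'Q hz, h hz⟩, hQP (hE'Q hz), hdis z hz⟩,
        h'.mono_right fun z hz => hz.1.2⟩
  have hAsat : ∀ E' ∈ components (P \ (B ∪ C)), E' ⊆ A ∨ Disjoint E' A := by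
    intro E' hE'
    by_cases hne : E' = E
    · exact Or.inr (disjoint_left.2 fun z hz hz' => hz'.2.2 (hne ▸ hz))
    · rcases hsat E' hE' with h | h
      · exact (hside E' hE' hne h).symm.imp (fun h => h.1) (fun h => h.2)
      · exact Or.inr (h.mono_right fun z hz => hz.1.1)
  have hDsat : ∀ E' ∈ components (P \ (B ∪ C)), E' ⊆ D ∨ Disjoint E' D := by
    intro E' hE'
    by_cases hne : E' = E
    · exact Or.inr (disjoint_left.2 fun z hz hz' => hz'.2.2 (hne ▸ hz))
    · rcases hsat E' hE' with h | h
      · exact (hside E' hE' hne h).imp (fun h => h.1) (fun h => h.2)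
      · exact Or.inr (h.mono_right fun z hz => hz.1.1)
  have hcount : ∀ Q' ⊆ Q, x ∉ Q' →
      {E | E ∈ components (P \ (B ∪ C)) ∧ E ⊆ Q'}.ncard < n := by
    intro Q' hQ' hxQ'
    rw [← hn]
    refine ncard_lt_ncard ⟨fun F hF => ⟨hF.1, hF.2.trans hQ'⟩, fun h => ?_⟩
      (S.finite_components.subset fun F hF => hF.1)
    exact hxQ' ((h (show E ∈ {E | E ∈ components (P \ (B ∪ C)) ∧ E ⊆ Q} from ⟨hE, hEQ⟩)).2 hxE)
  have hAQ : A ⊆ Q := fun z hz => hz.1.1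
  have hDQ : D ⊆ Q := fun z hz => hz.1.1
  have ihA := ih _ (hcount A hAQ fun h => h.2.2 hxE) A (hAQ.trans hQP) hAc hApre hAsat rfl
  have ihD := ih _ (hcount D hDQ fun h => h.2.2 hxE) D (hDQ.trans hQP) hDc hDpre hDsat rfl
  have hc0A : c 0 ∈ A := (hAK.ge rfl).1
  have hc1D : c 1 ∈ D := (hDK.ge rfl).1
  have hvE := hNE v hv.2
  have hvP := hQP hv.1
  rw [← hXY.union] at hvP
  rcases hvP with h | h
  · have hvD : v ∈ D := ⟨⟨hv.1, h⟩, hQP hv.1, hvE⟩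
    rw [← hunion']
    exact DeformsTo.join hDc hKc hAc hDK hAK hAD.symm (deformsTo_range' hcinj')
      (ihA _ ⟨hc0A, hc0⟩) hvD (ihD v ⟨hvD, hv.2⟩)
  · have hvA : v ∈ A := ⟨⟨hv.1, h⟩, hQP hv.1, hvE⟩
    rw [← hunion]
    exact DeformsTo.join hAc hKc hDc hAK hDK hAD (deformsTo_range hcinj')
      (ihD _ ⟨hc1D, hc1⟩) hvA (ihA v ⟨hvA, hv.2⟩)

lemma isSimplyConnected (S : IsCurveSystem P B C T) (hB : B.Nonempty) : IsSimplyConnected P := by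
  obtain ⟨v, hv⟩ := hB
  refine DeformsTo.isSimplyConnected (S.subset hv) (S.deformsTo_of_saturated _ P Subset.rfl
    S.compact.isClosed S.conn.isPreconnected (fun E hE => Or.inl ?_) rfl v
    ⟨S.subset hv, Or.inl hv⟩)
  obtain ⟨x, -, rfl⟩ := hE
  exact (connectedComponentIn_subset _ _).trans sdiff_subset

end IsCurveSystem

end HarmonicLevelSet

namespace HarmonicLevelSet

/-! ### The planar graph of a system of curves -/

variable {P B C : Set ℂ} {T : ℂ → ℝ}

lemma eq_zero_or_one_or_mem_Ioo (s : unitInterval) :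
    s = 0 ∨ s = 1 ∨ s ∈ Ioo (0 : unitInterval) 1 := by
  rcases eq_or_ne s 0 with h | h
  · exact Or.inl h
  rcases eq_or_ne s 1 with h' | h'
  · exact Or.inr (Or.inl h')
  · exact Or.inr (Or.inr ⟨unitInterval.pos_iff_ne_zero.2 h, unitInterval.lt_one_iff_ne_one.2 h'⟩)

namespace IsCurveSystem

lemma union_nodes (S : IsCurveSystem P B C T) : B ∪ C ⊆ P :=
  union_subset S.subset fun _ hc => (S.branch_subset hc).1

/-- A nontrivial connected set has no isolated point, so every node is a limit of regular points. As
there are finitely many edges, it is a limit of points of a single one. -/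
lemma exists_mem_closure_component (S : IsCurveSystem P B C T) (hP : P.Nontrivial) {v : ℂ}
    (hv : v ∈ B ∪ C) : ∃ E ∈ components (P \ (B ∪ C)), v ∈ closure E := by
  have hacc : AccPt v (Filter.principal P) :=
    S.conn.isPreconnected.preperfect_of_nontrivial hP v (S.union_nodes hv)
  have h1 : v ∈ closure (P \ (B ∪ C)) := by
    have hfin : (B ∪ C)ᶜ ∈ 𝓝[≠] v := by
      have h2 : ((B ∪ C) \ {v})ᶜ ∈ 𝓝 v :=
        S.finite_nodes.sdiff.isClosed.isOpen_compl.mem_nhds fun h => h.2 rfl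
      filter_upwards [mem_nhdsWithin_of_mem_nhds h2, self_mem_nhdsWithin] with z hz hz' hzn
      exact hz ⟨hzn, hz'⟩
    rw [accPt_iff_frequently_nhdsNE] at hacc
    rw [mem_closure_iff_frequently]
    have := hacc.and_eventually hfin
    exact (this.filter_mono nhdsWithin_le_nhds).mono fun z hz => hz
  have h2 : P \ (B ∪ C) ⊆ ⋃ E ∈ components (P \ (B ∪ C)), E := fun x hx =>
    mem_iUnion₂.2 ⟨_, ⟨x, hx, rfl⟩, mem_connectedComponentIn hx⟩
  have h3 := closure_mono h2 h1
  rw [S.finite_components.closure_biUnion] at h3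
  simpa using h3

theorem exists_planarGraph (S : IsCurveSystem P B C T) (hB : B.Nonempty) (hP : P.Nontrivial) :
    ∃ G : PlanarGraph, G.support = P ∧ G.nodes = B ∪ C ∧ G.IsFinite ∧ G.IsTree ∧
      ∀ v ∈ C, Even (G.valence v) ∧ 4 ≤ G.valence v := by
  choose a b γ c hpar h0 h1 himg hinj _ hlo hhi using
    fun E : components (P \ (B ∪ C)) => S.exists_curve E.2
  have hEsub : ∀ E : components (P \ (B ∪ C)), E.1 ⊆ P \ (B ∪ C) := by
    rintro ⟨_, x, -, rfl⟩
    exact connectedComponentIn_subset _ _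
  have hend : ∀ v ∈ B ∪ C, ∃ E, c E 0 = v ∨ c E 1 = v := fun v hv => by
    obtain ⟨E, hE, hvE⟩ := S.exists_mem_closure_component hP hv
    have hsub : closure E ⊆ range (c ⟨E, hE⟩) := by
      refine closure_minimal ?_ (isCompact_range (c ⟨E, hE⟩).continuous).isClosed
      exact (himg ⟨E, hE⟩).ge.trans (image_subset_range _ _)
    obtain ⟨s, hs⟩ := hsub hvE
    rcases eq_zero_or_one_or_mem_Ioo s with rfl | rfl | h
    · exact ⟨_, Or.inl hs⟩
    · exact ⟨_, Or.inr hs⟩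
    · have : v ∈ E := (himg ⟨E, hE⟩).le ⟨s, h, hs⟩
      exact absurd hv (hEsub ⟨E, hE⟩ this).2
  let G : PlanarGraph :=
    { nodes := B ∪ C
      Edge := components (P \ (B ∪ C))
      curve := c
      source_mem := h0
      target_mem := h1
      injOn := hinj
      notMem_nodes := fun E s hs => (hEsub E ((himg E).le ⟨s, hs, rfl⟩)).2
      disjoint := fun E E' hne => by
        rw [himg, himg, disjoint_left]
        exact fun z hz hz' => hne (Subtype.ext (eq_of_mem_components E.2 E'.2 hz hz'))
      exists_edge := hend }
  have hsupp : G.support = P := by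
    refine Subset.antisymm (union_subset S.union_nodes (iUnion_subset fun E => ?_)) fun z hz => ?_
    · rintro _ ⟨s, rfl⟩
      rcases eq_zero_or_one_or_mem_Ioo s with rfl | rfl | h
      · exact S.union_nodes (h0 E)
      · exact S.union_nodes (h1 E)
      · exact (hEsub E ((himg E).le ⟨s, h, rfl⟩)).1
    · by_cases hzn : z ∈ B ∪ C
      · exact Or.inl hzn
      · have hzR : z ∈ P \ (B ∪ C) := ⟨hz, hzn⟩
        obtain ⟨s, -, hs⟩ := (himg ⟨_, z, hzR, rfl⟩).ge (mem_connectedComponentIn hzR)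
        exact Or.inr (mem_iUnion.2 ⟨_, s, hs⟩)
  refine ⟨G, hsupp, rfl, ⟨S.finite_nodes, S.finite_components.to_subtype⟩, ?_, fun v hv => ?_⟩
  · rw [PlanarGraph.IsTree, hsupp]
    exact ⟨S.conn, S.isSimplyConnected hB⟩
  · obtain ⟨ι, ρ, α, β, hι, hρ, hα, hβ⟩ := S.branch v hv
    have e0 : {E | c E 0 = v}.encard = ENat.card ι := S.encard_lower_end hpar hlo hv hρ hα
    -- Passing to `-T` turns upper ends into lower ends. The upward and downward arms have the same
    -- index type, so the valence is twice its cardinality.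
    have e1 : {E | c E 1 = v}.encard = ENat.card ι :=
      S.neg.encard_lower_end (fun E => (hpar E).neg) (fun E => tendsto_nhdsGT_neg (hhi E)) hv hρ hβ
    have hval : G.valence v = ENat.card ι + ENat.card ι := congrArg₂ (· + ·) e0 e1
    rw [hval]
    have h2 : 2 ≤ ENat.card ι := Order.add_one_le_of_lt ((ENat.one_lt_card_iff_nontrivial ι).2 hι)
    refine ⟨⟨_, rfl⟩, ?_⟩
    calc (4 : ℕ∞) = 2 + 2 := by norm_num
      _ ≤ _ := add_le_add h2 h2

end IsCurveSystem

end HarmonicLevelSet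

namespace HarmonicLevelSet

/-! ### Components of the level set are systems of curves -/

open Complex ComplexConjugate

lemma isCompact_levelSet {h : ℂ → ℝ} (hh : ContinuousOn h disc) (a : ℝ) :
    IsCompact (levelSet h a) :=
  isCompact_disc.of_isClosed_subset
    (hh.preimage_isClosed_of_isClosed isCompact_disc.isClosed isClosed_singleton) fun _ hz => hz.1

lemma subset_of_mem_components {S P : Set ℂ} (hP : P ∈ components S) : P ⊆ S := by
  obtain ⟨x, -, rfl⟩ := hP
  exact connectedComponentIn_subset _ _

lemma isConnected_of_mem_components {S P : Set ℂ} (hP : P ∈ components S) : IsConnected P := by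
  obtain ⟨x, hx, rfl⟩ := hP
  exact isConnected_connectedComponentIn_iff.2 hx

lemma subset_of_isPreconnected_of_mem_components {S P Q : Set ℂ} (hP : P ∈ components S)
    (hQ : IsPreconnected Q) (hQS : Q ⊆ S) {y : ℂ} (hy : y ∈ P) (hyQ : y ∈ Q) : Q ⊆ P := by
  obtain ⟨x, -, rfl⟩ := hP
  rw [connectedComponentIn_eq hy]
  exact hQ.subset_connectedComponentIn hyQ hQS

lemma isClosed_of_mem_components {S P : Set ℂ} (hS : IsClosed S) (hP : P ∈ components S) :
    IsClosed P := by
  have hc := isConnected_of_mem_components hP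
  obtain ⟨x, hx⟩ := hc.nonempty
  exact isClosed_of_closure_subset (subset_of_isPreconnected_of_mem_components hP
    hc.isPreconnected.closure (closure_minimal (subset_of_mem_components hP) hS) hx
    (subset_closure hx))

/-- The set is star-shaped about the origin. -/
lemma isPreconnected_ball_inter_pow_re_eq_zero {k : ℕ} (hk : k ≠ 0) {ρ : ℝ} (hρ : 0 < ρ) :
    IsPreconnected (Metric.ball (0 : ℂ) ρ ∩ {u | (u ^ k).re = 0}) := by
  suffices hst : StarConvex ℝ 0 (Metric.ball (0 : ℂ) ρ ∩ {u | (u ^ k).re = 0}) from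
    (hst.isPathConnected ⟨Metric.mem_ball_self hρ, by simp [hk]⟩).isConnected.isPreconnected
  refine starConvex_zero_iff.2 fun u hu t ht0 ht1 => ⟨?_, ?_⟩
  · have h1 : ‖u‖ < ρ := by simpa using hu.1
    rw [mem_ball_zero_iff, norm_smul, Real.norm_of_nonneg ht0]
    nlinarith [norm_nonneg u]
  · have h1 : (u ^ k).re = 0 := hu.2
    rw [mem_ofPred_eq, smul_pow, Complex.smul_re, h1, smul_zero]

/-- Near `x` a point of `P` is recovered from its value of `T`, so the two half-arcs supplied by
`exists_cut` are the points with larger and with smaller `T`. -/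
lemma isCut_of_tendsto {P X Y : Set ℂ} {T : ℂ → ℝ} {x : ℂ} {σ : ℝ → ℂ} (hX : IsClosed X)
    (hY : IsClosed Y) (hXY : X ∪ Y = P) (hx : X ∩ Y = {x}) {δ : ℝ} (hδ : 0 < δ)
    (hT : ContinuousWithinAt T P x) (hσ : ∀ᶠ z in 𝓝[P] x, z = σ (T z - T x))
    (h : ∀ t : ℝ, 0 ≤ t → t ≤ δ → σ t ∈ X ∧ σ (-t) ∈ Y) : IsCut P T x X Y where
  closed_left := hX
  closed_right := hY
  union := hXY
  inter := hx
  left := by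
    filter_upwards [hσ, hT.eventually_lt (continuousWithinAt_const (b := T x + δ)) (by linarith)]
      with z hz hlt hle
    rw [hz]
    exact (h _ (by linarith) (by linarith)).1
  right := by
    filter_upwards [hσ, (continuousWithinAt_const (b := T x - δ)).eventually_lt hT (by linarith)]
      with z hz hlt hle
    rw [hz, ← neg_sub]
    exact (h _ (by linarith) (by linarith)).2

/-- The arms are the rays on which `u ^ k` is a positive multiple of `θ`, one for each `k`-th root
of `θ`. The parameter `s ^ (1 / k)` makes `T` grow exactly by `s`. It is used with `θ = I` for the
conjugate function and `θ = -I` for its negative. -/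
lemma isArmSystem_of_chart {P R : Set ℂ} {T : ℂ → ℝ} {ψ : OpenPartialHomeomorph ℂ ℂ} {k : ℕ}
    {ρ : ℝ} (hk : k ≠ 0) (hρ : 0 < ρ) (hψ : ψ.source = Metric.ball 0 ρ) {θ : ℂ} (hθ : θ.re = 0)
    (hθ1 : ‖θ‖ = 1) (hP : ∀ u ∈ ψ.source, ψ u ∈ P ↔ (u ^ k).re = 0)
    (hR : ∀ u ∈ ψ.source, ψ u ∈ P → u ≠ 0 → ψ u ∈ R)
    (hT : ∀ u ∈ ψ.source, (u ^ k).re = 0 → u ^ k = ((T (ψ u) - T (ψ 0) : ℝ) : ℂ) * θ)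
    {ι : Type} {e : ι → ℂ} (he : Function.Injective e) (her : range e = {ω | ω ^ k = θ}) :
    IsArmSystem P R T (ψ 0) (ρ ^ k)
      (fun i s => ψ ((s ^ (k : ℝ)⁻¹ : ℝ) * e i)) := by
  have hθ0 : θ ≠ 0 := norm_pos_iff.1 (hθ1 ▸ one_pos)
  have hek : ∀ i, e i ^ k = θ := fun i => her.le ⟨i, rfl⟩
  have hen : ∀ i, ‖e i‖ = 1 := fun i =>
    (pow_eq_one_iff_of_nonneg (norm_nonneg _) hk).1 (by rw [← norm_pow, hek, hθ1])
  have hroot : ∀ s : ℝ, 0 ≤ s → (s ^ (k : ℝ)⁻¹) ^ k = s := fun s hs =>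
    Real.rpow_inv_natCast_pow hs hk
  have hsrc : ∀ i, ∀ s ∈ Ico 0 (ρ ^ k), ((s ^ (k : ℝ)⁻¹ : ℝ) : ℂ) * e i ∈ ψ.source := by
    intro i s hs
    rw [hψ, mem_ball_zero_iff, norm_mul, hen, mul_one, Complex.norm_real,
      Real.norm_of_nonneg (Real.rpow_nonneg hs.1 _)]
    exact lt_of_pow_lt_pow_left₀ k hρ.le (by rw [hroot s hs.1]; exact hs.2)
  have hpow : ∀ i, ∀ s ∈ Ico 0 (ρ ^ k), (((s ^ (k : ℝ)⁻¹ : ℝ) : ℂ) * e i) ^ k = s * θ := by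
    intro i s hs
    rw [mul_pow, hek, ← Complex.ofReal_pow, hroot s hs.1]
  have hre : ∀ s : ℝ, ((s : ℂ) * θ).re = 0 := fun s => by
    rw [Complex.re_ofReal_mul, hθ, mul_zero]
  have hne : ∀ s ∈ Ioo 0 (ρ ^ k), ((s ^ (k : ℝ)⁻¹ : ℝ) : ℂ) ≠ 0 := fun s hs =>
    Complex.ofReal_ne_zero.2 (Real.rpow_pos_of_pos hs.1 _).ne'
  have hen0 : ∀ i, e i ≠ 0 := fun i => norm_pos_iff.1 (hen i ▸ one_pos)
  refine ⟨fun i => ?_, fun i => ?_, fun i s hs => ?_, fun i s hs => ?_, fun i j s hs hij => ?_, ?_⟩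
  · refine ψ.continuousOn.comp ?_ fun s hs => hsrc i s hs
    have : Continuous fun s : ℝ => s ^ (k : ℝ)⁻¹ :=
      Real.continuous_rpow_const (by positivity)
    exact ((Complex.continuous_ofReal.comp this).mul continuous_const).continuousOn
  · have : (k : ℝ)⁻¹ ≠ 0 := by positivity
    simp [Real.zero_rpow this]
  · have hs' := Ioo_subset_Ico_self hs
    refine hR _ (hsrc i s hs') ?_ (mul_ne_zero (hne s hs) (hen0 i))
    rw [hP _ (hsrc i s hs'), hpow i s hs', hre]
  · have hs' := Ioo_subset_Ico_self hs
    have h1 := hT _ (hsrc i s hs') (by rw [hpow i s hs', hre])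
    rw [hpow i s hs'] at h1
    have h2 := Complex.ofReal_injective (mul_right_cancel₀ hθ0 h1)
    linarith
  · have hs' := Ioo_subset_Ico_self hs
    have h1 := ψ.injOn (hsrc i s hs') (hsrc j s hs') hij
    exact he (mul_left_cancel₀ (hne s hs) h1)
  · have h0 : (0 : ℂ) ∈ ψ.source := by rw [hψ]; exact Metric.mem_ball_self hρ
    filter_upwards [self_mem_nhdsWithin, mem_nhdsWithin_of_mem_nhds
      (ψ.open_target.mem_nhds (ψ.map_source h0))] with z hzP hz hlt
    set u := ψ.symm z
    have hu : u ∈ ψ.source := ψ.map_target hz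
    have huz : ψ u = z := ψ.right_inv hz
    set s := T z - T (ψ 0) with hs
    have hs0 : 0 < s := sub_pos.2 hlt
    have hr0 : ((s ^ (k : ℝ)⁻¹ : ℝ) : ℂ) ≠ 0 :=
      Complex.ofReal_ne_zero.2 (Real.rpow_pos_of_pos hs0 _).ne'
    have h1 : u ^ k = s * θ := by
      rw [hT u hu ((hP u hu).1 (huz ▸ hzP)), huz]
    obtain ⟨i, hi⟩ : u / ((s ^ (k : ℝ)⁻¹ : ℝ) : ℂ) ∈ range e := by
      rw [her, mem_ofPred_eq, div_pow, h1, ← Complex.ofReal_pow, hroot s hs0.le,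
        mul_div_cancel_left₀ _ (Complex.ofReal_ne_zero.2 hs0.ne')]
    refine ⟨i, ?_⟩
    rw [hi, mul_div_cancel₀ _ hr0, huz]

lemma nontrivial_roots {k : ℕ} (hk : 2 ≤ k) {θ : ℂ} (hθ : θ ≠ 0) :
    Nontrivial {ω : ℂ // ω ^ k = θ} := by
  obtain ⟨ω, hω⟩ := IsAlgClosed.exists_pow_nat_eq θ (show 0 < k by lia)
  have hω0 : ω ≠ 0 := fun h => hθ (by rw [← hω, h, zero_pow (by lia)])
  have hζ := Complex.isPrimitiveRoot_exp k (by lia)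
  refine ⟨⟨ω, hω⟩, ⟨ω * Complex.exp (2 * Real.pi * Complex.I / k), ?_⟩, fun h => ?_⟩
  · rw [mul_pow, hζ.pow_eq_one, mul_one, hω]
  · have h1 := congrArg Subtype.val h
    exact hζ.ne_one hk (mul_left_cancel₀ hω0 (by rw [mul_one]; exact h1.symm))

variable {h : ℂ → ℝ} {f : ℂ → ℂ} {a : ℝ} {P : Set ℂ}

/-- Near an interior point, a component of the level set is a star in a suitable coordinate. -/
lemma IsAdmissible.exists_level_chart (H : IsAdmissible h) (hf : AnalyticOnNhd ℂ f openDisc)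
    (hfh : ∀ z ∈ openDisc, (f z).re = h z) (hP : P ∈ components (levelSet h a)) {y : ℂ}
    (hy : y ∈ P) (hyo : y ∈ openDisc) :
    ∃ (k : ℕ) (ρ : ℝ) (c : ℂ) (ψ : OpenPartialHomeomorph ℂ ℂ), k ≠ 0 ∧ 0 < ρ ∧ c ≠ 0 ∧
      ψ.source = Metric.ball 0 ρ ∧ ψ.target ⊆ openDisc ∧ ψ 0 = y ∧ HasStrictDerivAt ψ c 0 ∧
      (∀ u ∈ ψ.source, f (ψ u) = f y + u ^ k) ∧
      (∀ u ∈ ψ.source, deriv f (ψ u) ≠ 0 ↔ u ≠ 0 ∨ k = 1) ∧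
      ∀ u ∈ ψ.source, ψ u ∈ P ↔ (u ^ k).re = 0 := by
  obtain ⟨k, ρ, c, ψ, hk, hρ, hc, hs, ht, h0, hd, hfψ, hder⟩ := exists_chart (hf y hyo)
    (H.not_eventually_eq hf hfh hyo) (isOpen_openDisc.mem_nhds hyo)
  refine ⟨k, ρ, c, ψ, hk, hρ, hc, hs, ht, h0, hd, hfψ, hder, ?_⟩
  have hya : (f y).re = a := (hfh y hyo).trans (subset_of_mem_components hP hy).2
  have hlev : ∀ u ∈ ψ.source, ψ u ∈ levelSet h a ↔ (u ^ k).re = 0 := fun u hu => by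
    have huo : ψ u ∈ openDisc := ht (ψ.map_source hu)
    rw [levelSet, mem_ofPred_eq, ← hfh _ huo, hfψ u hu, Complex.add_re, hya, add_eq_left]
    exact and_iff_right (openDisc_subset_disc huo)
  refine fun u hu => ⟨fun h' => (hlev u hu).1 (subset_of_mem_components hP h'), fun h' => ?_⟩
  -- In the chart the level set is star-shaped, so its image is connected and lies entirely in the
  -- component through `y`.
  have hcon := (isPreconnected_ball_inter_pow_re_eq_zero hk hρ).image ψ
    (ψ.continuousOn.mono (by rw [hs]; exact inter_subset_left))
  refine subset_of_isPreconnected_of_mem_components hP hcon ?_ hy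
    ⟨0, ⟨Metric.mem_ball_self hρ, by simp [hk]⟩, h0⟩ ⟨u, ⟨hs ▸ hu, h'⟩, rfl⟩
  rintro _ ⟨v, ⟨hv, hv'⟩, rfl⟩
  exact (hlev v (hs ▸ hv)).2 hv'

/-- The function `T` is the harmonic conjugate of `h`, the branch points are the critical points of
`f`, and cuts exist because `P` does not separate the plane. -/
theorem IsAdmissible.isCurveSystem (H : IsAdmissible h) (hf : AnalyticOnNhd ℂ f openDisc)
    (hfh : ∀ z ∈ openDisc, (f z).re = h z) (hP : P ∈ components (levelSet h a))
    (hB : (P ∩ circle).Finite) :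
    IsCurveSystem P (P ∩ circle) {y | y ∈ P ∧ y ∈ openDisc ∧ deriv f y = 0}
      (fun z => (f z).im) := by
  have hPL := subset_of_mem_components hP
  have hPc : IsCompact P := (isCompact_levelSet H.cont a).of_isClosed_subset
    (isClosed_of_mem_components (isCompact_levelSet H.cont a).isClosed hP) hPL
  have hmem : ∀ z, z ∈ P \ (P ∩ circle) ↔ z ∈ P ∧ z ∈ openDisc := fun z =>
    ⟨fun hz => ⟨hz.1, mem_openDisc_of_mem_disc (hPL hz.1).1 fun h' => hz.2 ⟨hz.1, h'⟩⟩,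
      fun hz => ⟨hz.1, fun h' => notMem_circle_of_mem_openDisc hz.2 h'.2⟩⟩
  have hreg : ∀ z, z ∈ P \ (P ∩ circle ∪ {y | y ∈ P ∧ y ∈ openDisc ∧ deriv f y = 0}) ↔
      z ∈ P ∧ z ∈ openDisc ∧ deriv f z ≠ 0 := fun z => by
    rw [← sdiff_sdiff, mem_sdiff, hmem, mem_ofPred_eq]
    tauto
  have hTc : ∀ z ∈ openDisc, ContinuousAt (fun z => (f z).im) z := fun z hz =>
    Complex.continuous_im.continuousAt.comp (hf z hz).continuousAt
  have hchart : ∀ x ∈ P, x ∈ openDisc → deriv f x ≠ 0 → ∃ (ρ : ℝ) (c : ℂ)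
      (ψ : OpenPartialHomeomorph ℂ ℂ), 0 < ρ ∧ c ≠ 0 ∧ ψ.source = Metric.ball 0 ρ ∧ ψ 0 = x ∧
      HasStrictDerivAt ψ c 0 ∧ (∀ u ∈ ψ.source, ψ u ∈ P ↔ u.re = 0) ∧
      (∀ t : ℝ, |t| < ρ → ψ (t * I) ∈ P ∧ ψ (t * I) ∈ openDisc ∧ deriv f (ψ (t * I)) ≠ 0 ∧
        (f (ψ (t * I))).im = (f x).im + t) ∧
      ∀ᶠ z in 𝓝[P] x, z = ψ (((f z).im - (f x).im : ℝ) * I) := by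
    intro x hx hxo hxd
    obtain ⟨k, ρ, c, ψ, hk, hρ, hc, hs, ht, h0, hd, hfψ, hder, hψP⟩ :=
      H.exists_level_chart hf hfh hP hx hxo
    have h0s : (0 : ℂ) ∈ ψ.source := by rw [hs]; exact Metric.mem_ball_self hρ
    obtain rfl : k = 1 := ((hder 0 h0s).1 (h0.symm ▸ hxd)).resolve_left fun h' => h' rfl
    simp only [pow_one] at hψP hfψ
    refine ⟨ρ, c, ψ, hρ, hc, hs, h0, hd, hψP, fun t htρ => ?_, ?_⟩
    · have hts : (t * I : ℂ) ∈ ψ.source := by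
        rw [hs, mem_ball_zero_iff, norm_mul, Complex.norm_I, mul_one, Complex.norm_real]
        exact htρ
      refine ⟨(hψP _ hts).2 (by simp), ht (ψ.map_source hts), (hder _ hts).2 (Or.inr rfl), ?_⟩
      rw [hfψ _ hts]; simp
    · filter_upwards [self_mem_nhdsWithin, mem_nhdsWithin_of_mem_nhds
        (ψ.open_target.mem_nhds (h0 ▸ ψ.map_source h0s))] with z hzP hz
      have hu : ψ.symm z ∈ ψ.source := ψ.map_target hz
      have huz : ψ (ψ.symm z) = z := ψ.right_inv hz
      have hre := (hψP _ hu).1 (huz.symm ▸ hzP)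
      have hfz := hfψ _ hu
      rw [huz] at hfz
      have : (((f z).im - (f x).im : ℝ) : ℂ) * I = ψ.symm z := by
        rw [hfz]
        apply Complex.ext <;> simp [hre]
      rw [this, huz]
  refine ⟨hPc, isConnected_of_mem_components hP, hB, inter_subset_left, fun y hy =>
    (hmem y).2 ⟨hy.1, hy.2.1⟩, fun z hz => (hTc z ((hmem z).1 hz).2).continuousWithinAt, ?_, ?_, ?_⟩
  · intro x hx
    obtain ⟨hxP, hxo, hxd⟩ := (hreg x).1 hx
    obtain ⟨ρ, c, ψ, hρ, hc, hs, h0, hd, hψP, -, hev⟩ := hchart x hxP hxo hxd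
    have h0s : (0 : ℂ) ∈ ψ.source := by rw [hs]; exact Metric.mem_ball_self hρ
    obtain ⟨X, Y, hX, hY, hXY, hXYx, δ, hδ, hδ'⟩ :=
      exists_cut hPc (H.isPreconnected_compl hPc hPL) ψ h0s hd hc hψP
    refine ⟨X, Y, isCut_of_tendsto (σ := fun t => ψ (t * I)) hX hY hXY (h0 ▸ hXYx) hδ
      (hTc x hxo).continuousWithinAt hev fun t ht0 ht => ?_⟩
    have := hδ' t ht0 ht
    push_cast
    exact this
  · intro x hx
    obtain ⟨hxP, hxo, hxd⟩ := (hreg x).1 hx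
    obtain ⟨ρ, c, ψ, hρ, hc, hs, h0, hd, hψP, hψ, hev⟩ := hchart x hxP hxo hxd
    have habs : ∀ t ∈ Ioo ((f x).im - ρ) ((f x).im + ρ), |t - (f x).im| < ρ := fun t ht =>
      abs_lt.2 ⟨by linarith [ht.1], by linarith [ht.2]⟩
    refine ⟨fun t => ψ ((t - (f x).im : ℝ) * I), ρ, hρ, ?_, by simp [h0], fun t ht => ?_, hev⟩
    · refine ψ.continuousOn.comp (by fun_prop) fun t ht => ?_
      rw [hs, mem_ball_zero_iff, norm_mul, Complex.norm_I, mul_one, Complex.norm_real]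
      exact habs t ht
    · obtain ⟨h1, h2, h3, h4⟩ := hψ _ (habs t ht)
      exact ⟨(hreg _).2 ⟨h1, h2, h3⟩, by simp only [h4]; ring⟩
  · intro y hy
    obtain ⟨k, ρ, c, ψ, hk, hρ, hc, hs, ht, h0, hd, hfψ, hder, hψP⟩ :=
      H.exists_level_chart hf hfh hP hy.1 hy.2.1
    have h0s : (0 : ℂ) ∈ ψ.source := by rw [hs]; exact Metric.mem_ball_self hρ
    have hk1 : k ≠ 1 := fun hk1 => (hder 0 h0s).2 (Or.inr hk1) (h0.symm ▸ hy.2.2)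
    have hR : ∀ u ∈ ψ.source, ψ u ∈ P → u ≠ 0 →
        ψ u ∈ P \ (P ∩ circle ∪ {y | y ∈ P ∧ y ∈ openDisc ∧ deriv f y = 0}) :=
      fun u hu huP hu0 => (hreg _).2 ⟨huP, ht (ψ.map_source hu), (hder u hu).2 (Or.inl hu0)⟩
    have hT : ∀ u ∈ ψ.source, (u ^ k).re = 0 →
        u ^ k = (((f (ψ u)).im - (f (ψ 0)).im : ℝ) : ℂ) * I := fun u hu hre => by
      rw [h0, hfψ u hu]
      apply Complex.ext <;> simp [hre]
    -- Complex conjugation matches the roots of `I` with those of `-I`, so the same index type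
    -- serves for both directions.
    refine ⟨{ω : ℂ // ω ^ k = I}, ρ ^ k, _, _, nontrivial_roots (by lia) Complex.I_ne_zero,
      pow_pos hρ k, h0 ▸ isArmSystem_of_chart (e := Subtype.val) hk hρ hs Complex.I_re
        Complex.norm_I hψP hR hT Subtype.val_injective Subtype.range_coe,
      h0 ▸ isArmSystem_of_chart (θ := -I) (e := fun ω : {ω : ℂ // ω ^ k = I} => conj ω.1) hk hρ hs (by simp) (by simp)
        hψP hR ?_ ?_ ?_⟩
    · intro u hu hre
      rw [hT u hu hre]
      push_cast
      ring
    · exact (RingHom.injective _).comp Subtype.val_injective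
    · ext ω
      constructor
      · rintro ⟨ω, rfl⟩
        simp only [mem_ofPred_eq]
        rw [← map_pow, ω.2, Complex.conj_I]
      · intro hω
        refine ⟨⟨conj ω, ?_⟩, Complex.conj_conj ω⟩
        rw [← map_pow, show ω ^ k = -I from hω, map_neg, Complex.conj_I, neg_neg]

end HarmonicLevelSet

namespace HarmonicLevelSet

/-! ### The components of the level set meet the lower arc -/

variable {h : ℂ → ℝ} {a : ℝ} {P : Set ℂ}

/-- A cut at a regular point has points of `B` on both sides, and these differ because the cut point
itself is not in `B`. -/
lemma IsCurveSystem.not_subsingleton {B C : Set ℂ} {T : ℂ → ℝ} (S : IsCurveSystem P B C T)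
    (hP : (P \ B).Nonempty) : ¬ B.Subsingleton := by
  obtain ⟨x, hx⟩ : (P \ (B ∪ C)).Nonempty := by
    obtain ⟨y, hy⟩ := hP
    by_cases hyC : y ∈ C
    · obtain ⟨ι, ρ, α, β, hι, hρ, hα, -⟩ := S.branch y hyC
      obtain ⟨i⟩ := hι.to_nonempty
      exact ⟨_, hα.mem i (ρ / 2) ⟨by linarith, by linarith⟩⟩
    · exact ⟨y, regular_of_notMem hy hyC⟩
  obtain ⟨X, Y, hc⟩ := S.cut x hx
  obtain ⟨p, hpX, hpB⟩ := S.left_inter_nonempty hc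
  obtain ⟨q, hqY, hqB⟩ := S.right_inter_nonempty hc
  intro hs
  obtain rfl := hs hpB hqB
  exact hx.2 (Or.inl (hc.eq_of_mem hpX hqY ▸ hpB))

/-- A component of a compact set which is contained in an open set has a relatively clopen
neighbourhood contained in the open set. -/
lemma exists_isClopen_of_connectedComponent_subset {X : Type*} [TopologicalSpace X]
    [CompactSpace X] [T2Space X] {x : X} {V : Set X} (hV : IsOpen V)
    (hx : connectedComponent x ⊆ V) : ∃ K, IsClopen K ∧ x ∈ K ∧ K ⊆ V := by
  -- Pass to the space of connected components, where clopen sets form a basis.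
  have hcl : IsClosed ((↑) '' Vᶜ : Set (ConnectedComponents X)) :=
    (hV.isClosed_compl.isCompact.image ConnectedComponents.continuous_coe).isClosed
  obtain ⟨W, hW, hxW, hWV⟩ := compact_exists_isClopen_in_isOpen hcl.isOpen_compl
    (x := (x : ConnectedComponents X)) (by
      rintro ⟨y, hy, hyx⟩
      refine hy (hx ?_)
      rw [← ConnectedComponents.coe_eq_coe.1 hyx]
      exact mem_connectedComponent)
  refine ⟨ConnectedComponents.mk ⁻¹' W, hW.preimage ConnectedComponents.continuous_coe, hxW, fun y hy => ?_⟩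
  by_contra hyV
  exact hWV hy ⟨y, hyV, rfl⟩

lemma inter_circle_subset : P ∩ circle ⊆ P ∩ lowerArc ∪ P ∩ upperArc := fun _ hz =>
  (mem_lowerArc_or_mem_openUpperArc hz.2).imp (fun h' => ⟨hz.1, h'⟩)
    fun h' => ⟨hz.1, openUpperArc_subset_upperArc h'⟩

lemma IsAdmissible.not_subsingleton_inter_circle (H : IsAdmissible h)
    (hP : P ∈ components (levelSet h a)) (ho : (P ∩ openDisc).Nonempty) :
    ¬ (P ∩ circle).Subsingleton := by
  intro hs
  obtain ⟨f, hf, hfh⟩ := H.exists_analytic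
  refine (H.isCurveSystem hf hfh hP hs.finite).not_subsingleton ?_ hs
  obtain ⟨z, hz, hzo⟩ := ho
  exact ⟨z, hz, fun h' => notMem_circle_of_mem_openDisc hzo h'.2⟩

/-- A point of the circle is an extreme point of the disc, so a convex neighborhood in the disc
stays convex when it is removed. -/
lemma isPreconnected_disc_inter_ball_diff {z : ℂ} (hz : z ∈ circle) {r : ℝ} (hr : 0 < r) :
    IsPreconnected ((disc ∩ Metric.ball z r) \ {z}) := by
  have hconv : Convex ℝ (disc ∩ Metric.ball z r) :=
    (convex_closedBall 0 1).inter (convex_ball z r)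
  refine (hconv.mem_extremePoints_iff_convex_sdiff.1 ?_).2.isPreconnected
  refine inter_extremePoints_subset_extremePoints_of_subset inter_subset_left
    ⟨⟨circle_subset_disc hz, Metric.mem_ball_self hr⟩, ?_⟩
  rw [disc, StrictConvexSpace.extremePoints_closedBall_eq_sphere]
  exact hz

/-- Otherwise `h - h z` would have a constant sign on a connected punctured neighborhood of `z`,
which would make `z` an extremum. -/
lemma IsAdmissible.not_eventually_ne (H : IsAdmissible h) {z : ℂ} (hz : z ∈ openUpperArc) :
    ¬ ∀ᶠ w in 𝓝[disc] z, h w = h z → w = z := by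
  intro he
  obtain ⟨r, hr, hr'⟩ := Metric.mem_nhdsWithin_iff.1 he
  have hne : ∀ w ∈ (disc ∩ Metric.ball z r) \ {z}, h w ≠ h z := fun w hw hw' =>
    hw.2 (hr' ⟨hw.1.2, hw.1.1⟩ hw')
  have himg := (isPreconnected_disc_inter_ball_diff hz.1 hr).image h
    (H.cont.mono (sdiff_subset.trans inter_subset_left))
  have hmem : ∀ᶠ w in 𝓝[disc] z, w ∈ disc ∩ Metric.ball z r :=
    Filter.inter_mem self_mem_nhdsWithin (mem_nhdsWithin_of_mem_nhds (Metric.ball_mem_nhds z hr))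
  refine H.noExtr z hz ?_
  by_cases hlt : ∃ w ∈ (disc ∩ Metric.ball z r) \ {z}, h w < h z
  · obtain ⟨w₀, hw₀, hw₀'⟩ := hlt
    refine Or.inr (hmem.mono fun w hw => ?_)
    by_contra! hlt'
    have hwz : w ≠ z := fun h' => hlt'.ne (by rw [h'])
    obtain ⟨v, hv, hv'⟩ := himg.ordConnected.out ⟨w₀, hw₀, rfl⟩ ⟨w, ⟨hw, hwz⟩, rfl⟩
      ⟨hw₀'.le, hlt'.le⟩
    exact hne v hv hv'
  · push Not at hlt
    refine Or.inl (hmem.mono fun w hw => ?_)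
    rcases eq_or_ne w z with rfl | hwz
    · exact le_rfl
    · exact hlt w ⟨hw, hwz⟩

/-- A point of the open upper arc is not a component of the level set. -/
lemma IsAdmissible.singleton_notMem_components (H : IsAdmissible h) {z : ℂ}
    (hz : z ∈ openUpperArc) : {z} ∉ components (levelSet h a) := by
  intro hP
  set L := levelSet h a
  have hzL : z ∈ L := subset_of_mem_components hP rfl
  have : CompactSpace L := isCompact_iff_compactSpace.1 (isCompact_levelSet H.cont a)
  obtain ⟨V, hVo, hzV, hV⟩ := mem_nhdsWithin.1 (H.eventually_ne_on_circle a hz)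
  have hcomp : connectedComponent (⟨z, hzL⟩ : L) ⊆ Subtype.val ⁻¹' V := fun w hw => by
    have h1 := subset_of_isPreconnected_of_mem_components hP
      (isPreconnected_connectedComponent.image _ continuous_subtype_val.continuousOn)
      (by rintro _ ⟨w, -, rfl⟩; exact w.2) rfl ⟨⟨z, hzL⟩, mem_connectedComponent, rfl⟩
    have h2 : w.1 = z := h1 ⟨w, hw, rfl⟩
    rw [mem_preimage, h2]
    exact hzV
  obtain ⟨K, hK, hzK, hKV⟩ := exists_isClopen_of_connectedComponent_subset
    (hVo.preimage continuous_subtype_val) hcomp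
  -- The clopen piece `K` meets the circle only at `z`. A component inside `K` other than `{z}`
  -- would miss the circle altogether, although a component that enters the open disc has two points
  -- there. So `z` is isolated in the level set.
  have hKz : ∀ w ∈ K, w.1 = z := by
    intro w hw
    by_contra hwz
    set Q := connectedComponentIn L w.1 with hQ
    have hQc : Q ∈ components L := ⟨_, w.2, rfl⟩
    have hwQ : w.1 ∈ Q := mem_connectedComponentIn w.2
    have hQK : Q ⊆ Subtype.val '' K := by
      rw [hQ, connectedComponentIn_eq_image w.2]
      exact image_mono (hK.connectedComponent_subset hw)
    have hQcirc : Q ∩ circle = ∅ := by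
      refine eq_empty_of_forall_notMem fun v hv => ?_
      obtain ⟨v', hv'K, rfl⟩ := hQK hv.1
      have hvz : v'.1 = z := hV ⟨hKV hv'K, hv.2⟩ v'.2.2
      have hQz : Q = {z} := IsCurveSystem.eq_of_mem_components hQc hP (hvz ▸ hv.1) rfl
      exact hwz (hQz.le hwQ)
    have hwo : w.1 ∈ openDisc := mem_openDisc_of_mem_disc w.2.1 fun h' => hQcirc.le ⟨hwQ, h'⟩
    refine H.not_subsingleton_inter_circle hQc ⟨_, hwQ, hwo⟩ ?_
    rw [hQcirc]
    exact subsingleton_empty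
  refine H.not_eventually_ne hz ?_
  obtain ⟨O, hO, hOK⟩ := isOpen_induced_iff.1 hK.isOpen
  have hzO : z ∈ O := by
    have : (⟨z, hzL⟩ : L) ∈ Subtype.val ⁻¹' O := hOK.ge hzK
    exact this
  filter_upwards [self_mem_nhdsWithin, mem_nhdsWithin_of_mem_nhds (hO.mem_nhds hzO)]
    with w hwd hwO hw
  exact hKz ⟨w, hwd, hw.trans hzL.2⟩ (hOK.le hwO)

/-- Every component of the level set meets the lower arc. -/
theorem IsAdmissible.inter_lowerArc_nonempty (H : IsAdmissible h)
    (hP : P ∈ components (levelSet h a)) : (P ∩ lowerArc).Nonempty := by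
  have hPL := subset_of_mem_components hP
  have hPc := isConnected_of_mem_components hP
  have hup := H.subsingleton_inter_upperArc ((isCompact_levelSet H.cont a).of_isClosed_subset
    (isClosed_of_mem_components (isCompact_levelSet H.cont a).isClosed hP) hPL)
    hPc.isPreconnected hPL
  by_contra hne
  rw [not_nonempty_iff_eq_empty] at hne
  have hcirc : P ∩ circle ⊆ P ∩ upperArc := fun z hz =>
    (inter_circle_subset hz).resolve_left fun h' => hne.le h'
  -- With at most one point on the circle, `P` cannot enter the open disc, so it is a single point
  -- of the open upper arc.
  have ho : ¬ (P ∩ openDisc).Nonempty := fun h' =>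
    H.not_subsingleton_inter_circle hP h' (hup.anti hcirc)
  have hPcirc : P ⊆ P ∩ circle := fun z hz => ⟨hz, by
    by_contra h'
    exact ho ⟨z, hz, mem_openDisc_of_mem_disc (hPL hz).1 h'⟩⟩
  obtain ⟨z, hz⟩ := hPc.nonempty
  have hPz : P = {z} := (hup.anti (hPcirc.trans hcirc)).eq_singleton_of_mem hz
  refine H.singleton_notMem_components (a := a) (z := z) ?_ (hPz ▸ hP)
  exact (mem_lowerArc_or_mem_openUpperArc (hPcirc hz).2).resolve_left fun h' => hne.le ⟨hz, h'⟩

/-- It makes the results on components of the level set available for components of `U`. -/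
lemma mem_components_of_mem_components_sUnion {L P : Set ℂ} {S : Set (Set ℂ)}
    (hS : S ⊆ components L) (hP : P ∈ components (⋃₀ S)) : P ∈ components L := by
  have hSL : ⋃₀ S ⊆ L := sUnion_subset fun Q hQ => subset_of_mem_components (hS hQ)
  have hPc := isConnected_of_mem_components hP
  obtain ⟨x, hx⟩ := hPc.nonempty
  obtain ⟨Q, hQ, hxQ⟩ := subset_of_mem_components hP hx
  have h1 : Q ⊆ P := subset_of_isPreconnected_of_mem_components hP
    (isConnected_of_mem_components (hS hQ)).isPreconnected (subset_sUnion_of_mem hQ) hx hxQ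
  have h2 : P ⊆ Q := subset_of_isPreconnected_of_mem_components (hS hQ) hPc.isPreconnected
    ((subset_of_mem_components hP).trans hSL) hxQ hx
  exact h2.antisymm h1 ▸ hS hQ

end HarmonicLevelSet

/-! ### The main theorem. -/

open HarmonicLevelSet in
theorem mainTheorem4 (h : ℂ → ℝ) (a : ℝ) (U : Set ℂ) (m : ℕ)
    (h_cont : ContinuousOn h disc)
    (h_harm : InnerProductSpace.HarmonicOnNhd h openDisc)
    (h_analytic : AnalyticOn ℝ h (disc \ lowerArc))
    (U_nonempty : U.Nonempty)
    (U_union : ∃ S ⊆ components (levelSet h a), U = ⋃₀ S)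
    (h_nonconst : ∃ p ∈ upperArc, ∃ q ∈ upperArc, h p ≠ h q)
    (h_noExtr : ∀ p ∈ openUpperArc, ¬ IsLocalExtrOn h disc p)
    (U_lower : (U ∩ lowerArc).encard = m) :
    (components U).encard ≤ m ∧
    ∀ P ∈ components U,
      (∃ p ∈ lowerArc, P = {p}) ∨
      ∃ G : PlanarGraph, G.support = P ∧
        -- every point where the component touches the circle is a node
        P ∩ circle ⊆ G.nodes ∧
        G.IsFinite ∧ G.IsTree ∧
        (∀ v ∈ G.nodes ∩ openDisc, Even (G.valence v) ∧ 4 ≤ G.valence v) ∧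
        (G.nodes ∩ lowerArc).Nonempty ∧
        (G.nodes ∩ upperArc).Subsingleton := by
  have H : IsAdmissible h := ⟨h_cont, h_harm, h_analytic, h_noExtr⟩
  obtain ⟨S, hS, rfl⟩ := U_union
  have hcomp : ∀ P ∈ components (⋃₀ S), P ∈ components (levelSet h a) := fun P hP =>
    mem_components_of_mem_components_sUnion hS hP
  have hlow : ∀ P ∈ components (⋃₀ S), (P ∩ lowerArc).Nonempty := fun P hP =>
    H.inter_lowerArc_nonempty (hcomp P hP)
  refine ⟨?_, fun P hP => ?_⟩
  -- Distinct components are disjoint, so choosing a point of the lower arc in each is injective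
  -- into the `m` points available.
  · choose! φ hφ using hlow
    rw [← U_lower]
    refine encard_le_encard_of_injOn (f := φ)
      (fun P hP => ⟨subset_of_mem_components hP (hφ P hP).1, (hφ P hP).2⟩) fun P hP Q hQ hPQ => ?_
    exact IsCurveSystem.eq_of_mem_components hP hQ (hφ P hP).1 (hPQ ▸ (hφ Q hQ).1)
  · obtain ⟨p, hpP, hp⟩ := hlow P hP
    rcases P.subsingleton_or_nontrivial with hPs | hPn
    · exact Or.inl ⟨p, hp, hPs.eq_singleton_of_mem hpP⟩
    right
    have hPL := subset_of_mem_components (hcomp P hP)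
    have hup := H.subsingleton_inter_upperArc ((isCompact_levelSet H.cont a).of_isClosed_subset
      (isClosed_of_mem_components (isCompact_levelSet H.cont a).isClosed (hcomp P hP)) hPL)
      (isConnected_of_mem_components hP).isPreconnected hPL
    have hfin : (P ∩ circle).Finite := by
      refine (Finite.union (finite_of_encard_eq_coe U_lower |>.subset ?_) hup.finite).subset
        inter_circle_subset
      exact inter_subset_inter_left _ (subset_of_mem_components hP)
    obtain ⟨f, hf, hfh⟩ := H.exists_analytic
    have hsys := H.isCurveSystem hf hfh (hcomp P hP) hfin
    obtain ⟨G, hsupp, hnodes, hGf, hGt, hval⟩ := hsys.exists_planarGraph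
      ⟨p, hpP, lowerArc_subset_circle hp⟩ hPn
    have hnP : G.nodes ⊆ P := hnodes ▸ hsys.union_nodes
    refine ⟨G, hsupp, hnodes ▸ subset_union_left, hGf, hGt, fun v hv => hval v ?_,
      ⟨p, hnodes ▸ Or.inl ⟨hpP, lowerArc_subset_circle hp⟩, hp⟩,
      hup.anti (inter_subset_inter_left _ hnP)⟩
    exact (hnodes.le hv.1).resolve_left fun h' => notMem_circle_of_mem_openDisc hv.2 h'.2
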